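/- **Corollary (instance-wise equivalence of HST and BW).** Work in second-order arithmetic. A real number is coded by a sequence of rationals $(q_k)_k$ with $|q_k-q_{k+i}|\le 2^{-k}$ for all $k,i$. A point of $BV=BV([0,1])$ is coded by a rational number $v$ (its *bound on the variation*) together with a sequence $(p_k)_k$ of rational polynomials such that $\|p_k-p_{k+1}\|_1\le 2^{-k}$ and $\int_0^1|p_k'|\,dx\le v$ for all $k$, where $\|p\|_1=\int_0^1|p|\,dx$; it represents the $L_1$-limit of $(p_k)_k$. Sequences of such objects are coded by single functions $X\colon\mathbb N\to\mathbb N$. * An *instance of HST* is a function $X$ coding a sequence $(f_n)_n$ of points of $BV$ with bounds on the variation $v_n$, such that for some rationals $u,v$ we have $\|f_n\|_1\le u$ and $v_n\le v$ for all $n$. $\mathrm{HST}(X)$ states: for all such $u,v$ there are a point $f\in BV$ with bound on the variation $v$ and a strictly increasing $g\colon\mathbb N\to\mathbb N$ with $f_{g(n)}\to f$ in $L_1$. * An *instance of BW* is a function $X$ coding a sequence $(x_n)_n$ of real numbers in $[0,1]$. $\mathrm{BW}(X)$ states: there are a real number $y$ and a strictly increasing $g\colon\mathbb N\to\mathbb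 N$ with $x_{g(n)}\to y$. For an $X$ that is not an instance the corresponding statement holds vacuously. Then there are (standard) codes $e_1,e_2$ of Turing functionals with oracle such that $\mathsf{RCA}_0$ proves the following, equivalently (by the completeness theorem), such that the following holds in every model $(M,S)$ of $\mathsf{RCA}_0$, not only in $\omega$-models: 1. for every instance $X$ of HST, $\{e_1\}^X$ is total and is an instance of BW, and $\mathrm{BW}(\{e_1\}^X)\rightarrow\mathrm{HST}(X)$; 2. for every instance $X$ of BW, $\{e_2\}^X$ is total and is an instance of HST, and $\mathrm{HST}(\{e_2\}^X)\rightarrow\mathrm{BW}(X)$. -/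

import Mathlib

noncomputable section

namespace SOA

/-! ## Structures for the language of second-order arithmetic -/

/-- The number part of a structure for the language of second-order arithmetic: a set `M` with
interpretations of `0`, `1`, `+`, `·`, `<`. A structure is such an `M` together with a collection
`S : Set (Set M)`, the range of the set variables. -/
class NumStr (M : Type*) extends Zero M, One M, Add M, Mul M, LT M

/-- Number terms; the number variables are de Bruijn indices. -/
inductive Tm : Type
  | var (i : ℕ)
  | zero
  | one
  | add (s t : Tm)
  | mul (s t : Tm)

/-- Bounded quantifier formulas (`Σ⁰₀` formulas). They may contain free number variables and
free set variables. `ball t φ` is `∀ x < t, φ`; in `φ` the variable `x` has index `0` and the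
other indices are shifted by one. -/
inductive BdFormula : Type
  | eq (s t : Tm)
  | lt (s t : Tm)
  | mem (t : Tm) (X : ℕ)
  | neg (φ : BdFormula)
  | and (φ ψ : BdFormula)
  | ball (t : Tm) (φ : BdFormula)

section Semantics

variable {M : Type*} [NumStr M]

/-- The assignment with value `a` at variable `0` and `v i` at variable `i + 1`. -/
def push (a : M) (v : ℕ → M) : ℕ → M
  | 0 => a
  | i + 1 => v i

def Tm.eval (v : ℕ → M) : Tm → M
  | .var i => v i
  | .zero => 0
  | .one => 1
  | .add s t => s.eval v + t.eval v
  | .mul s t => s.eval v * t.eval v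

/-- Truth of a bounded quantifier formula under an assignment `v` of numbers and `V` of sets. -/
def BdFormula.Holds (V : ℕ → Set M) : BdFormula → (ℕ → M) → Prop
  | .eq s t, v => s.eval v = t.eval v
  | .lt s t, v => s.eval v < t.eval v
  | .mem t X, v => t.eval v ∈ V X
  | .neg φ, v => ¬ φ.Holds V v
  | .and φ ψ, v => φ.Holds V v ∧ ψ.Holds V v
  | .ball t φ, v => ∀ a : M, a < t.eval v → φ.Holds V (push a v)

/-- The `Σ⁰₁` formula `∃ m, θ(m, n, parameters)` in the distinguished number variable `n`. -/
def SigmaHolds (θ : BdFormula) (V : ℕ → Set M) (v : ℕ → M) (n : M) : Prop :=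
  ∃ m : M, θ.Holds V (push m (push n v))

/-- The `Π⁰₁` formula `∀ m, θ(m, n, parameters)` in the distinguished number variable `n`. -/
def PiHolds (θ : BdFormula) (V : ℕ → Set M) (v : ℕ → M) (n : M) : Prop :=
  ∀ m : M, θ.Holds V (push m (push n v))

end Semantics

/-- `(M, S)` is a model of `RCA₀`: the basic axioms, the scheme of `Σ⁰₁` induction and the scheme of
`Δ⁰₁` comprehension, both with number and set parameters. Models need not be `ω`-models. -/
structure IsModelRCA0 (M : Type*) [NumStr M] (S : Set (Set M)) : Prop where
  sets_nonempty : S.Nonempty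
  succ_ne_zero : ∀ n : M, n + 1 ≠ 0
  succ_inj : ∀ m n : M, m + 1 = n + 1 → m = n
  add_zero : ∀ m : M, m + 0 = m
  add_succ : ∀ m n : M, m + (n + 1) = (m + n) + 1
  mul_zero : ∀ m : M, m * 0 = 0
  mul_succ : ∀ m n : M, m * (n + 1) = m * n + m
  not_lt_zero : ∀ m : M, ¬ m < 0
  lt_succ_iff : ∀ m n : M, m < n + 1 ↔ m < n ∨ m = n
  sigma_induction : ∀ (θ : BdFormula) (V : ℕ → Set M) (v : ℕ → M), (∀ i, V i ∈ S) →
    SigmaHolds θ V v 0 → (∀ n, SigmaHolds θ V v n → SigmaHolds θ V v (n + 1)) →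
    ∀ n, SigmaHolds θ V v n
  delta_comprehension : ∀ (θ ψ : BdFormula) (V : ℕ → Set M) (v : ℕ → M), (∀ i, V i ∈ S) →
    (∀ n, SigmaHolds θ V v n ↔ PiHolds ψ V v n) → {n | SigmaHolds θ V v n} ∈ S

/-! ## Coding inside a structure -/

section Coding

variable {M : Type*} [NumStr M]

/-- The defined relation `a ≤ b`. -/
def Le (a b : M) : Prop := a < b ∨ a = b

/-- The standard pairing of numbers, `(i + j)² + i`. -/
def pair (i j : M) : M := (i + j) * (i + j) + i

/-- `f` is a function of the structure: its graph is (coded by) one of the sets of the structure.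
Quantification over such `f` is quantification over those elements of `S` that are graphs. -/
def Internal (S : Set (Set M)) (f : M → M) : Prop := {z | ∃ n, z = pair n (f n)} ∈ S

/-- Gödel's beta function: the remainder of `a` modulo `b * (i + 1) + 1`. In a model of `RCA₀` the
remainder exists and is unique, and the pairs `(a, b)` code all finite sequences of numbers, of
possibly nonstandard length. -/
def beta (a b i : M) : M :=
  Classical.epsilon fun r : M =>
    r < b * (i + 1) + 1 ∧ ∃ q : M, a = q * (b * (i + 1) + 1) + r

end Coding

/-! ## Turing functionals -/

/-- Codes (programs) for the Turing functionals, i.e. for the partial recursive functionals of `k`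
number arguments with an oracle. -/
inductive OracleCode : ℕ → Type
  | zero {k : ℕ} : OracleCode k
  | succ : OracleCode 1
  | oracle : OracleCode 1
  | proj {k : ℕ} (i : Fin k) : OracleCode k
  | comp {k m : ℕ} (f : OracleCode m) (g : Fin m → OracleCode k) : OracleCode k
  | prec {k : ℕ} (f : OracleCode k) (g : OracleCode (k + 2)) : OracleCode (k + 1)
  | mu {k : ℕ} (f : OracleCode (k + 1)) : OracleCode k

section Computation

variable {M : Type*} [NumStr M]

/-- `e.Eval X v y` is the relation `{e}^X(v) = y`, evaluated inside the structure `M`, with the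
function `X` as oracle.
`prec f g` is primitive recursion on the first argument: the sequence of values is
`h 0 = f(v)`, `h (i + 1) = g(i, h i, v)`, and it is coded by the beta function.
`mu f` is the least `y` with `f(y, v) = 0` such that `f(i, v)` is defined for all `i < y`. -/
def OracleCode.Eval (X : M → M) : {k : ℕ} → OracleCode k → (Fin k → M) → M → Prop
  | _, .zero, _, y => y = 0
  | _, .succ, v, y => y = v 0 + 1
  | _, .oracle, v, y => y = X (v 0)
  | _, .proj i, v, y => y = v i
  | _, .comp (m := m) f g, v, y => ∃ w : Fin m → M, (∀ i, (g i).Eval X v (w i)) ∧ f.Eval X w y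
  | _, .prec f g, v, y => ∃ a b : M,
      f.Eval X (Fin.tail v) (beta a b 0) ∧
      (∀ i : M, i < v 0 →
        g.Eval X (Fin.cons i (Fin.cons (beta a b i) (Fin.tail v))) (beta a b (i + 1))) ∧
      y = beta a b (v 0)
  | _, .mu f, v, y =>
      f.Eval X (Fin.cons y v) 0 ∧
      ∀ i : M, i < y → ∃ z : M, z ≠ 0 ∧ f.Eval X (Fin.cons i v) z

/-- The function `{e}^X` is total and equal to `Y`. -/
def Computes (e : OracleCode 1) (X Y : M → M) : Prop :=
  ∀ n : M, e.Eval X (fun _ => n) (Y n)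

end Computation

/-! ## Rational numbers of a structure -/

/-- The rational number `(pos - neg) / (den + 1)` of the structure `M`. -/
structure Rational (M : Type*) where
  pos : M
  neg : M
  den : M

namespace Rational

variable {M : Type*} [NumStr M]

instance : Nonempty (Rational M) := ⟨⟨0, 0, 0⟩⟩

/-- The number coding a rational. A rational has many codes. -/
def code (q : Rational M) : M := pair (pair q.pos q.neg) q.den

/-- The rational coded by a number. -/
def decode (n : M) : Rational M := Classical.epsilon fun q => q.code = n

/-- The rational `n` for a number `n`. -/
def ofNum (n : M) : Rational M := ⟨n, 0, 0⟩

/-- The rational `i / (N + 1)`. -/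
def frac (i N : M) : Rational M := ⟨i, 0, N⟩

def half : Rational M := ⟨1, 0, 1⟩

/-- `(c + 1) * (d + 1) = (c * d + c + d) + 1`. -/
def mulDen (c d : M) : M := c * d + c + d

def add (p q : Rational M) : Rational M :=
  ⟨p.pos * (q.den + 1) + q.pos * (p.den + 1),
   p.neg * (q.den + 1) + q.neg * (p.den + 1),
   mulDen p.den q.den⟩

def opp (p : Rational M) : Rational M := ⟨p.neg, p.pos, p.den⟩

def sub (p q : Rational M) : Rational M := p.add q.opp

def mul (p q : Rational M) : Rational M :=
  ⟨p.pos * q.pos + p.neg * q.neg,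
   p.pos * q.neg + p.neg * q.pos,
   mulDen p.den q.den⟩

/-- The order `p ≤ q` of rational numbers. -/
def LE (p q : Rational M) : Prop :=
  Le (p.pos * (q.den + 1) + q.neg * (p.den + 1)) (q.pos * (p.den + 1) + p.neg * (q.den + 1))

/-- `0 < p`. -/
def Positive (p : Rational M) : Prop := p.neg < p.pos

open Classical in
def abs (p : Rational M) : Rational M := if Le p.neg p.pos then p else p.opp

/-- The value at `n` of the function `h` with `h 0 = z`, `h (i + 1) = step i (h i)`. In a model
of `RCA₀` it exists and is unique for all `step` defined from such recursions; the witness is the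
finite sequence `h 0, …, h n`, coded by the beta function. -/
def primRec (z : Rational M) (step : M → Rational M → Rational M) (n : M) : Rational M :=
  Classical.epsilon fun y => ∃ a b : M,
    beta a b 0 = z.code ∧
    (∀ i : M, i < n → ∃ q : Rational M,
      beta a b i = q.code ∧ beta a b (i + 1) = (step i q).code) ∧
    beta a b n = y.code

/-- `∑_{i < n} f i`. -/
def sum (f : M → Rational M) (n : M) : Rational M :=
  primRec (ofNum 0) (fun i q => q.add (f i)) n

/-- `x ^ n`. -/
def pow (x : Rational M) (n : M) : Rational M :=
  primRec (ofNum 1) (fun _ q => q.mul x) n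

/-- `2 ^ (-n)`. -/
def twoPowNeg (n : M) : Rational M := pow half n

/-- `lim_n s n ≤ q` for a (convergent) sequence of rational numbers. -/
def LimLE (s : M → Rational M) (q : Rational M) : Prop :=
  ∀ ε : Rational M, ε.Positive → ∃ N : M, ∀ n : M, Le N n → (s n).LE (q.add ε)

end Rational

open Rational

/-! ## Rational polynomials and the `L₁`-norm -/

/-- A polynomial `∑_{i ≤ deg} c_i x^i` with rational coefficients in the sense of `M`; the
finite sequence of (codes of) the coefficients is coded by `(seqA, seqB)`. -/
structure RatPoly (M : Type*) where
  deg : M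
  seqA : M
  seqB : M

namespace RatPoly

variable {M : Type*} [NumStr M]

/-- The number coding a polynomial. -/
def code (p : RatPoly M) : M := pair (pair p.seqA p.seqB) p.deg

/-- The entries of the coefficient sequence are codes of rational numbers. -/
def Valid (p : RatPoly M) : Prop :=
  ∀ i : M, Le i p.deg → ∃ q : Rational M, beta p.seqA p.seqB i = q.code

def coeff (p : RatPoly M) (i : M) : Rational M := decode (beta p.seqA p.seqB i)

/-- `p(x)`. -/
def eval (p : RatPoly M) (x : Rational M) : Rational M :=
  sum (fun i => (p.coeff i).mul (pow x i)) (p.deg + 1)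

/-- `p'(x)`. -/
def evalDeriv (p : RatPoly M) (x : Rational M) : Rational M :=
  sum (fun i => ((ofNum (i + 1)).mul (p.coeff (i + 1))).mul (pow x i)) p.deg

end RatPoly

section Functions

variable {M : Type*} [NumStr M]

/-- The Riemann sum `1/(N+1) · ∑_{i < N+1} |f(i/(N+1))|`. -/
def riemannSum (f : Rational M → Rational M) (N : M) : Rational M :=
  (frac 1 N).mul (sum (fun i => (f (frac i N)).abs) (N + 1))

/-- `∫₀¹ |f| dx ≤ q` (Riemann integral), for `f` the difference of two rational polynomials or the
derivative of a rational polynomial. -/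
def IntAbsLE (f : Rational M → Rational M) (q : Rational M) : Prop :=
  LimLE (riemannSum f) q

/-- `‖p - q‖₁ ≤ c` for polynomials. -/
def PolyDistLE (p q : RatPoly M) (c : Rational M) : Prop :=
  IntAbsLE (fun x => (p.eval x).sub (q.eval x)) c

/-! ## The space `BV` -/

/-- `F` codes the point `((p_k)_k, v)` of `BV`: `F 0` is the code of the rational number `v` and
`F (k + 1)` is the code of `p_k`, where `‖p_k - p_{k+1}‖₁ ≤ 2^{-k}` and `∫₀¹ |p_k'| dx ≤ v`. The
number `v` is the bound on the variation of the point. -/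
structure IsBVPoint (F : M → M) (v : Rational M) (p : M → RatPoly M) : Prop where
  bound_code : F 0 = v.code
  poly_code : ∀ k, F (k + 1) = (p k).code
  valid : ∀ k, (p k).Valid
  rate : ∀ k, PolyDistLE (p k) (p (k + 1)) (twoPowNeg k)
  variation : ∀ k, IntAbsLE (p k).evalDeriv v

/-- `‖f‖₁ ≤ u`, where `f = lim_k p_k` and `‖f‖₁ = lim_k ‖p_k‖₁`. -/
def NormLE (p : M → RatPoly M) (u : Rational M) : Prop :=
  ∀ δ : Rational M, δ.Positive → ∃ K : M, ∀ k : M, Le K k → IntAbsLE (p k).eval (u.add δ)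

/-- `‖f - g‖₁ ≤ c`, where `f = lim_k p_k` and `g = lim_k q_k`. -/
def DistLE (p q : M → RatPoly M) (c : Rational M) : Prop :=
  ∀ δ : Rational M, δ.Positive → ∃ K : M, ∀ k : M, Le K k → PolyDistLE (p k) (q k) (c.add δ)

/-- The `n`-th component of a function coding a sequence of functions. -/
def component (X : M → M) (n : M) : M → M := fun k => X (pair n k)

/-- `g` is strictly increasing. -/
def StrictIncr (g : M → M) : Prop := ∀ m n : M, m < n → g m < g n

/-! ## The two principles, restricted to a single instance -/

/-- `X` codes the sequence of points `f_n = ((p_{n,k})_k, v_n)` of `BV`. -/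
def CodesBVSeq (X : M → M) (v : M → Rational M) (p : M → M → RatPoly M) : Prop :=
  ∀ n, IsBVPoint (component X n) (v n) (p n)

/-- The hypotheses of Helly's selection theorem: `‖f_n‖₁ ≤ u` and `v_n ≤ w` for all `n`. -/
def UniformlyBounded (v : M → Rational M) (p : M → M → RatPoly M) (u w : Rational M) : Prop :=
  (∀ n, NormLE (p n) u) ∧ ∀ n, (v n).LE w

/-- `X` codes an instance of Helly's selection theorem. -/
def IsHSTInstance (X : M → M) : Prop :=
  ∃ v p, CodesBVSeq X v p ∧ ∃ u w, UniformlyBounded v p u w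

/-- Helly's selection theorem for the instance coded by `X`: whenever `X` codes a sequence `f_n` in
`BV` and `‖f_n‖₁ ≤ u`, `v_n ≤ w` for all `n`, there are a point `f` of `BV` with bound on the
variation `w` and a subsequence `f_{g(n)}` converging to `f` in `L₁`. -/
def HST (S : Set (Set M)) (X : M → M) : Prop :=
  ∀ v p, CodesBVSeq X v p → ∀ u w, UniformlyBounded v p u w →
    ∃ (F : M → M) (q : M → RatPoly M) (g : M → M),
      Internal S F ∧ IsBVPoint F w q ∧ Internal S g ∧ StrictIncr g ∧
      ∀ ε : Rational M, ε.Positive → ∃ m : M, ∀ n : M, Le m n → DistLE (p (g n)) q ε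

/-- `F` codes the real number given by the sequence `x` of rational numbers, which satisfies
`|x_k - x_{k+i}| ≤ 2^{-k}`. -/
structure IsReal (F : M → M) (x : M → Rational M) : Prop where
  code : ∀ k, F k = (x k).code
  rate : ∀ k i, ((x k).sub (x (k + i))).abs.LE (twoPowNeg k)

/-- `|x - y| ≤ c` for real numbers. -/
def RealDistLE (x y : M → Rational M) (c : Rational M) : Prop :=
  LimLE (fun k => ((x k).sub (y k)).abs) c

/-- `X` codes the sequence `(x_n)_n` of real numbers in `[0,1]`. -/
def CodesUnitSeq (X : M → M) (x : M → M → Rational M) : Prop :=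
  ∀ n, IsReal (component X n) (x n) ∧ LimLE (x n) (ofNum 1) ∧
    LimLE (fun k => (x n k).opp) (ofNum 0)

/-- `X` codes an instance of the Bolzano–Weierstraß principle. -/
def IsBWInstance (X : M → M) : Prop := ∃ x, CodesUnitSeq X x

/-- The Bolzano–Weierstraß principle for the instance coded by `X`: whenever `X` codes a sequence
`x_n` in `[0,1]`, there are a real number `y` and a subsequence `x_{g(n)}` converging to `y`. -/
def BW (S : Set (Set M)) (X : M → M) : Prop :=
  ∀ x, CodesUnitSeq X x →
    ∃ (F : M → M) (y : M → Rational M) (g : M → M),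
      Internal S F ∧ IsReal F y ∧ Internal S g ∧ StrictIncr g ∧
      ∀ ε : Rational M, ε.Positive → ∃ m : M, ∀ n : M, Le m n → RealDistLE (x (g n)) y ε

end Functions

end SOA

end

open SOA

noncomputable section

namespace SOA

universe u v

/-! ## Renaming of variables -/

/-! Both reductions are explicit constructions on codes. From BW to HST, a real number becomes a
constant function: the rational approximations of x_n are read as constant polynomials, with bound 0
on the variation. A limit point with bound 0 is given by polynomials whose variation on every
rational grid is 0, so their values at 0 form the desired limit real (`bw_of_hst_constSeq`). From
HST to BW, let P_n be the n-th polynomial p_{n,n} of the point f_n. Its distance from f_n is at most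
2·2^{-n}. The i-th digit of P_n, for i coding (a, b, c, N), records whether P_n(a/(N+1)) ≤ (b -
c)/(N+1), and x_n is the sum of 4^{-(i+1)} over the i < n with digit 1. Base 4 with digits 0 and 1
excludes carries, so closeness of x_n and x_l forces the first digits to agree (`digits_agree`).
Agreement locates the values on the grid of mesh 1/(N+1) up to 1/(N+1), and bounded variation turns
this into closeness in L₁ (`rs_close`). Hence a convergent subsequence of (x_n) makes the
corresponding P_n Cauchy with an explicit rate. The limit point is q_k = P_{s(k)}, where s(k) is
found by searching for an index at which x is close to an approximation of the limit real
(`hst_of_bw`). The bounds u and w enter only the verification, so x_n is computable from X alone.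
All this takes place in a possibly nonstandard model with Σ⁰₁ induction only. A bound on an integral
is a limit statement, too complex for induction. It is exchanged for inequalities between Riemann
sums: if V bounds the variation on all grids, then ∫|f| ≤ c means that the sum on the grid N is at
most c + V/(N+1) for all N (`rs_le_of_lim`, `lim_of_forall_rs_le`). The variation is bounded by
∫|p'| through a Taylor estimate (`gvar_le_of_variation`). Chains of nonstandard length are then
summed by Δ⁰₁ induction on a fixed grid (`BVFacts.rs_chain`). The codes have to be chosen before the
model. Definability is therefore developed for families of structures, with one formula for the
whole family and instance search as the prover. In the family of all models equipped with an
instance (`World`), a total function with a Σ⁰₁ graph in the oracle is compiled into a single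
program (`exists_oracleCode`). Recursions rest on the beta function, whose coding property is proved
from the axioms (`exists_beta`). -/

def Tm.rename (ρ : ℕ → ℕ) : Tm → Tm
  | .var i => .var (ρ i)
  | .zero => .zero
  | .one => .one
  | .add s t => .add (s.rename ρ) (t.rename ρ)
  | .mul s t => .mul (s.rename ρ) (t.rename ρ)

def liftRen (ρ : ℕ → ℕ) : ℕ → ℕ
  | 0 => 0
  | i + 1 => ρ i + 1

def BdFormula.rename (σ : ℕ → ℕ) : (ℕ → ℕ) → BdFormula → BdFormula
  | ρ, .eq s t => .eq (s.rename ρ) (t.rename ρ)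
  | ρ, .lt s t => .lt (s.rename ρ) (t.rename ρ)
  | ρ, .mem t X => .mem (t.rename ρ) (σ X)
  | ρ, .neg φ => .neg (φ.rename σ ρ)
  | ρ, .and φ ψ => .and (φ.rename σ ρ) (ψ.rename σ ρ)
  | ρ, .ball t φ => .ball (t.rename ρ) (φ.rename σ (liftRen ρ))

section
variable {M : Type u} [NumStr M]

theorem Tm.eval_rename (ρ : ℕ → ℕ) (v : ℕ → M) (t : Tm) :
    (t.rename ρ).eval v = t.eval (fun n => v (ρ n)) := by
  induction t <;> simp_all [Tm.rename, Tm.eval]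

theorem push_liftRen (a : M) (v : ℕ → M) (ρ : ℕ → ℕ) :
    (fun n => push a v (liftRen ρ n)) = push a (fun n => v (ρ n)) := by
  funext n; cases n <;> rfl

theorem BdFormula.holds_rename (σ : ℕ → ℕ) (V : ℕ → Set M) (φ : BdFormula) :
    ∀ (ρ : ℕ → ℕ) (v : ℕ → M),
      (φ.rename σ ρ).Holds V v ↔ φ.Holds (fun n => V (σ n)) (fun n => v (ρ n)) := by
  induction φ with
  | eq s t => intro ρ v; simp [BdFormula.rename, BdFormula.Holds, Tm.eval_rename]
  | lt s t => intro ρ v; simp [BdFormula.rename, BdFormula.Holds, Tm.eval_rename]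
  | mem t X => intro ρ v; simp [BdFormula.rename, BdFormula.Holds, Tm.eval_rename]
  | neg φ ih => intro ρ v; simp [BdFormula.rename, BdFormula.Holds, ih]
  | and φ ψ ih ih' => intro ρ v; simp [BdFormula.rename, BdFormula.Holds, ih, ih']
  | ball t φ ih =>
    intro ρ v
    simp [BdFormula.rename, BdFormula.Holds, ih, Tm.eval_rename, push_liftRen]

/-- The assignment with values `v` at the even and `p` at the odd variables. -/
def mix (v p : ℕ → M) (n : ℕ) : M := if n % 2 = 0 then v (n / 2) else p (n / 2)

theorem mix_even (v p : ℕ → M) (n : ℕ) : mix v p (2 * n) = v n := by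
  simp [mix]

theorem mix_odd (v p : ℕ → M) (n : ℕ) : mix v p (2 * n + 1) = p n := by
  have : (2 * n + 1) / 2 = n := by omega
  simp [mix, this]

end

/-! ## Definability over a family of structures -/

/-- A model of `RCA₀`, as a structure on its number part. -/
class Mod (M : Type u) [NumStr M] where
  S : Set (Set M)
  model : IsModelRCA0 M S

section Definability

variable {ι : Type v} {M : ι → Type u} [∀ i, NumStr (M i)]

/-- The set and number parameters allowed in definitions over a family of structures. -/
structure Pars (M : ι → Type u) where
  sets : Set (∀ i, Set (M i))
  nums : Set (∀ i, M i)
  sets_nonempty : sets.Nonempty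
  nums_nonempty : nums.Nonempty

variable (C : Pars M)

/-- `t` is given by a term, uniformly in the family. -/
class IsTm (t : ∀ i, (ℕ → M i) → M i) : Prop where
  out : ∃ (τ : Tm) (p : ℕ → ∀ i, M i), (∀ j, p j ∈ C.nums) ∧
    ∀ i v, t i v = τ.eval (mix v (fun j => p j i))

/-- `R` is defined by a bounded quantifier formula, uniformly in the family. -/
class D0 (R : ∀ i, (ℕ → M i) → Prop) : Prop where
  out : ∃ (θ : BdFormula) (A : ℕ → ∀ i, Set (M i)) (p : ℕ → ∀ i, M i),
    (∀ j, A j ∈ C.sets) ∧ (∀ j, p j ∈ C.nums) ∧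
    ∀ i v, R i v ↔ θ.Holds (fun j => A j i) (mix v (fun j => p j i))

/-- `R` is defined by a `Σ⁰₁` formula, uniformly in the family. -/
class Sg (R : ∀ i, (ℕ → M i) → Prop) : Prop where
  out : ∃ Q : ∀ i, M i → (ℕ → M i) → Prop,
    D0 C (fun i v => Q i (v 0) (fun n => v (n + 1))) ∧ ∀ i v, R i v ↔ ∃ m, Q i m v

variable {C}

theorem Sg.of_exists {Q : ∀ i, M i → (ℕ → M i) → Prop}
    (h : D0 C (fun i v => Q i (v 0) (fun n => v (n + 1)))) : Sg C (fun i v => ∃ m, Q i m v) :=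
  ⟨Q, h, fun _ _ => Iff.rfl⟩

/-- interleaving two sequences -/
def ileave {α : Type*} (a b : ℕ → α) (n : ℕ) : α := if n % 2 = 0 then a (n / 2) else b (n / 2)

theorem ileave_even {α : Type*} (a b : ℕ → α) (n : ℕ) : ileave a b (2 * n) = a n := by
  simp [ileave]

theorem ileave_odd {α : Type*} (a b : ℕ → α) (n : ℕ) : ileave a b (2 * n + 1) = b n := by
  have : (2 * n + 1) / 2 = n := by omega
  simp [ileave, this]

/-- The renaming of the odd variables by `f`. -/
def oddRen (f : ℕ → ℕ) (n : ℕ) : ℕ := if n % 2 = 0 then n else 2 * f (n / 2) + 1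

theorem mix_oddRen {N : Type*} [NumStr N] (v p : ℕ → N) (f : ℕ → ℕ) :
    (fun n => mix v p (oddRen f n)) = mix v (fun n => p (f n)) := by
  funext n
  rcases Nat.even_or_odd' n with ⟨k, rfl | rfl⟩
  · have : oddRen f (2 * k) = 2 * k := by simp [oddRen]
    rw [this, mix_even, mix_even]
  · have : oddRen f (2 * k + 1) = 2 * f k + 1 := by
      have : (2 * k + 1) / 2 = k := by omega
      simp [oddRen, this]
    rw [this, mix_odd, mix_odd]

theorem ileave_mem {α : Type*} {s : Set α} {a b : ℕ → α} (ha : ∀ j, a j ∈ s) (hb : ∀ j, b j ∈ s)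
    (j : ℕ) : ileave a b j ∈ s := by
  unfold ileave; split <;> simp [ha, hb]

/-- Two expressions with separate parameter lists are brought onto one list by interleaving the
lists and renaming the parameter variables. This and its three companions give closure under
operations and connectives. -/
theorem Tm.eval_ileave_left {i : ι} (τ : Tm) (p q : ℕ → ∀ i, M i) (v : ℕ → M i) :
    (τ.rename (oddRen (fun k => 2 * k))).eval (mix v (fun j => ileave p q j i))
      = τ.eval (mix v (fun j => p j i)) := by
  rw [Tm.eval_rename, mix_oddRen]; simp [ileave_even]

theorem Tm.eval_ileave_right {i : ι} (τ : Tm) (p q : ℕ → ∀ i, M i) (v : ℕ → M i) :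
    (τ.rename (oddRen (fun k => 2 * k + 1))).eval (mix v (fun j => ileave p q j i))
      = τ.eval (mix v (fun j => q j i)) := by
  rw [Tm.eval_rename, mix_oddRen]; simp [ileave_odd]

theorem BdFormula.holds_ileave_left {i : ι} (θ : BdFormula) (A B : ℕ → ∀ i, Set (M i))
    (p q : ℕ → ∀ i, M i) (v : ℕ → M i) :
    (θ.rename (fun k => 2 * k) (oddRen (fun k => 2 * k))).Holds (fun j => ileave A B j i)
      (mix v (fun j => ileave p q j i)) ↔ θ.Holds (fun j => A j i) (mix v (fun j => p j i)) := by
  rw [BdFormula.holds_rename, mix_oddRen]; simp [ileave_even]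

theorem BdFormula.holds_ileave_right {i : ι} (θ : BdFormula) (A B : ℕ → ∀ i, Set (M i))
    (p q : ℕ → ∀ i, M i) (v : ℕ → M i) :
    (θ.rename (fun k => 2 * k + 1) (oddRen (fun k => 2 * k + 1))).Holds (fun j => ileave A B j i)
      (mix v (fun j => ileave p q j i)) ↔ θ.Holds (fun j => B j i) (mix v (fun j => q j i)) := by
  rw [BdFormula.holds_rename, mix_oddRen]; simp [ileave_odd]

instance IsTm.var (k : ℕ) : IsTm C (fun _ v => v k) := by
  obtain ⟨c, hc⟩ := C.nums_nonempty
  exact ⟨.var (2 * k), fun _ => c, fun _ => hc, fun i v => by simp [Tm.eval, mix_even]⟩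

instance IsTm.zero : IsTm C (fun _ _ => 0) := by
  obtain ⟨c, hc⟩ := C.nums_nonempty
  exact ⟨.zero, fun _ => c, fun _ => hc, fun i v => by simp [Tm.eval]⟩

instance IsTm.one : IsTm C (fun _ _ => 1) := by
  obtain ⟨c, hc⟩ := C.nums_nonempty
  exact ⟨.one, fun _ => c, fun _ => hc, fun i v => by simp [Tm.eval]⟩

theorem IsTm.par {c : ∀ i, M i} (hc : c ∈ C.nums) : IsTm C (fun i _ => c i) :=
  ⟨.var 1, fun _ => c, fun _ => hc, fun i v => by simp [Tm.eval, mix]⟩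

instance IsTm.add {s t : ∀ i, (ℕ → M i) → M i} [hs : IsTm C s] [ht : IsTm C t] :
    IsTm C (fun i v => s i v + t i v) := by
  obtain ⟨σ, p, hp, hs⟩ := hs
  obtain ⟨τ, q, hq, ht⟩ := ht
  refine ⟨.add (σ.rename (oddRen (fun k => 2 * k))) (τ.rename (oddRen (fun k => 2 * k + 1))),
    ileave p q, ileave_mem hp hq, fun i v => ?_⟩
  simp only [Tm.eval, Tm.eval_ileave_left, Tm.eval_ileave_right, hs, ht]

instance IsTm.mul {s t : ∀ i, (ℕ → M i) → M i} [hs : IsTm C s] [ht : IsTm C t] :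
    IsTm C (fun i v => s i v * t i v) := by
  obtain ⟨σ, p, hp, hs⟩ := hs
  obtain ⟨τ, q, hq, ht⟩ := ht
  refine ⟨.mul (σ.rename (oddRen (fun k => 2 * k))) (τ.rename (oddRen (fun k => 2 * k + 1))),
    ileave p q, ileave_mem hp hq, fun i v => ?_⟩
  simp only [Tm.eval, Tm.eval_ileave_left, Tm.eval_ileave_right, hs, ht]

instance D0.eq {s t : ∀ i, (ℕ → M i) → M i} [hs : IsTm C s] [ht : IsTm C t] :
    D0 C (fun i v => s i v = t i v) := by
  obtain ⟨σ, p, hp, hs⟩ := hs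
  obtain ⟨τ, q, hq, ht⟩ := ht
  obtain ⟨A, hA⟩ := C.sets_nonempty
  refine ⟨.eq (σ.rename (oddRen (fun k => 2 * k))) (τ.rename (oddRen (fun k => 2 * k + 1))),
    fun _ => A, ileave p q, fun _ => hA, ileave_mem hp hq, fun i v => ?_⟩
  simp only [BdFormula.Holds, Tm.eval_ileave_left, Tm.eval_ileave_right, hs, ht]

instance D0.lt {s t : ∀ i, (ℕ → M i) → M i} [hs : IsTm C s] [ht : IsTm C t] :
    D0 C (fun i v => s i v < t i v) := by
  obtain ⟨σ, p, hp, hs⟩ := hs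
  obtain ⟨τ, q, hq, ht⟩ := ht
  obtain ⟨A, hA⟩ := C.sets_nonempty
  refine ⟨.lt (σ.rename (oddRen (fun k => 2 * k))) (τ.rename (oddRen (fun k => 2 * k + 1))),
    fun _ => A, ileave p q, fun _ => hA, ileave_mem hp hq, fun i v => ?_⟩
  simp only [BdFormula.Holds, Tm.eval_ileave_left, Tm.eval_ileave_right, hs, ht]

theorem D0.mem {t : ∀ i, (ℕ → M i) → M i} [ht : IsTm C t] {A : ∀ i, Set (M i)}
    (hA : A ∈ C.sets) : D0 C (fun i v => t i v ∈ A i) := by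
  obtain ⟨τ, q, hq, ht⟩ := ht
  exact ⟨.mem τ 0, fun _ => A, q, fun _ => hA, hq, fun i v => by
    simp only [BdFormula.Holds, ht]⟩

instance D0.not {R : ∀ i, (ℕ → M i) → Prop} [h : D0 C R] : D0 C (fun i v => ¬ R i v) := by
  obtain ⟨θ, A, p, hA, hp, h⟩ := h
  exact ⟨.neg θ, A, p, hA, hp, fun i v => by simp only [BdFormula.Holds, h]⟩

instance D0.and {R Q : ∀ i, (ℕ → M i) → Prop} [h : D0 C R] [h' : D0 C Q] :
    D0 C (fun i v => R i v ∧ Q i v) := by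
  obtain ⟨θ, A, p, hA, hp, h⟩ := h
  obtain ⟨θ', A', p', hA', hp', h'⟩ := h'
  refine ⟨.and (θ.rename (fun k => 2 * k) (oddRen (fun k => 2 * k)))
    (θ'.rename (fun k => 2 * k + 1) (oddRen (fun k => 2 * k + 1))),
    ileave A A', ileave p p', ileave_mem hA hA', ileave_mem hp hp', fun i v => ?_⟩
  simp only [BdFormula.Holds, BdFormula.holds_ileave_left, BdFormula.holds_ileave_right, h, h']

theorem D0.congr {R Q : ∀ i, (ℕ → M i) → Prop} (h : D0 C R) (e : ∀ i v, Q i v ↔ R i v) :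
    D0 C Q := by
  obtain ⟨θ, A, p, hA, hp, h⟩ := h
  exact ⟨θ, A, p, hA, hp, fun i v => (e i v).trans (h i v)⟩

instance D0.or {R Q : ∀ i, (ℕ → M i) → Prop} [h : D0 C R] [h' : D0 C Q] :
    D0 C (fun i v => R i v ∨ Q i v) :=
  D0.congr (inferInstance : D0 C (fun i v => ¬ (¬ R i v ∧ ¬ Q i v))) (fun i v => by tauto)

instance D0.imp {R Q : ∀ i, (ℕ → M i) → Prop} [h : D0 C R] [h' : D0 C Q] :
    D0 C (fun i v => R i v → Q i v) :=
  D0.congr (inferInstance : D0 C (fun i v => ¬ (R i v ∧ ¬ Q i v))) (fun i v => by tauto)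

/-- The renaming taking the variables of `mix (push a v) p` to those of `push a (mix v p)`. -/
def pushRen (n : ℕ) : ℕ := if n = 0 then 0 else if n % 2 = 0 then n - 1 else n + 1

theorem mix_push {N : Type*} [NumStr N] (a : N) (v p : ℕ → N) :
    (fun n => push a (mix v p) (pushRen n)) = mix (push a v) p := by
  funext n
  rcases Nat.even_or_odd' n with ⟨k, rfl | rfl⟩
  · cases k with
    | zero => rfl
    | succ k =>
      have : pushRen (2 * (k + 1)) = 2 * k + 1 := by
        simp [pushRen]; omega
      rw [this, mix_even]
      exact mix_even v p k
  · have : pushRen (2 * k + 1) = (2 * k + 1) + 1 := by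
      simp [pushRen]
    rw [this, mix_odd]
    exact mix_odd v p k

/-- The bound variable is `v 0` and the others are shifted, in agreement with `push`. Instances of
this shape let unification go under quantifiers, so that later definability goals are closed by
instance search. -/
instance D0.ball {t : ∀ i, (ℕ → M i) → M i} {Q : ∀ i, M i → (ℕ → M i) → Prop} [ht : IsTm C t]
    [hQ : D0 C (fun i v => Q i (v 0) (fun n => v (n + 1)))] :
    D0 C (fun i v => ∀ a, a < t i v → Q i a v) := by
  obtain ⟨τ, q, hq, ht⟩ := ht
  obtain ⟨θ, A, p, hA, hp, h⟩ := hQ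
  refine ⟨.ball (τ.rename (oddRen (fun k => 2 * k)))
    ((θ.rename (fun k => k) (oddRen (fun k => 2 * k + 1))).rename (fun k => k) pushRen),
    A, ileave q p, hA, ileave_mem hq hp, fun i v => ?_⟩
  simp only [BdFormula.Holds, Tm.eval_ileave_left]
  rw [ht]
  refine forall_congr' fun a => imp_congr_right fun _ => ?_
  have := h i (push a v)
  simp only [push] at this
  rw [this, BdFormula.holds_rename, mix_push, BdFormula.holds_rename, mix_oddRen]
  simp only [ileave_odd]

instance D0.bex {t : ∀ i, (ℕ → M i) → M i} {Q : ∀ i, M i → (ℕ → M i) → Prop} [ht : IsTm C t]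
    [hQ : D0 C (fun i v => Q i (v 0) (fun n => v (n + 1)))] :
    D0 C (fun i v => ∃ a, a < t i v ∧ Q i a v) :=
  D0.congr (inferInstance : D0 C (fun i v => ¬ ∀ a, a < t i v → ¬ Q i a v))
    (fun i v => by push Not; rfl)

theorem D0.reindex {R : ∀ i, (ℕ → M i) → Prop} (h : D0 C R) (ρ : ℕ → ℕ) :
    D0 C (fun i v => R i (fun n => v (ρ n))) := by
  obtain ⟨θ, A, p, hA, hp, h⟩ := h
  refine ⟨θ.rename (fun k => k) (fun n => if n % 2 = 0 then 2 * ρ (n / 2) else n),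
    A, p, hA, hp, fun i v => ?_⟩
  rw [h, BdFormula.holds_rename]
  have : (fun n => mix v (fun j => p j i) (if n % 2 = 0 then 2 * ρ (n / 2) else n)) =
      mix (fun n => v (ρ n)) (fun j => p j i) := by
    funext n
    rcases Nat.even_or_odd' n with ⟨k, rfl | rfl⟩
    · simp [mix]
    · simp [mix]
  rw [this]

theorem Sg.congr {R Q : ∀ i, (ℕ → M i) → Prop} (h : Sg C R) (e : ∀ i v, Q i v ↔ R i v) :
    Sg C Q := by
  obtain ⟨P, hP, h⟩ := h
  exact ⟨P, hP, fun i v => (e i v).trans (h i v)⟩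

theorem Sg.of_D0 {R : ∀ i, (ℕ → M i) → Prop} [h : D0 C R] : Sg C R :=
  ⟨fun i _ v => R i v, D0.reindex h (fun n => n + 1), fun i v => ⟨fun h => ⟨0, h⟩, fun ⟨_, h⟩ => h⟩⟩

/-- The normal form used by the axiom schemes: variable 0 is the distinguished number, all else is
parameters. -/
theorem Sg.sigmaHolds {R : ∀ i, (ℕ → M i) → Prop} (h : Sg C R) :
    ∃ (θ : BdFormula) (A : ℕ → ∀ i, Set (M i)) (p : ℕ → ∀ i, M i),
    (∀ j, A j ∈ C.sets) ∧ (∀ j, p j ∈ C.nums) ∧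
    ∀ i n v, R i (push n v) ↔
      SigmaHolds θ (fun j => A j i) (mix v (fun j => p j i)) n := by
  obtain ⟨Q, ⟨θ, A, p, hA, hp, h⟩, hR⟩ := h
  refine ⟨(θ.rename (fun k => k) pushRen).rename (fun k => k) (liftRen pushRen),
    A, p, hA, hp, fun i n v => ?_⟩
  rw [hR]
  refine exists_congr fun m => ?_
  have : Q i m (push n v) ↔ _ := h i (push m (push n v))
  rw [this, BdFormula.holds_rename, push_liftRen, BdFormula.holds_rename, mix_push, mix_push]

end Definability

/-! ### Induction in a single structure with all its parameters -/

section Single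

variable (M : Type u) [NumStr M] [m : Mod M]

/-- All parameters of a single structure. -/
def full : Pars (fun _ : Unit => M) where
  sets := {A | A () ∈ m.S}
  nums := Set.univ
  sets_nonempty := by
    obtain ⟨A, hA⟩ := m.model.sets_nonempty
    exact ⟨fun _ => A, hA⟩
  nums_nonempty := ⟨fun _ => 0, trivial⟩

variable {M}

instance IsTm.const (c : M) : IsTm (full M) (fun _ _ => c) :=
  IsTm.par (C := full M) (c := fun _ => c) trivial

theorem induct {P : M → Prop} (hP : Sg (full M) (fun _ v => P (v 0))) (h0 : P 0)
    (hs : ∀ n, P n → P (n + 1)) (n : M) : P n := by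
  obtain ⟨θ, A, p, hA, -, h⟩ := hP.sigmaHolds
  have h' : ∀ n, P n ↔ SigmaHolds θ (fun j => A j ()) (mix (fun _ => 0) (fun j => p j ())) n :=
    fun n => h () n (fun _ => 0)
  rw [h']
  refine m.model.sigma_induction _ _ _ (fun j => hA j) ((h' 0).1 h0) (fun k hk => ?_) n
  exact (h' _).1 (hs k ((h' k).2 hk))

theorem induct0 {P : M → Prop} (hP : D0 (full M) (fun _ v => P (v 0))) (h0 : P 0)
    (hs : ∀ n, P n → P (n + 1)) (n : M) : P n :=
  induct Sg.of_D0 h0 hs n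

end Single

/-! ## Arithmetic -/

namespace Arith

variable {M : Type u} [NumStr M] [m : Mod M]

theorem zero_add' (a : M) : 0 + a = a := by
  refine induct0 (P := fun a => 0 + a = a) inferInstance (m.model.add_zero _) (fun n hn => ?_) a
  rw [m.model.add_succ, hn]

theorem succ_add' (a b : M) : a + 1 + b = a + b + 1 := by
  refine induct0 (P := fun b => a + 1 + b = a + b + 1) inferInstance ?_ (fun n hn => ?_) b
  · rw [m.model.add_zero, m.model.add_zero]
  · rw [m.model.add_succ, hn, m.model.add_succ]

theorem add_comm' (a b : M) : a + b = b + a := by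
  refine induct0 (P := fun b => a + b = b + a) inferInstance ?_ (fun n hn => ?_) b
  · rw [m.model.add_zero, zero_add']
  · rw [m.model.add_succ, hn, succ_add']

theorem add_assoc' (a b c : M) : a + b + c = a + (b + c) := by
  refine induct0 (P := fun c => a + b + c = a + (b + c)) inferInstance ?_ (fun n hn => ?_) c
  · rw [m.model.add_zero, m.model.add_zero]
  · rw [m.model.add_succ, hn, m.model.add_succ, m.model.add_succ]

theorem zero_mul' (a : M) : 0 * a = 0 := by
  refine induct0 (P := fun a => 0 * a = 0) inferInstance (m.model.mul_zero _) (fun n hn => ?_) a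
  rw [m.model.mul_succ, hn, m.model.add_zero]

theorem succ_mul' (a b : M) : (a + 1) * b = a * b + b := by
  refine induct0 (P := fun b => (a + 1) * b = a * b + b) inferInstance ?_ (fun n hn => ?_) b
  · rw [m.model.mul_zero, m.model.mul_zero, m.model.add_zero]
  · rw [m.model.mul_succ, hn, m.model.mul_succ, add_assoc', add_assoc', m.model.add_succ,
      add_comm' n a, add_assoc']

theorem mul_comm' (a b : M) : a * b = b * a := by
  refine induct0 (P := fun b => a * b = b * a) inferInstance ?_ (fun n hn => ?_) b
  · rw [m.model.mul_zero, zero_mul']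
  · rw [m.model.mul_succ, hn, succ_mul']

theorem mul_add' (a b c : M) : a * (b + c) = a * b + a * c := by
  refine induct0 (P := fun c => a * (b + c) = a * b + a * c) inferInstance ?_ (fun n hn => ?_) c
  · rw [m.model.add_zero, m.model.mul_zero, m.model.add_zero]
  · rw [m.model.add_succ, m.model.mul_succ, hn, m.model.mul_succ, add_assoc']

theorem mul_assoc' (a b c : M) : a * b * c = a * (b * c) := by
  refine induct0 (P := fun c => a * b * c = a * (b * c)) inferInstance ?_ (fun n hn => ?_) c
  · rw [m.model.mul_zero, m.model.mul_zero, m.model.mul_zero]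
  · rw [m.model.mul_succ, hn, m.model.mul_succ, mul_add']

theorem mul_one' (a : M) : a * 1 = a := by
  rw [← zero_add' (1 : M), m.model.mul_succ, m.model.mul_zero, zero_add']

theorem add_right_cancel' (a b c : M) (h : a + c = b + c) : a = b := by
  have := induct0 (P := fun c => a + c = b + c → a = b) inferInstance
    (by rw [m.model.add_zero, m.model.add_zero]; exact id) (fun n hn h => ?_) c
  · exact this h
  · rw [m.model.add_succ, m.model.add_succ] at h
    exact hn (m.model.succ_inj _ _ h)

theorem zero_or_succ (a : M) : a = 0 ∨ ∃ b, a = b + 1 := by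
  -- The quantifier is moved to the front because so far only a single quantifier before a bounded
  -- formula is recognised as Σ⁰₁. For 0 the witness is arbitrary.
  have := induct (P := fun a => ∃ b, a = 0 ∨ a = b + 1) (Sg.of_exists inferInstance)
    ⟨0, .inl rfl⟩ (fun n _ => ⟨n, .inr rfl⟩) a
  obtain ⟨b, h | h⟩ := this
  exacts [.inl h, .inr ⟨b, h⟩]

theorem lt_iff_add (a b : M) : a < b ↔ ∃ c, b = a + (c + 1) := by
  constructor
  · intro h
    -- Prenexed for the same reason; the witness is irrelevant while a < b fails.
    have := induct (P := fun b => ∃ c, a < b → b = a + (c + 1)) (Sg.of_exists inferInstance)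
      ⟨0, fun h => (m.model.not_lt_zero _ h).elim⟩ (fun n ⟨c, hc⟩ => ?_) b
    · obtain ⟨c, hc⟩ := this
      exact ⟨c, hc h⟩
    · by_cases han : a = n
      · exact ⟨0, fun _ => by rw [han, zero_add']⟩
      · refine ⟨c + 1, fun h => ?_⟩
        rcases (m.model.lt_succ_iff _ _).1 h with h | h
        · rw [m.model.add_succ, ← hc h]
        · exact (han h).elim
  · rintro ⟨c, rfl⟩
    refine induct0 (P := fun c => a < a + (c + 1)) inferInstance ?_ (fun n hn => ?_) c
    · rw [zero_add']; exact (m.model.lt_succ_iff _ _).2 (.inr rfl)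
    · rw [m.model.add_succ]; exact (m.model.lt_succ_iff _ _).2 (.inl hn)

theorem trichotomy (a b : M) : a < b ∨ a = b ∨ b < a := by
  refine induct0 (P := fun b => a < b ∨ a = b ∨ b < a) inferInstance ?_ (fun n hn => ?_) b
  · rcases zero_or_succ a with h | ⟨c, rfl⟩
    · exact .inr (.inl h)
    · exact .inr (.inr ((lt_iff_add _ _).2 ⟨c, (zero_add' _).symm⟩))
  · rcases hn with h | h | h
    · exact .inl ((m.model.lt_succ_iff _ _).2 (.inl h))
    · exact .inl ((m.model.lt_succ_iff _ _).2 (.inr h))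
    · obtain ⟨c, rfl⟩ := (lt_iff_add _ _).1 h
      rcases zero_or_succ c with rfl | ⟨d, rfl⟩
      · rw [zero_add']; exact .inr (.inl rfl)
      · refine .inr (.inr ((lt_iff_add _ _).2 ⟨d, ?_⟩))
        rw [add_assoc', add_assoc', add_comm' 1 (d + 1), add_assoc' d]

theorem lt_irrefl' (a : M) : ¬ a < a := by
  intro h
  obtain ⟨c, hc⟩ := (lt_iff_add _ _).1 h
  refine m.model.succ_ne_zero c (add_right_cancel' _ _ a ?_)
  rw [zero_add', add_comm']; exact hc.symm

theorem lt_trans' {a b c : M} (h : a < b) (h' : b < c) : a < c := by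
  obtain ⟨d, rfl⟩ := (lt_iff_add _ _).1 h
  obtain ⟨e, rfl⟩ := (lt_iff_add _ _).1 h'
  exact (lt_iff_add _ _).2 ⟨d + 1 + e, by rw [add_assoc', m.model.add_succ (d + 1) e]⟩

end Arith

/-! ### The ordered semiring structure of a model -/

section Instances

variable {M : Type u} [NumStr M] [m : Mod M]

instance instCommSemiring : CommSemiring M where
  add_assoc := Arith.add_assoc'
  zero_add := Arith.zero_add'
  add_zero := m.model.add_zero
  add_comm := Arith.add_comm'
  left_distrib := Arith.mul_add'
  right_distrib a b c := by rw [Arith.mul_comm', Arith.mul_add', Arith.mul_comm' c a, Arith.mul_comm' c b]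
  zero_mul := Arith.zero_mul'
  mul_zero := m.model.mul_zero
  mul_assoc := Arith.mul_assoc'
  one_mul a := by rw [Arith.mul_comm', Arith.mul_one']
  mul_one := Arith.mul_one'
  mul_comm := Arith.mul_comm'
  nsmul := nsmulRec
  npow := npowRec

instance instLinearOrder : LinearOrder M where
  le := Le
  lt := (· < ·)
  le_refl _ := .inr rfl
  le_trans a b c h h' := by
    rcases h with h | rfl
    · rcases h' with h' | rfl
      · exact .inl (Arith.lt_trans' h h')
      · exact .inl h
    · exact h'
  lt_iff_le_not_ge a b := by
    constructor
    · refine fun h => ⟨.inl h, ?_⟩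
      rintro (h' | rfl)
      · exact Arith.lt_irrefl' _ (Arith.lt_trans' h h')
      · exact Arith.lt_irrefl' _ h
    · rintro ⟨h | rfl, h'⟩
      · exact h
      · exact (h' (.inr rfl)).elim
  le_antisymm a b h h' := by
    rcases h with h | h
    · rcases h' with h' | h'
      · exact (Arith.lt_irrefl' _ (Arith.lt_trans' h h')).elim
      · exact h'.symm
    · exact h
  le_total a b := by
    rcases Arith.trichotomy a b with h | h | h
    exacts [.inl (.inl h), .inl (.inr h), .inr (.inl h)]
  toDecidableLE := Classical.decRel _

theorem Le_iff (a b : M) : Le a b ↔ a ≤ b := Iff.rfl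

instance : IsStrictOrderedRing M := by
  have hadd : ∀ a b : M, a < b → ∀ c, c + a < c + b := by
    intro a b h c
    obtain ⟨d, rfl⟩ := (Arith.lt_iff_add _ _).1 h
    exact (Arith.lt_iff_add _ _).2 ⟨d, (add_assoc _ _ _).symm⟩
  have h01 : (0 : M) < 1 := (Arith.lt_iff_add _ _).2 ⟨0, by simp⟩
  have hmul : ∀ c : M, 0 < c → ∀ a b : M, a < b → c * a < c * b := by
    intro c hc a b h
    obtain ⟨d, rfl⟩ := (Arith.lt_iff_add _ _).1 h
    obtain ⟨e, rfl⟩ := (Arith.lt_iff_add _ _).1 hc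
    exact (Arith.lt_iff_add _ _).2 ⟨e * d + e + d, by ring⟩
  exact
    { add_le_add_left := fun a b h c => by
        rcases h.lt_or_eq with h | rfl
        · rw [add_comm a, add_comm b]; exact (hadd a b h c).le
        · exact le_rfl
      le_of_add_le_add_left := fun a b c h => by
        by_contra! h'
        exact absurd (hadd _ _ h' a) h.not_gt
      zero_le_one := h01.le
      exists_pair_ne := ⟨0, 1, h01.ne⟩
      mul_lt_mul_of_pos_left := fun c hc a b h => hmul c hc a b h
      mul_lt_mul_of_pos_right := fun c hc a b h => by
        rw [mul_comm a, mul_comm b]; exact hmul c hc a b h }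

theorem zero_le' (a : M) : 0 ≤ a := by
  rcases Arith.zero_or_succ a with rfl | ⟨b, rfl⟩
  · exact le_rfl
  · exact ((Arith.lt_iff_add _ _).2 ⟨b, by rw [zero_add]⟩ : (0 : M) < b + 1).le

instance : CanonicallyOrderedAdd M where
  exists_add_of_le {a b} h := by
    rcases h.lt_or_eq with h | rfl
    · obtain ⟨c, hc⟩ := (Arith.lt_iff_add _ _).1 h
      exact ⟨_, hc⟩
    · exact ⟨0, (add_zero _).symm⟩
  le_add_self a b := le_add_of_nonneg_left (zero_le' b)
  le_self_add a b := le_add_of_nonneg_right (zero_le' b)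

theorem lt_succ {a b : M} : a < b + 1 ↔ a ≤ b :=
  (m.model.lt_succ_iff a b).trans le_iff_lt_or_eq.symm

theorem succ_le {a b : M} : a + 1 ≤ b ↔ a < b := by
  rw [← not_lt, lt_succ, not_le]

end Instances

/-! ### Closure properties of Σ⁰₁ and Δ⁰₁ definability -/

section Sigma

variable {ι : Type v} {M : ι → Type u} [∀ i, NumStr (M i)] [∀ i, Mod (M i)]

/-- The set parameters belong to the models. -/
class Pars.Good (C : Pars M) : Prop where
  mem : ∀ A ∈ C.sets, ∀ i, A i ∈ Mod.S (M := M i)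

instance {N : Type u} [NumStr N] [Mod N] : (full N).Good := ⟨fun _ hA _ => hA⟩

variable {C : Pars M}

theorem Sg.induct [C.Good] {P : ∀ i, M i → (ℕ → M i) → Prop}
    (h : Sg C (fun i v => P i (v 0) (fun n => v (n + 1)))) (i : ι) (v : ℕ → M i)
    (h0 : P i 0 v) (hs : ∀ n, P i n v → P i (n + 1) v) (n : M i) : P i n v := by
  obtain ⟨θ, A, p, hA, -, h⟩ := h.sigmaHolds
  have h' : ∀ n, P i n v ↔ SigmaHolds θ (fun j => A j i) (mix v (fun j => p j i)) n :=
    fun n => h i n v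
  rw [h']
  refine (Mod.model (M := M i)).sigma_induction _ _ _ (fun j => Pars.Good.mem _ (hA j) i)
    ((h' 0).1 h0) (fun k hk => ?_) n
  exact (h' _).1 (hs k ((h' k).2 hk))

theorem Sg.reindex {R : ∀ i, (ℕ → M i) → Prop} (h : Sg C R) (ρ : ℕ → ℕ) :
    Sg C (fun i v => R i (fun n => v (ρ n))) := by
  obtain ⟨Q, hQ, h⟩ := h
  exact ⟨fun i m v => Q i m (fun n => v (ρ n)), hQ.reindex (liftRen ρ), fun i v => h i _⟩

/-- Two witnesses are replaced by one number bounding both; no pairing is needed. -/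
instance Sg.and {R Q : ∀ i, (ℕ → M i) → Prop} [hR : Sg C R] [hQ : Sg C Q] :
    Sg C (fun i v => R i v ∧ Q i v) := by
  obtain ⟨R', hR', hR⟩ := hR
  obtain ⟨Q', hQ', hQ⟩ := hQ
  have h1 := hR'.reindex (fun n => if n = 0 then 0 else n + 1)
  have h2 := hQ'.reindex (fun n => if n = 0 then 0 else n + 1)
  simp only [if_true, Nat.add_eq_zero_iff, one_ne_zero, and_false, if_false] at h1 h2
  refine ⟨fun i b v => (∃ m, m < b ∧ R' i m v) ∧ ∃ m, m < b ∧ Q' i m v, inferInstance,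
    fun i v => ?_⟩
  rw [hR, hQ]
  constructor
  · rintro ⟨⟨a, ha⟩, b, hb⟩
    exact ⟨max a b + 1, ⟨a, lt_succ.2 (le_max_left _ _), ha⟩, b, lt_succ.2 (le_max_right _ _), hb⟩
  · rintro ⟨b, ⟨a, -, ha⟩, c, -, hc⟩
    exact ⟨⟨a, ha⟩, c, hc⟩

instance Sg.or {R Q : ∀ i, (ℕ → M i) → Prop} [hR : Sg C R] [hQ : Sg C Q] :
    Sg C (fun i v => R i v ∨ Q i v) := by
  obtain ⟨R', hR', hR⟩ := hR
  obtain ⟨Q', hQ', hQ⟩ := hQ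
  refine ⟨fun i b v => R' i b v ∨ Q' i b v, inferInstance, fun i v => ?_⟩
  rw [hR, hQ, exists_or]

/-- The renaming under two quantifiers which ignores the third variable. -/
def skipTwo (n : ℕ) : ℕ := if n < 2 then n else n + 1

instance Sg.ex {R : ∀ i, M i → (ℕ → M i) → Prop}
    [hR : Sg C (fun i v => R i (v 0) (fun n => v (n + 1)))] :
    Sg C (fun i v => ∃ a, R i a v) := by
  obtain ⟨Q, hQ, hR⟩ := hR
  have h1 := hQ.reindex skipTwo
  have h2 : D0 C (fun i v => Q i (v 0) (push (v 1) (fun n => v (n + 3)))) := by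
    refine h1.congr fun i v => ?_
    have : (push (v 1) (fun n => v (n + 3))) = fun n => v (skipTwo (n + 1)) := by
      funext n; cases n <;> rfl
    rw [this]; rfl
  refine ⟨fun i b v => ∃ a, a < b ∧ ∃ m, m < b ∧ Q i m (push a v), ?_, fun i v => ?_⟩
  · exact inferInstance
  · have : ∀ a, R i a v ↔ ∃ m, Q i m (push a v) := fun a => hR i (push a v)
    simp only [this]
    constructor
    · rintro ⟨a, b, hb⟩
      exact ⟨max a b + 1, a, lt_succ.2 (le_max_left _ _), b, lt_succ.2 (le_max_right _ _), hb⟩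
    · rintro ⟨b, a, -, c, -, hc⟩
      exact ⟨a, c, hc⟩

/-- Σ⁰₁ collection: induction along the bounded quantifier produces a common bound for the
witnesses, after which the bounded quantifier is part of a bounded matrix. -/
theorem Sg.ball_var [C.Good] {R : ∀ i, M i → (ℕ → M i) → Prop}
    (hR : Sg C (fun i v => R i (v 0) (fun n => v (n + 1)))) :
    Sg C (fun i v => ∀ a, a < v 0 → R i a (fun n => v (n + 1))) := by
  obtain ⟨Q, hQ, hR⟩ := hR
  have h1 := hQ.reindex (fun n => if n < 2 then n else n + 2)
  have h2 : D0 C (fun i v => Q i (v 0) (push (v 1) (fun n => v (n + 4)))) := by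
    refine h1.congr fun i v => ?_
    have : (push (v 1) (fun n => v (n + 4))) =
        fun n => v ((fun n => if n < 2 then n else n + 2) (n + 1)) := by
      funext n; cases n <;> rfl
    rw [this]; rfl
  have h1' := hQ.reindex (fun n => if n < 2 then n else n + 3)
  have h2' : D0 C (fun i v => Q i (v 0) (push (v 1) (fun n => v (n + 5)))) := by
    refine h1'.congr fun i v => ?_
    have : (push (v 1) (fun n => v (n + 5))) =
        fun n => v ((fun n => if n < 2 then n else n + 3) (n + 1)) := by
      funext n; cases n <;> rfl
    rw [this]; rfl
  refine ⟨fun i b v => ∀ a, a < v 0 → ∃ m, m < b ∧ Q i m (push a (fun n => v (n + 1))), ?_,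
    fun i v => ?_⟩
  · exact inferInstance
  · have hR' : ∀ a v, R i a v ↔ ∃ m, Q i m (push a v) := fun a v => hR i (push a v)
    simp only [hR']
    constructor
    · intro h
      have key := Sg.induct (C := C) (P := fun i s v => ∃ b, ∀ a, a < s → a < v 0 → ∃ m, m < b ∧
        Q i m (push a (fun n => v (n + 1)))) (Sg.of_exists inferInstance) i v
        ⟨0, fun a ha => absurd ha (zero_le' a).not_gt⟩ ?_ (v 0)
      · obtain ⟨b, hb⟩ := key
        exact ⟨b, fun a ha => hb a ha ha⟩
      · rintro s ⟨b, hb⟩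
        by_cases hs : s < v 0
        · obtain ⟨m, hm⟩ := h s hs
          refine ⟨max b (m + 1), fun a ha ha' => ?_⟩
          rcases (lt_succ.1 ha).lt_or_eq with ha | rfl
          · obtain ⟨k, hk, hk'⟩ := hb a ha ha'
            exact ⟨k, lt_max_of_lt_left hk, hk'⟩
          · exact ⟨m, lt_max_of_lt_right (lt_succ.2 le_rfl), hm⟩
        · refine ⟨b, fun a ha ha' => hb a ?_ ha'⟩
          exact ha'.trans_le (not_lt.1 hs)
    · rintro ⟨b, hb⟩ a ha
      obtain ⟨m, -, hm⟩ := hb a ha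
      exact ⟨m, hm⟩

variable (C) in
/-- The function `f` is uniformly definable with a `Σ⁰₁` graph. -/
class Fn (f : ∀ i, (ℕ → M i) → M i) : Prop where
  graph : Sg C (fun i v => v 0 = f i (fun n => v (n + 1)))

variable (C) in
/-- The relation `R` is uniformly `Δ⁰₁` definable. -/
class Dl (R : ∀ i, (ℕ → M i) → Prop) : Prop where
  pos : Sg C R
  neg : Sg C (fun i v => ¬ R i v)

variable {R Q : ∀ i, (ℕ → M i) → Prop} {s t f g : ∀ i, (ℕ → M i) → M i}

theorem Fn.reindex (h : Fn C f) (ρ : ℕ → ℕ) : Fn C (fun i v => f i (fun n => v (ρ n))) :=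
  ⟨h.graph.reindex (liftRen ρ)⟩

theorem Dl.reindex (h : Dl C R) (ρ : ℕ → ℕ) : Dl C (fun i v => R i (fun n => v (ρ n))) :=
  ⟨h.pos.reindex ρ, h.neg.reindex ρ⟩

theorem Dl.congr (h : Dl C R) (e : ∀ i v, Q i v ↔ R i v) : Dl C Q :=
  ⟨h.pos.congr e, h.neg.congr fun i v => not_congr (e i v)⟩

instance (priority := low) Sg.of_Dl [h : Dl C R] : Sg C R := h.pos

theorem Dl.of_D0 (h : D0 C R) : Dl C R := ⟨Sg.of_D0, Sg.of_D0⟩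

/-- Substitution of t amounts to ∃ y, y = t ∧ R y. As t is total, the same applies to the
complement, which is why Δ⁰₁ relations are closed under substitution too. -/
theorem Sg.subst {R : ∀ i, M i → (ℕ → M i) → Prop}
    (hR : Sg C (fun i v => R i (v 0) (fun n => v (n + 1)))) (ht : Fn C t) :
    Sg C (fun i v => R i (t i v) v) := by
  have := ht.graph
  exact Sg.congr (inferInstance : Sg C (fun i v => ∃ y, y = t i v ∧ R i y v)) (fun i v => by simp)

theorem Dl.subst {R : ∀ i, M i → (ℕ → M i) → Prop}
    (hR : Dl C (fun i v => R i (v 0) (fun n => v (n + 1)))) (ht : Fn C t) :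
    Dl C (fun i v => R i (t i v) v) :=
  ⟨Sg.subst hR.pos ht, Sg.subst (R := fun i a v => ¬ R i a v) hR.neg ht⟩

theorem Fn.subst {f : ∀ i, M i → (ℕ → M i) → M i}
    (hf : Fn C (fun i v => f i (v 0) (fun n => v (n + 1)))) (ht : Fn C t) :
    Fn C (fun i v => f i (t i v) v) := by
  refine ⟨Sg.subst (R := fun i y v => v 0 = f i y (fun n => v (n + 1))) ?_
    (ht.reindex (fun n => n + 1))⟩
  exact hf.graph.reindex (fun n => if n = 0 then 1 else if n = 1 then 0 else n)

theorem Fn.of_graph {G : ∀ i, M i → (ℕ → M i) → Prop}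
    (h : Sg C (fun i v => G i (v 0) (fun n => v (n + 1)))) (e : ∀ i v y, y = f i v ↔ G i y v) :
    Fn C f :=
  ⟨h.congr fun i v => e i _ _⟩

theorem Fn.congr (h : Fn C f) (e : ∀ i v, g i v = f i v) : Fn C g :=
  ⟨h.graph.congr fun i v => by rw [e]⟩

theorem Fn.of_isTm (h : IsTm C f) : Fn C f := by
  refine ⟨Sg.of_D0 (h := ?_)⟩
  have : IsTm C (fun i v => f i (fun n => v (n + 1))) := by
    obtain ⟨τ, p, hp, h⟩ := h
    refine ⟨τ.rename (fun n => if n % 2 = 0 then n + 2 else n), p, hp, fun i v => ?_⟩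
    rw [h, Tm.eval_rename]
    congr 1
    funext n
    rcases Nat.even_or_odd' n with ⟨k, rfl | rfl⟩
    · simp [mix]
    · simp [mix]
  exact inferInstance

instance Fn.var (k : ℕ) : Fn C (fun _ v => v k) := Fn.of_isTm inferInstance
instance Fn.zero : Fn C (fun _ _ => 0) := Fn.of_isTm inferInstance
instance Fn.one : Fn C (fun _ _ => 1) := Fn.of_isTm inferInstance
instance Fn.const {N : Type u} [NumStr N] [Mod N] (c : N) : Fn (full N) (fun _ _ => c) :=
  Fn.of_isTm inferInstance

theorem Fn.comp1 {f : ∀ i, M i → M i} (hf : Fn C (fun i v => f i (v 0))) (hs : Fn C s) :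
    Fn C (fun i v => f i (s i v)) :=
  Fn.subst (f := fun i x _ => f i x) hf hs

theorem Fn.comp2 {f : ∀ i, M i → M i → M i} (hf : Fn C (fun i v => f i (v 0) (v 1)))
    (hs : Fn C s) (ht : Fn C t) : Fn C (fun i v => f i (s i v) (t i v)) := by
  refine Fn.subst (f := fun i x v => f i x (t i v)) ?_ hs
  refine Fn.subst (f := fun i x v => f i (v 0) x) ?_ (ht.reindex (fun n => n + 1))
  exact hf.reindex (fun n => if n = 0 then 1 else 0)

theorem Fn.comp3 {f : ∀ i, M i → M i → M i → M i} {r : ∀ i, (ℕ → M i) → M i}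
    (hf : Fn C (fun i v => f i (v 0) (v 1) (v 2)))
    (hs : Fn C s) (ht : Fn C t) (hr : Fn C r) : Fn C (fun i v => f i (s i v) (t i v) (r i v)) := by
  refine Fn.subst (f := fun i x v => f i x (t i v) (r i v)) ?_ hs
  refine Fn.subst (f := fun i x v => f i (v 0) x (r i (fun n => v (n + 1)))) ?_
    (ht.reindex (fun n => n + 1))
  refine Fn.subst (f := fun i x v => f i (v 1) (v 0) x) ?_ (hr.reindex (fun n => n + 2))
  exact hf.reindex (fun n => 2 - n)

theorem Dl.comp2 {P : ∀ i, M i → M i → Prop} (h : Dl C (fun i v => P i (v 0) (v 1)))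
    (hs : Fn C s) (ht : Fn C t) : Dl C (fun i v => P i (s i v) (t i v)) := by
  refine Dl.subst (R := fun i x v => P i x (t i v)) ?_ hs
  refine Dl.subst (R := fun i x v => P i (v 0) x) ?_ (ht.reindex (fun n => n + 1))
  exact h.reindex (fun n => if n = 0 then 1 else 0)

instance Fn.add [hs : Fn C s] [ht : Fn C t] : Fn C (fun i v => s i v + t i v) :=
  Fn.comp2 (f := fun _ a b => a + b) (Fn.of_isTm inferInstance) hs ht
instance Fn.mul [hs : Fn C s] [ht : Fn C t] : Fn C (fun i v => s i v * t i v) :=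
  Fn.comp2 (f := fun _ a b => a * b) (Fn.of_isTm inferInstance) hs ht

instance Dl.eq [hs : Fn C s] [ht : Fn C t] : Dl C (fun i v => s i v = t i v) :=
  Dl.comp2 (P := fun _ a b => a = b) (Dl.of_D0 inferInstance) hs ht
instance Dl.lt [hs : Fn C s] [ht : Fn C t] : Dl C (fun i v => s i v < t i v) :=
  Dl.comp2 (P := fun _ a b => a < b) (Dl.of_D0 inferInstance) hs ht
instance Dl.le [hs : Fn C s] [ht : Fn C t] : Dl C (fun i v => s i v ≤ t i v) :=
  Dl.comp2 (P := fun _ a b => a ≤ b)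
    (Dl.of_D0 (inferInstance : D0 C (fun _ v => v 0 < v 1 ∨ v 0 = v 1))) hs ht

instance Dl.not [h : Dl C R] : Dl C (fun i v => ¬ R i v) :=
  ⟨h.neg, h.pos.congr fun i v => not_not⟩
instance Dl.and [h : Dl C R] [h' : Dl C Q] : Dl C (fun i v => R i v ∧ Q i v) :=
  ⟨have := h.pos; have := h'.pos; inferInstance,
   have := h.neg; have := h'.neg
   Sg.congr (inferInstance : Sg C (fun i v => ¬ R i v ∨ ¬ Q i v)) fun i v => by tauto⟩
instance Dl.imp [h : Dl C R] [h' : Dl C Q] : Dl C (fun i v => R i v → Q i v) :=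
  Dl.congr (inferInstance : Dl C (fun i v => ¬ (R i v ∧ ¬ Q i v))) (fun i v => by tauto)
instance Dl.iff [h : Dl C R] [h' : Dl C Q] : Dl C (fun i v => R i v ↔ Q i v) :=
  Dl.congr (inferInstance : Dl C (fun i v => (R i v → Q i v) ∧ (Q i v → R i v)))
    (fun i v => by tauto)
instance Dl.constant {N : Type u} [NumStr N] [Mod N] (p : Prop) : Dl (full N) (fun _ _ => p) := by
  by_cases h : p
  · exact Dl.congr (inferInstance : Dl (full N) (fun _ _ => (0 : N) = 0)) fun _ _ => by simp [h]
  · exact Dl.congr (inferInstance : Dl (full N) (fun _ _ => ¬ (0 : N) = 0)) fun _ _ => by simp [h]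

instance Sg.ball [C.Good] {P : ∀ i, M i → (ℕ → M i) → Prop} [ht : Fn C t]
    [hP : Sg C (fun i v => P i (v 0) (fun n => v (n + 1)))] :
    Sg C (fun i v => ∀ a, a < t i v → P i a v) :=
  Sg.subst (R := fun i y v => ∀ a, a < y → P i a v) (Sg.ball_var hP) ht

instance Dl.ball [C.Good] {P : ∀ i, M i → (ℕ → M i) → Prop} [ht : Fn C t]
    [hP : Dl C (fun i v => P i (v 0) (fun n => v (n + 1)))] :
    Dl C (fun i v => ∀ a, a < t i v → P i a v) := by
  refine ⟨have := hP.pos; inferInstance, ?_⟩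
  have h1 := hP.neg
  have h2 : Fn C (fun i v => t i (fun n => v (n + 1))) := ht.reindex _
  exact Sg.congr (inferInstance : Sg C (fun i v => ∃ a, a < t i v ∧ ¬ P i a v))
    fun i v => by push Not; rfl

instance Dl.bex [C.Good] {P : ∀ i, M i → (ℕ → M i) → Prop} [ht : Fn C t]
    [hP : Dl C (fun i v => P i (v 0) (fun n => v (n + 1)))] :
    Dl C (fun i v => ∃ a, a < t i v ∧ P i a v) :=
  Dl.congr (inferInstance : Dl C (fun i v => ¬ ∀ a, a < t i v → ¬ P i a v))
    fun i v => by push Not; rfl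

instance Dl.bexLe [C.Good] {P : ∀ i, M i → (ℕ → M i) → Prop} [ht : Fn C t]
    [hP : Dl C (fun i v => P i (v 0) (fun n => v (n + 1)))] :
    Dl C (fun i v => ∃ a, a ≤ t i v ∧ P i a v) :=
  Dl.congr (inferInstance : Dl C (fun i v => ∃ a, a < t i v + 1 ∧ P i a v))
    fun i v => by simp only [lt_succ]

instance Fn.ite {d : ∀ i v, Decidable (R i v)} [hR : Dl C R] [hf : Fn C f] [hg : Fn C g] :
    Fn C (fun i v => @_root_.ite _ (R i v) (d i v) (f i v) (g i v)) := by
  have h1 : Fn C (fun i v => f i (fun n => v (n + 1))) := hf.reindex _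
  have h2 : Fn C (fun i v => g i (fun n => v (n + 1))) := hg.reindex _
  have h3 : Dl C (fun i v => R i (fun n => v (n + 1))) := hR.reindex _
  refine Fn.of_graph (G := fun i y v => (R i v ∧ y = f i v) ∨ (¬ R i v ∧ y = g i v)) inferInstance
    fun i v y => ?_
  by_cases h : R i v <;> simp [h]

/-- Least number principle. -/
theorem Dl.exists_least [C.Good] {P : ∀ i, M i → (ℕ → M i) → Prop}
    (hP : Dl C (fun i v => P i (v 0) (fun n => v (n + 1)))) (i : ι) (v : ℕ → M i)
    (h : ∃ n, P i n v) : ∃ n, P i n v ∧ ∀ m, m < n → ¬ P i m v := by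
  by_contra! hc
  have hP' : Dl C (fun i v => P i (v 0) (fun n => v (n + 2))) :=
    hP.reindex (fun n => if n = 0 then 0 else n + 1)
  have key : ∀ n, ∀ m, m < n → ¬ P i m v := by
    refine Sg.induct (C := C) (P := fun i n v => ∀ m, m < n → ¬ P i m v) inferInstance i v
      (fun m hm => absurd hm (zero_le' m).not_gt) (fun n hn m hm hP => ?_)
    obtain ⟨k, hk, hk'⟩ := hc m hP
    exact hn k (hk.trans_le (lt_succ.1 hm)) hk'
  obtain ⟨n, hn⟩ := h
  exact key (n + 1) n (lt_succ.2 le_rfl) hn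

/-- The μ-operator preserves definability, because being the least witness of a Δ⁰₁ relation is
again Δ⁰₁ and serves as definition of the graph. -/
theorem Fn.exists_least [C.Good] {P : ∀ i, M i → (ℕ → M i) → Prop}
    (hP : Dl C (fun i v => P i (v 0) (fun n => v (n + 1)))) (h : ∀ i v, ∃ n, P i n v) :
    ∃ f, Fn C f ∧ ∀ i v, P i (f i v) v ∧ ∀ m, m < f i v → ¬ P i m v := by
  choose f hf using fun i v => hP.exists_least i v (h i v)
  have hP' : Dl C (fun i v => P i (v 0) (fun n => v (n + 2))) :=
    hP.reindex (fun n => if n = 0 then 0 else n + 1)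
  refine ⟨f, Fn.of_graph (G := fun i y v => P i y v ∧ ∀ m, m < y → ¬ P i m v) inferInstance
    fun i v y => ⟨?_, ?_⟩, hf⟩
  · rintro rfl; exact hf i v
  · rintro ⟨h1, h2⟩
    rcases lt_trichotomy y (f i v) with h | h | h
    · exact ((hf i v).2 y h h1).elim
    · exact h
    · exact (h2 _ h (hf i v).1).elim

variable (C) in
/-- The unary function `f` is uniformly definable. -/
class Fn1 (f : ∀ i, M i → M i) : Prop where
  out : Fn C (fun i v => f i (v 0))

instance (priority := low) Fn.app1 {f : ∀ i, M i → M i} [hf : Fn1 C f] [hs : Fn C s] :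
    Fn C (fun i v => f i (s i v)) :=
  Fn.comp1 hf.out hs

variable (C) in
/-- The binary function `f` is uniformly definable. -/
class Fn2 (f : ∀ i, M i → M i → M i) : Prop where
  out : Fn C (fun i v => f i (v 0) (v 1))

instance (priority := low) Fn.app2 {f : ∀ i, M i → M i → M i} [hf : Fn2 C f] [hs : Fn C s]
    [ht : Fn C t] : Fn C (fun i v => f i (s i v) (t i v)) :=
  Fn.comp2 hf.out hs ht

end Sigma

/-! ## Pairing and comprehension -/

section Pairing

variable {M : Type u} [NumStr M] [m : Mod M]

theorem left_le_pair (a b : M) : a ≤ pair a b := le_add_self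
theorem right_le_pair (a b : M) : b ≤ pair a b := by
  have h : a + b ≤ (a + b) * (a + b) := by
    rcases (zero_le' (a + b)).eq_or_lt with h | h
    · rw [← h]; exact zero_le' _
    · exact le_mul_of_one_le_left (zero_le' _) (by rw [← zero_add (1 : M)]; exact succ_le.2 h)
  exact le_add_self.trans (h.trans le_self_add)

theorem pair_lt_of_add_lt {a b c d : M} (h : a + b < c + d) : pair a b < pair c d := by
  have h1 : a + b + 1 ≤ c + d := succ_le.2 h
  have h2 : (a + b + 1) * (a + b + 1) ≤ (c + d) * (c + d) := mul_le_mul' h1 h1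
  calc pair a b = (a + b) * (a + b) + a := rfl
    _ < (a + b) * (a + b) + (a + b + (a + b) + 1) := by
        refine (add_lt_add_iff_left _).2 (lt_succ.2 ?_)
        exact le_self_add.trans (le_self_add)
    _ = (a + b + 1) * (a + b + 1) := by ring
    _ ≤ (c + d) * (c + d) := h2
    _ ≤ pair c d := le_self_add

/-- A pair lies between the consecutive squares (a + b)² and (a + b + 1)², so it determines the sum
of its entries and then the first entry. -/
theorem pair_inj {a b c d : M} : pair a b = pair c d ↔ a = c ∧ b = d := by
  refine ⟨fun h => ?_, by rintro ⟨rfl, rfl⟩; rfl⟩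
  have hs : a + b = c + d := by
    rcases lt_trichotomy (a + b) (c + d) with h' | h' | h'
    · exact absurd h (pair_lt_of_add_lt h').ne
    · exact h'
    · exact absurd h (pair_lt_of_add_lt h').ne'
  have ha : a = c := by
    unfold pair at h
    rw [hs] at h
    exact add_left_cancel h
  subst ha
  exact ⟨rfl, add_left_cancel hs⟩

theorem pair_mono {a b c d : M} (h : a ≤ c) (h' : b ≤ d) : pair a b ≤ pair c d := by
  unfold pair
  gcongr

instance Fn.pair {ι : Type v} {M : ι → Type u} [∀ i, NumStr (M i)] [∀ i, Mod (M i)] {C : Pars M}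
    {s t : ∀ i, (ℕ → M i) → M i} [Fn C s] [Fn C t] : Fn C (fun i v => pair (s i v) (t i v)) := by
  unfold SOA.pair
  infer_instance

/-- The Π⁰₁ definition required by comprehension is the negated matrix of the Σ⁰₁ definition of the
complement. Interleaving the assignments puts both formulas over the same parameters. -/
theorem setOf_mem {P : M → Prop} (h : Dl (full M) (fun _ v => P (v 0))) : {n | P n} ∈ m.S := by
  obtain ⟨θ, A, p, hA, -, hθ⟩ := h.pos.sigmaHolds
  obtain ⟨ψ, B, q, hB, -, hψ⟩ := h.neg.sigmaHolds
  have h1 : ∀ n, P n ↔ SigmaHolds θ (fun j => A j ()) (mix (fun _ => 0) (fun j => p j ())) n :=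
    fun n => hθ () n (fun _ => 0)
  have h2 : ∀ n, ¬ P n ↔ SigmaHolds ψ (fun j => B j ()) (mix (fun _ => 0) (fun j => q j ())) n :=
    fun n => hψ () n (fun _ => 0)
  have := m.model.delta_comprehension
    ((θ.rename (fun k => 2 * k) (liftRen (liftRen (fun k => 2 * k)))))
    (.neg (ψ.rename (fun k => 2 * k + 1) (liftRen (liftRen (fun k => 2 * k + 1)))))
    (ileave (fun j => A j ()) (fun j => B j ()))
    (ileave (mix (fun _ => 0) (fun j => p j ())) (mix (fun _ => 0) (fun j => q j ())))
    (ileave_mem (fun j => hA j) (fun j => hB j)) ?_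
  · convert this using 1
    ext n
    simp only [Set.mem_ofPred_eq]
    rw [h1]
    refine exists_congr fun k => ?_
    rw [BdFormula.holds_rename, push_liftRen, push_liftRen]
    simp only [ileave_even]
  · intro n
    have e1 : SigmaHolds (θ.rename (fun k => 2 * k) (liftRen (liftRen (fun k => 2 * k))))
        (ileave (fun j => A j ()) (fun j => B j ()))
        (ileave (mix (fun _ => 0) (fun j => p j ())) (mix (fun _ => 0) (fun j => q j ()))) n ↔
        P n := by
      rw [h1]
      refine exists_congr fun k => ?_
      rw [BdFormula.holds_rename, push_liftRen, push_liftRen]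
      simp only [ileave_even]
    rw [e1, ← not_not (a := P n), h2]
    simp only [SigmaHolds, PiHolds, BdFormula.Holds, not_exists]
    refine forall_congr' fun k => ?_
    rw [BdFormula.holds_rename, push_liftRen, push_liftRen]
    simp only [ileave_odd]

/-- The argument is bounded by the pair containing it, so the graph, as a set of coded pairs, is
Δ⁰₁. -/
theorem internal_of_fn {f : M → M} (h : Fn (full M) (fun _ v => f (v 0))) : Internal m.S f := by
  have : Fn1 (full M) (fun _ => f) := ⟨h⟩
  have h1 : Dl (full M) (fun _ v => ∃ n, n ≤ v 0 ∧ v 0 = pair n (f n)) := inferInstance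
  have := setOf_mem (P := fun z => ∃ n, n ≤ z ∧ z = pair n (f n)) h1
  have e : {z | ∃ n, z = pair n (f n)} = {z | ∃ n, n ≤ z ∧ z = pair n (f n)} := by
    ext z
    refine exists_congr fun n => ?_
    constructor
    · rintro rfl; exact ⟨left_le_pair _ _, rfl⟩
    · exact And.right
  unfold Internal
  rw [e]; exact this

theorem Fn1.of_internal {f : M → M} (h : Internal m.S f) : Fn1 (full M) (fun _ => f) := by
  refine ⟨⟨Sg.of_D0 (h := ?_)⟩⟩
  have h1 : IsTm (full M) (fun _ v => pair (v 1) (v 0)) := by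
    unfold pair; infer_instance
  refine (D0.mem (C := full M) (A := fun _ => {z | ∃ n, z = pair n (f n)})
    (t := fun _ v => pair (v 1) (v 0)) h).congr fun _ v => ?_
  simp only [Set.mem_ofPred_eq, pair_inj]
  simp

end Pairing

/-! ## The integers and the rational numbers of a model -/

variable (M : Type u) [NumStr M] [m : Mod M]

/-- Pairs `(a, b)` standing for the integer `a - b`. -/
def intSetoid : Setoid (M × M) where
  r p q := p.1 + q.2 = q.1 + p.2
  iseqv :=
    { refl := fun _ => rfl
      symm := fun h => h.symm
      trans := fun {p q r} h h' => by
        refine add_right_cancel (b := q.2) ?_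
        calc p.1 + r.2 + q.2 = (p.1 + q.2) + r.2 := by ring
          _ = (q.1 + r.2) + p.2 := by rw [h]; ring
          _ = r.1 + p.2 + q.2 := by rw [h']; ring }

/-- The integers of `M`. -/
def IntOf : Type u := Quotient (intSetoid M)

variable {M}

namespace IntOf

def mk (a b : M) : IntOf M := Quotient.mk (intSetoid M) (a, b)

theorem mk_eq {a b c d : M} : mk a b = mk c d ↔ a + d = c + b := Quotient.eq (r := intSetoid M)

theorem ind {P : IntOf M → Prop} (h : ∀ a b, P (mk a b)) (x : IntOf M) : P x :=
  Quotient.ind (fun p => h p.1 p.2) x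

instance : Zero (IntOf M) := ⟨mk 0 0⟩
instance : One (IntOf M) := ⟨mk 1 0⟩
instance : Add (IntOf M) := ⟨Quotient.map₂ (fun p q => (p.1 + q.1, p.2 + q.2)) (by
  intro p p' h q q' h'
  change p.1 + q.1 + (p'.2 + q'.2) = p'.1 + q'.1 + (p.2 + q.2)
  change p.1 + p'.2 = p'.1 + p.2 at h
  change q.1 + q'.2 = q'.1 + q.2 at h'
  calc _ = (p.1 + p'.2) + (q.1 + q'.2) := by ring
    _ = _ := by rw [h, h']; ring)⟩
instance : Neg (IntOf M) := ⟨Quotient.map (fun p => (p.2, p.1)) (by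
  intro p p' h
  change p.2 + p'.1 = p'.2 + p.1
  change p.1 + p'.2 = p'.1 + p.2 at h
  rw [add_comm, ← h, add_comm])⟩
instance : Mul (IntOf M) :=
  ⟨Quotient.map₂ (fun p q => (p.1 * q.1 + p.2 * q.2, p.1 * q.2 + p.2 * q.1)) (by
  intro p p' h q q' h'
  change p.1 * q.1 + p.2 * q.2 + (p'.1 * q'.2 + p'.2 * q'.1) =
    p'.1 * q'.1 + p'.2 * q'.2 + (p.1 * q.2 + p.2 * q.1)
  change p.1 + p'.2 = p'.1 + p.2 at h
  change q.1 + q'.2 = q'.1 + q.2 at h'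
  refine add_right_cancel (b := p'.1 * q.2 + p'.2 * q.1) ?_
  calc _ = (p.1 + p'.2) * q.1 + (p'.1 + p.2) * q.2 + p'.1 * q'.2 + p'.2 * q'.1 := by ring
    _ = (p'.1 + p.2) * q.1 + (p.1 + p'.2) * q.2 + p'.1 * q'.2 + p'.2 * q'.1 := by rw [h]
    _ = p'.1 * (q.1 + q'.2) + p'.2 * (q'.1 + q.2) + (p.2 * q.1 + p.1 * q.2) := by ring
    _ = p'.1 * (q'.1 + q.2) + p'.2 * (q.1 + q'.2) + (p.2 * q.1 + p.1 * q.2) := by rw [h']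
    _ = _ := by ring)⟩

theorem mk_add (a b c d : M) : mk a b + mk c d = mk (a + c) (b + d) := rfl
theorem mk_mul (a b c d : M) : mk a b * mk c d = mk (a * c + b * d) (a * d + b * c) := rfl
theorem neg_mk (a b : M) : - mk a b = mk b a := rfl
theorem zero_def : (0 : IntOf M) = mk 0 0 := rfl
theorem one_def : (1 : IntOf M) = mk 1 0 := rfl

instance : CommRing (IntOf M) where
  add_assoc x y z := by
    induction x using ind; induction y using ind; induction z using ind
    simp only [mk_add, mk_eq]; ring
  zero_add x := by induction x using ind; simp only [zero_def, mk_add, mk_eq]; ring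
  add_zero x := by induction x using ind; simp only [zero_def, mk_add, mk_eq]; ring
  add_comm x y := by
    induction x using ind; induction y using ind
    simp only [mk_add, mk_eq]; ring
  left_distrib x y z := by
    induction x using ind; induction y using ind; induction z using ind
    simp only [mk_add, mk_mul, mk_eq]; ring
  right_distrib x y z := by
    induction x using ind; induction y using ind; induction z using ind
    simp only [mk_add, mk_mul, mk_eq]; ring
  zero_mul x := by induction x using ind; simp only [zero_def, mk_mul, mk_eq]; ring
  mul_zero x := by induction x using ind; simp only [zero_def, mk_mul, mk_eq]; ring
  mul_assoc x y z := by
    induction x using ind; induction y using ind; induction z using ind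
    simp only [mk_mul, mk_eq]; ring
  one_mul x := by induction x using ind; simp only [one_def, mk_mul, mk_eq]; ring
  mul_one x := by induction x using ind; simp only [one_def, mk_mul, mk_eq]; ring
  mul_comm x y := by
    induction x using ind; induction y using ind
    simp only [mk_mul, mk_eq]; ring
  neg_add_cancel x := by induction x using ind; simp only [zero_def, neg_mk, mk_add, mk_eq]; ring
  nsmul := nsmulRec
  zsmul := zsmulRec
  npow := npowRec

/-- The embedding of the numbers into the integers. -/
def ofNum : M →+* IntOf M where
  toFun a := mk a 0
  map_zero' := rfl
  map_one' := rfl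
  map_add' a b := by simp only [mk_add, mk_eq]; ring
  map_mul' a b := by simp only [mk_mul, mk_eq]; ring

theorem ofNum_injective : Function.Injective (ofNum (M := M)) := fun a b h => by
  have : a + 0 = b + 0 := mk_eq.1 h
  simpa using this

theorem eq_or_neg (x : IntOf M) : ∃ a, x = ofNum a ∨ x = - ofNum a := by
  induction x using ind with | h a b => ?_
  rcases le_total a b with h | h
  · obtain ⟨c, rfl⟩ := exists_add_of_le h
    exact ⟨c, .inr (by change _ = - mk c 0; rw [neg_mk, mk_eq]; ring)⟩
  · obtain ⟨c, rfl⟩ := exists_add_of_le h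
    exact ⟨c, .inl (by change _ = mk c 0; rw [mk_eq]; ring)⟩

instance : Nontrivial (IntOf M) :=
  ⟨0, 1, fun h => zero_ne_one (α := M) (ofNum_injective (by simpa using h))⟩

instance : NoZeroDivisors (IntOf M) where
  eq_zero_or_eq_zero_of_mul_eq_zero {x y} h := by
    obtain ⟨a, ha⟩ := eq_or_neg x
    obtain ⟨b, hb⟩ := eq_or_neg y
    have h0 : ofNum (a * b) = 0 := by
      rw [map_mul]
      rcases ha with rfl | rfl <;> rcases hb with rfl | rfl <;> simpa using h
    have : a * b = 0 := ofNum_injective (by simpa using h0)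
    rcases mul_eq_zero.1 this with rfl | rfl
    · left; simpa using ha
    · right; simpa using hb

instance : IsDomain (IntOf M) := NoZeroDivisors.to_isDomain _

end IntOf

variable (M) in
/-- The field of rational numbers of `M`. -/
def RatOf : Type u := FractionRing (IntOf M)

namespace RatOf

instance : Field (RatOf M) := inferInstanceAs (Field (FractionRing (IntOf M)))

/-- The embedding of the numbers into the rational numbers. -/
def ofNum : M →+* RatOf M := (algebraMap (IntOf M) (FractionRing (IntOf M))).comp IntOf.ofNum

theorem ofNum_injective : Function.Injective (ofNum (M := M)) :=
  (IsFractionRing.injective (IntOf M) (FractionRing (IntOf M))).comp IntOf.ofNum_injective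

theorem exists_rep (x : RatOf M) :
    ∃ a b : M, ofNum b ≠ 0 ∧ (x * ofNum b = ofNum a ∨ - x * ofNum b = ofNum a) := by
  obtain ⟨z, w, hw, rfl⟩ := IsFractionRing.div_surjective (A := IntOf M) (K := FractionRing (IntOf M)) x
  have hw0 : w ≠ 0 := nonZeroDivisors.ne_zero hw
  obtain ⟨a, ha⟩ := IntOf.eq_or_neg z
  obtain ⟨b, hb⟩ := IntOf.eq_or_neg w
  have hb0 : ofNum b ≠ 0 := by
    intro h
    have : b = 0 := ofNum_injective (by simpa using h)
    subst this
    exact hw0 (by simpa using hb)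
  have hb0' : algebraMap (IntOf M) (FractionRing (IntOf M)) (IntOf.ofNum b) ≠ 0 := hb0
  refine ⟨a, b, hb0, ?_⟩
  change algebraMap (IntOf M) (FractionRing (IntOf M)) z / algebraMap _ _ w *
    algebraMap _ _ (IntOf.ofNum b) = algebraMap _ _ (IntOf.ofNum a) ∨
    -(algebraMap (IntOf M) (FractionRing (IntOf M)) z / algebraMap _ _ w) *
    algebraMap _ _ (IntOf.ofNum b) = algebraMap _ _ (IntOf.ofNum a)
  rcases ha with rfl | rfl <;> rcases hb with rfl | rfl
  · left; field_simp
  · right; rw [map_neg]; field_simp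
  · right; rw [map_neg]; field_simp
  · left; rw [map_neg, map_neg]; field_simp

def Nonneg (x : RatOf M) : Prop := ∃ a b : M, ofNum b ≠ 0 ∧ x * ofNum b = ofNum a

theorem Nonneg.add {x y : RatOf M} (hx : Nonneg x) (hy : Nonneg y) : Nonneg (x + y) := by
  obtain ⟨a, b, hb, h⟩ := hx
  obtain ⟨c, d, hd, h'⟩ := hy
  refine ⟨a * d + c * b, b * d, by rw [map_mul]; exact mul_ne_zero hb hd, ?_⟩
  rw [map_mul, map_add, map_mul, map_mul, ← h, ← h']; ring

theorem Nonneg.mul {x y : RatOf M} (hx : Nonneg x) (hy : Nonneg y) : Nonneg (x * y) := by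
  obtain ⟨a, b, hb, h⟩ := hx
  obtain ⟨c, d, hd, h'⟩ := hy
  refine ⟨a * c, b * d, by rw [map_mul]; exact mul_ne_zero hb hd, ?_⟩
  rw [map_mul, map_mul, ← h, ← h']; ring

theorem Nonneg.antisymm {x : RatOf M} (hx : Nonneg x) (hy : Nonneg (-x)) : x = 0 := by
  obtain ⟨a, b, hb, h⟩ := hx
  obtain ⟨c, d, hd, h'⟩ := hy
  have : a * d + c * b = 0 := by
    apply ofNum_injective
    rw [map_add, map_mul, map_mul, ← h, ← h', map_zero]; ring
  have h1 : a * d = 0 := le_antisymm (le_self_add.trans this.le) (zero_le' _)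
  have hd' : d ≠ 0 := by rintro rfl; simp at hd
  have : a = 0 := (mul_eq_zero.1 h1).resolve_right hd'
  subst this
  simpa [hb] using h

theorem Nonneg.total (x : RatOf M) : Nonneg x ∨ Nonneg (-x) := by
  obtain ⟨a, b, hb, h | h⟩ := exists_rep x
  exacts [.inl ⟨a, b, hb, h⟩, .inr ⟨a, b, hb, h⟩]

instance : LinearOrder (RatOf M) where
  le x y := Nonneg (y - x)
  le_refl x := ⟨0, 1, by simp, by simp⟩
  le_trans x y z h h' := by
    have := Nonneg.add h h'
    rwa [show y - x + (z - y) = z - x by ring] at this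
  le_antisymm x y h h' := by
    have := Nonneg.antisymm h (by rw [neg_sub]; exact h')
    exact (sub_eq_zero.1 this).symm
  le_total x y := by
    rcases Nonneg.total (y - x) with h | h
    · exact .inl h
    · right; rwa [neg_sub] at h
  toDecidableLE := Classical.decRel _

theorem le_def {x y : RatOf M} : x ≤ y ↔ Nonneg (y - x) := Iff.rfl

instance : IsOrderedAddMonoid (RatOf M) where
  add_le_add_left x y h z := by
    rw [le_def]; rwa [show y + z - (x + z) = y - x by ring]

instance : IsStrictOrderedRing (RatOf M) :=
  have : ZeroLEOneClass (RatOf M) := ⟨⟨1, 1, by simp, by simp⟩⟩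
  have : IsOrderedRing (RatOf M) := IsOrderedRing.of_mul_nonneg fun a b ha hb => by
    rw [le_def] at *; simp only [sub_zero] at *; exact ha.mul hb
  IsOrderedRing.toIsStrictOrderedRing _

theorem ofNum_nonneg (a : M) : (0 : RatOf M) ≤ ofNum a := ⟨a, 1, by simp, by simp⟩

theorem ofNum_mono : StrictMono (ofNum (M := M)) := by
  intro a b h
  refine lt_of_le_of_ne ?_ fun e => h.ne (ofNum_injective e)
  obtain ⟨c, rfl⟩ := exists_add_of_le h.le
  rw [map_add]; linarith [ofNum_nonneg c]

@[simp] theorem ofNum_le {a b : M} : ofNum a ≤ ofNum b ↔ a ≤ b := ofNum_mono.le_iff_le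
@[simp] theorem ofNum_lt {a b : M} : ofNum a < ofNum b ↔ a < b := ofNum_mono.lt_iff_lt

theorem ofNum_succ_pos (a : M) : (0 : RatOf M) < ofNum a + 1 := by
  linarith [ofNum_nonneg a]

/-- The Archimedean property relative to the model: `M` itself, in place of ℕ, is cofinal in its
rational numbers. -/
theorem exists_lt_ofNum (x : RatOf M) : ∃ n : M, x < ofNum n := by
  obtain ⟨a, b, hb, h⟩ := exists_rep x
  have hb' : (1 : RatOf M) ≤ ofNum b := by
    rw [← map_one ofNum, ofNum_le, ← zero_add (1 : M), succ_le]
    refine lt_of_le_of_ne (zero_le' _) ?_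
    rintro rfl; simp at hb
  refine ⟨a + 1, ?_⟩
  rw [map_add, map_one]
  rcases lt_or_ge x 0 with hx | hx
  · linarith [ofNum_nonneg a]
  · rcases h with h | h
    · nlinarith
    · nlinarith [ofNum_nonneg a]

end RatOf

/-! ## Division and the beta function -/

section Beta

variable {M : Type u} [NumStr M] [m : Mod M]

theorem exists_div (a d : M) (hd : 0 < d) : ∃ q r, a = q * d + r ∧ r < d := by
  refine induct (P := fun a => ∃ q r, a = q * d + r ∧ r < d) inferInstance
    ⟨0, 0, by simp, hd⟩ ?_ a
  rintro n ⟨q, r, rfl, hr⟩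
  rcases (succ_le.2 hr).lt_or_eq with h | h
  · exact ⟨q, r + 1, by ring, h⟩
  · exact ⟨q + 1, 0, by rw [add_assoc, h]; ring, hd⟩

theorem div_unique {d q r q' r' : M} (hr : r < d) (hr' : r' < d)
    (h : q * d + r = q' * d + r') : q = q' ∧ r = r' := by
  have aux : ∀ {q r q' r' : M}, r' < d → q * d + r = q' * d + r' → ¬ q' < q := by
    intro q r q' r' hr h hlt
    obtain ⟨e, rfl⟩ := exists_add_of_le (succ_le.2 hlt)
    refine h.not_gt ?_
    calc q' * d + r' < q' * d + d := (add_lt_add_iff_left _).2 hr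
      _ ≤ q' * d + d + (e * d + r) := le_self_add
      _ = (q' + 1 + e) * d + r := by ring
  have : q = q' := le_antisymm (not_lt.1 (aux hr' h)) (not_lt.1 (aux hr h.symm))
  subst this
  exact ⟨rfl, add_left_cancel h⟩

theorem beta_spec (a b i : M) : beta a b i < b * (i + 1) + 1 ∧
    ∃ q : M, a = q * (b * (i + 1) + 1) + beta a b i := by
  refine Classical.epsilon_spec (p := fun r : M =>
    r < b * (i + 1) + 1 ∧ ∃ q : M, a = q * (b * (i + 1) + 1) + r) ?_
  obtain ⟨q, r, h, hr⟩ := exists_div a (b * (i + 1) + 1) (lt_succ.2 (zero_le' _))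
  exact ⟨r, hr, q, h⟩

theorem eq_beta_iff {a b i r : M} :
    r = beta a b i ↔ r < b * (i + 1) + 1 ∧ ∃ q : M, a = q * (b * (i + 1) + 1) + r := by
  refine ⟨by rintro rfl; exact beta_spec a b i, ?_⟩
  rintro ⟨hr, q, hq⟩
  obtain ⟨h1, q', h2⟩ := beta_spec a b i
  exact (div_unique hr h1 (hq.symm.trans h2)).2

instance Fn.beta {ι : Type v} {M : ι → Type u} [∀ i, NumStr (M i)] [∀ i, Mod (M i)] {C : Pars M}
    {r s t : ∀ i, (ℕ → M i) → M i} [hr : Fn C r] [hs : Fn C s] [ht : Fn C t] :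
    Fn C (fun i v => beta (r i v) (s i v) (t i v)) := by
  refine Fn.comp3 (f := fun _ a b i => SOA.beta a b i) ?_ hr hs ht
  exact Fn.of_graph (G := fun _ y v => y < v 1 * (v 2 + 1) + 1 ∧
    ∃ q, v 0 = q * (v 1 * (v 2 + 1) + 1) + y) inferInstance fun i v y => eq_beta_iff

theorem exists_bound (f : M → M) [hf : Fn1 (full M) (fun _ => f)] (n : M) :
    ∃ B, ∀ i, i < n → f i ≤ B := by
  refine induct (P := fun n => ∃ B, ∀ i, i < n → f i ≤ B) inferInstance
    ⟨0, fun i hi => absurd hi (zero_le' i).not_gt⟩ ?_ n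
  rintro n ⟨B, hB⟩
  refine ⟨max B (f n), fun i hi => ?_⟩
  rcases (lt_succ.1 hi).lt_or_eq with h | rfl
  · exact (hB i h).trans (le_max_left _ _)
  · exact le_max_right _ _

theorem exists_common_multiple (n : M) : ∃ L, 0 < L ∧ ∀ d, d < n → ∃ q, L = q * (d + 1) := by
  refine induct (P := fun n => ∃ L, 0 < L ∧ ∀ d, d < n → ∃ q, L = q * (d + 1)) inferInstance
    ⟨1, zero_lt_one, fun i hi => absurd hi (zero_le' i).not_gt⟩ ?_ n
  rintro n ⟨L, h0, hL⟩
  refine ⟨L * (n + 1), mul_pos h0 (lt_succ.2 (zero_le' _)), fun d hd => ?_⟩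
  rcases (lt_succ.1 hd).lt_or_eq with h | rfl
  · obtain ⟨q, rfl⟩ := hL d h
    exact ⟨q * (n + 1), by ring⟩
  · exact ⟨L, rfl⟩

/-- Splitting the integer Bézout coefficients into differences of numbers gives a Σ⁰₁ formula, which
may occur in an induction. -/
theorem isCoprime_iff {a b : M} : IsCoprime (IntOf.ofNum a) (IntOf.ofNum b) ↔
    ∃ s t s' t', s * a + t * b = s' * a + t' * b + 1 := by
  constructor
  · rintro ⟨x, y, h⟩
    induction x using IntOf.ind with | h s s' => ?_
    induction y using IntOf.ind with | h t t' => ?_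
    refine ⟨s, t, s', t', ?_⟩
    have : s * a + s' * 0 + (t * b + t' * 0) + 0 = 1 + (s * 0 + s' * a + (t * 0 + t' * b)) :=
      IntOf.mk_eq.1 h
    calc _ = s * a + s' * 0 + (t * b + t' * 0) + 0 := by ring
      _ = _ := by rw [this]; ring
  · rintro ⟨s, t, s', t', h⟩
    refine ⟨IntOf.ofNum s - IntOf.ofNum s', IntOf.ofNum t - IntOf.ofNum t', ?_⟩
    have := congrArg IntOf.ofNum h
    simp only [map_add, map_mul, map_one] at this
    linear_combination this

/-- A threshold, and not just one N, is provided so that two Bézout coefficients can be shifted by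
the same N. -/
theorem IntOf.exists_nonneg_add (x : IntOf M) (c : M) (hc : 0 < c) :
    ∃ N, ∀ N', N ≤ N' → ∃ y, x + ofNum (c * N') = ofNum y := by
  obtain ⟨a, rfl | rfl⟩ := eq_or_neg x
  · exact ⟨0, fun N' _ => ⟨a + c * N', by rw [map_add]⟩⟩
  · refine ⟨a, fun N' h => ?_⟩
    have h1 : a ≤ c * N' := h.trans (le_mul_of_one_le_left (zero_le' _)
      (by rw [← zero_add (1 : M)]; exact succ_le.2 hc))
    obtain ⟨y, hy⟩ := exists_add_of_le h1
    exact ⟨y, by rw [hy, map_add]; ring⟩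

/-- One step of the Chinese remainder theorem. Bézout coefficients scaled by f - a solve the
congruence over the integers; adding d·N to one unknown and P·N to the other keeps the equation and
makes both nonnegative. -/
theorem exists_crt_step {a P d f : M} (hP : 0 < P) (hd : 0 < d)
    (h : IsCoprime (IntOf.ofNum P) (IntOf.ofNum d)) : ∃ c q, a + P * c = q * d + f := by
  obtain ⟨s, t, hst⟩ := h
  set x := s * (IntOf.ofNum f - IntOf.ofNum a)
  set y := -t * (IntOf.ofNum f - IntOf.ofNum a)
  have hxy : IntOf.ofNum a + IntOf.ofNum P * x = y * IntOf.ofNum d + IntOf.ofNum f := by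
    simp only [x, y]; linear_combination (IntOf.ofNum f - IntOf.ofNum a) * hst
  obtain ⟨N₁, h1⟩ := x.exists_nonneg_add d hd
  obtain ⟨N₂, h2⟩ := y.exists_nonneg_add P hP
  obtain ⟨c, hc⟩ := h1 (max N₁ N₂) (le_max_left _ _)
  obtain ⟨q, hq⟩ := h2 (max N₁ N₂) (le_max_right _ _)
  refine ⟨c, q, IntOf.ofNum_injective ?_⟩
  rw [map_add, map_add, map_mul, map_mul, ← hc, ← hq, map_mul, map_mul]
  linear_combination hxy

/-- The moduli differ by b·e. The first one is coprime to b, hence to the divisor e of b, hence to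
b·e. -/
theorem isCoprime_moduli {b k e c : M} (he : b = c * e) :
    IsCoprime (IntOf.ofNum (b * (k + 1) + 1)) (IntOf.ofNum (b * (k + e + 1) + 1)) := by
  have h1 : IsCoprime (IntOf.ofNum (b * (k + 1) + 1)) (IntOf.ofNum b) :=
    ⟨1, -(IntOf.ofNum (k + 1)), by simp only [map_add, map_mul, map_one]; ring⟩
  have h2 : IsCoprime (IntOf.ofNum (b * (k + 1) + 1)) (IntOf.ofNum e) :=
    h1.of_isCoprime_of_dvd_right (by rw [he, map_mul]; exact dvd_mul_left _ _)
  have h3 := h1.mul_right h2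
  obtain ⟨x, y, h⟩ := h3
  refine ⟨x - y, y, ?_⟩
  simp only [map_add, map_mul, map_one] at h ⊢
  linear_combination h

set_option synthInstance.maxHeartbeats 400000 in
set_option synthInstance.maxSize 2000 in
/-- Every definable sequence has codes of its initial segments. -/
theorem exists_beta (f : M → M) [hf : Fn1 (full M) (fun _ => f)] (n : M) :
    ∃ a b, ∀ i, i < n → beta a b i = f i := by
  obtain ⟨B, hB⟩ := exists_bound f n
  obtain ⟨L, hL0, hL⟩ := exists_common_multiple n
  -- The factor L makes differences of indices below n divide b, hence the moduli pairwise coprime;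
  -- the factor B + 1 makes the moduli exceed the values to be coded.
  set b := (B + 1) * L with hb
  have hBb : B < b := by
    refine (lt_succ.2 le_rfl : B < B + 1).trans_le (le_mul_of_one_le_right (zero_le' _) ?_)
    rw [← zero_add (1 : M)]; exact succ_le.2 hL0
  have hfb : ∀ i, i < n → f i < b * (i + 1) + 1 := fun i hi =>
    lt_succ.2 (((hB i hi).trans hBb.le).trans (le_mul_of_one_le_right (zero_le' _) le_add_self))
  have hcop : ∀ k j, k < j → j < n →
      IsCoprime (IntOf.ofNum (b * (k + 1) + 1)) (IntOf.ofNum (b * (j + 1) + 1)) := by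
    intro k j hkj hj
    obtain ⟨e, rfl⟩ := exists_add_of_le (succ_le.2 hkj)
    obtain ⟨q, hq⟩ := hL e (lt_of_le_of_lt le_add_self hj)
    rw [show k + 1 + e = k + (e + 1) by ring]
    exact isCoprime_moduli (c := (B + 1) * q) (by rw [hb, hq]; ring)
  -- Here a has the right remainders for the indices below k, while P is a multiple of the moduli
  -- used and coprime to the remaining ones. The alternatives n ≤ i and j < k make the claim
  -- meaningful for every k, and coprimality is stated in its Σ⁰₁ form.
  have key : ∀ k, ∃ a P, 0 < P ∧ (∀ i, i < k → (n ≤ i ∨ (∃ q, P = q * (b * (i + 1) + 1)) ∧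
      ∃ q, a = q * (b * (i + 1) + 1) + f i)) ∧ ∀ j, j < n → j < k ∨
      ∃ s t s' t', s * P + t * (b * (j + 1) + 1) = s' * P + t' * (b * (j + 1) + 1) + 1 := by
    refine induct (P := fun k => ∃ a P, 0 < P ∧ (∀ i, i < k → (n ≤ i ∨
      (∃ q, P = q * (b * (i + 1) + 1)) ∧
      ∃ q, a = q * (b * (i + 1) + 1) + f i)) ∧ ∀ j, j < n → j < k ∨
      ∃ s t s' t', s * P + t * (b * (j + 1) + 1) = s' * P + t' * (b * (j + 1) + 1) + 1)
      inferInstance ?_ ?_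
    · refine ⟨0, 1, zero_lt_one, fun i hi => absurd hi (zero_le' i).not_gt, fun j _ => .inr ?_⟩
      rw [← isCoprime_iff, map_one]
      exact isCoprime_one_left
    · rintro k ⟨a, P, hP, h1, h2⟩
      simp only [← isCoprime_iff] at h2 ⊢
      rcases le_or_gt n k with hk | hk
      · refine ⟨a, P, hP, fun i hi => ?_, fun j hj => ?_⟩
        · rcases (lt_succ.1 hi).lt_or_eq with h | rfl
          · exact h1 i h
          · exact .inl hk
        · exact .inl (hj.trans_le (hk.trans le_self_add))
      · have hPk := (h2 k hk).resolve_left (lt_irrefl _)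
        have hpos : 0 < b * (k + 1) + 1 := lt_succ.2 (zero_le' _)
        obtain ⟨c, q, hcq⟩ := exists_crt_step (a := a) (f := f k) hP hpos hPk
        refine ⟨a + P * c, P * (b * (k + 1) + 1), mul_pos hP hpos, fun i hi => ?_, fun j hj => ?_⟩
        · rcases (lt_succ.1 hi).lt_or_eq with h | rfl
          · rcases h1 i h with h' | ⟨⟨r, hr⟩, r', hr'⟩
            · exact .inl h'
            · exact .inr ⟨⟨r * (b * (k + 1) + 1), by rw [hr]; ring⟩, r' + r * c, by
                rw [hr', hr]; ring⟩
          · exact .inr ⟨⟨P, rfl⟩, q, hcq⟩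
        · rcases lt_trichotomy j k with h | rfl | h
          · exact .inl (lt_succ.2 h.le)
          · exact .inl (lt_succ.2 le_rfl)
          · right
            rw [map_mul]
            exact ((h2 j hj).resolve_left h.not_gt).mul_left (hcop k j h hj)
  obtain ⟨a, P, -, h, -⟩ := key n
  refine ⟨a, b, fun i hi => (eq_beta_iff.2 ⟨hfb i hi, ?_⟩).symm⟩
  exact ((h i hi).resolve_left hi.not_ge).2

end Beta

/-! ## Primitive recursion -/

section Recursion

variable {M : Type u} [NumStr M] [m : Mod M]

/-- Beta codes cannot be extended in place. The step therefore recodes the whole sequence, prolonged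
by one value, with `exists_beta`. -/
theorem exists_recursion (z : M) (s : M → M → M) [hs : Fn2 (full M) (fun _ => s)] (n : M) :
    ∃ a b, beta a b 0 = z ∧ ∀ i, i < n → beta a b (i + 1) = s i (beta a b i) := by
  refine induct (P := fun n => ∃ a b, beta a b 0 = z ∧ ∀ i, i < n →
    beta a b (i + 1) = s i (beta a b i)) inferInstance ?_ ?_ n
  · obtain ⟨a, b, h⟩ := exists_beta (fun _ => z) (hf := ⟨inferInstance⟩) 1
    exact ⟨a, b, h 0 zero_lt_one, fun i hi => absurd hi (zero_le' i).not_gt⟩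
  · rintro n ⟨a, b, h0, h1⟩
    classical
    obtain ⟨a', b', h⟩ := exists_beta
      (fun i => if i ≤ n then beta a b i else s n (beta a b n)) (hf := ⟨inferInstance⟩) (n + 1 + 1)
    refine ⟨a', b', ?_, fun i hi => ?_⟩
    · rw [h 0 (lt_succ.2 (zero_le' _)), if_pos (zero_le' _), h0]
    · rw [h _ (lt_succ.2 (succ_le.2 hi)), h i (hi.trans (lt_succ.2 le_rfl)), if_pos (lt_succ.1 hi)]
      rcases (lt_succ.1 hi).lt_or_eq with hi' | rfl
      · rw [if_pos (succ_le.2 hi'), h1 i hi']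
      · rw [if_neg (not_le.2 (lt_succ.2 le_rfl))]

/-- The function with `h 0 = z` and `h (i + 1) = s i (h i)`. -/
def mrec (z : M) (s : M → M → M) (n : M) : M := Classical.epsilon fun y =>
  ∃ a b, beta a b 0 = z ∧ (∀ i, i < n → beta a b (i + 1) = s i (beta a b i)) ∧ y = beta a b n

theorem recursion_unique {z : M} {s : M → M → M} {n a b a' b' : M}
    (h0 : beta a b 0 = z) (h : ∀ i, i < n → beta a b (i + 1) = s i (beta a b i))
    (h0' : beta a' b' 0 = z) (h' : ∀ i, i < n → beta a' b' (i + 1) = s i (beta a' b' i)) :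
    ∀ i, i ≤ n → beta a b i = beta a' b' i := by
  refine induct (P := fun i => i ≤ n → beta a b i = beta a' b' i) inferInstance
    (fun _ => h0.trans h0'.symm) (fun i hi hn => ?_)
  have := succ_le.1 hn
  rw [h i this, h' i this, hi this.le]

/-- Existence and uniqueness of the coded sequence turn the choice in `mrec` into a Σ⁰₁ graph; it
matches the clause for `prec` in `OracleCode.Eval`. -/
theorem eq_mrec_iff (z : M) (s : M → M → M) [hs : Fn2 (full M) (fun _ => s)] (n y : M) :
    y = mrec z s n ↔ ∃ a b, beta a b 0 = z ∧ (∀ i, i < n → beta a b (i + 1) = s i (beta a b i)) ∧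
      y = beta a b n := by
  have hspec : ∃ a b, beta a b 0 = z ∧ (∀ i, i < n → beta a b (i + 1) = s i (beta a b i)) ∧
      mrec z s n = beta a b n := by
    refine Classical.epsilon_spec (p := fun y => ∃ a b, beta a b 0 = z ∧
      (∀ i, i < n → beta a b (i + 1) = s i (beta a b i)) ∧ y = beta a b n) ?_
    obtain ⟨a, b, h, h'⟩ := exists_recursion z s n
    exact ⟨_, a, b, h, h', rfl⟩
  refine ⟨by rintro rfl; exact hspec, ?_⟩
  rintro ⟨a, b, h0, h, rfl⟩
  obtain ⟨a', b', h0', h', e⟩ := hspec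
  rw [e]
  exact recursion_unique h0 h h0' h' n le_rfl

theorem mrec_zero (z : M) (s : M → M → M) [hs : Fn2 (full M) (fun _ => s)] : mrec z s 0 = z := by
  obtain ⟨a, b, h0, -, h⟩ := (eq_mrec_iff z s 0 _).1 rfl
  rw [h, h0]

theorem mrec_succ (z : M) (s : M → M → M) [hs : Fn2 (full M) (fun _ => s)] (n : M) :
    mrec z s (n + 1) = s n (mrec z s n) := by
  obtain ⟨a, b, h0, h1, h⟩ := (eq_mrec_iff z s (n + 1) _).1 rfl
  rw [h, h1 n (lt_succ.2 le_rfl)]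
  congr 1
  exact (eq_mrec_iff z s n _).2 ⟨a, b, h0, fun i hi => h1 i (hi.trans (lt_succ.2 le_rfl)), rfl⟩

end Recursion

/-! ### Freezing variables of uniform definitions -/

section Specialize

variable {ι : Type v} {M : ι → Type u} [∀ i, NumStr (M i)] [∀ i, Mod (M i)] {C : Pars M}

/-- The first `k` variables from `w`, the others from `v`. -/
def splice {N : Type*} (k : ℕ) (w v : ℕ → N) (n : ℕ) : N := if n < k then w n else v (n - k)

/-- Facts such as the existence of recursions are proved in one structure at a time. Freezing all
but the first k variables makes a uniform definition available there, the frozen values becoming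
parameters. -/
theorem D0.specialize [C.Good] {R : ∀ i, (ℕ → M i) → Prop} (h : D0 C R) (i : ι) (k : ℕ)
    (v : ℕ → M i) : D0 (full (M i)) (fun _ w => R i (splice k w v)) := by
  obtain ⟨θ, A, p, hA, hp, h⟩ := h
  refine ⟨θ.rename (fun k => k) (fun n => if n % 2 = 1 then 2 * n + 1 else
    if n / 2 < k then n else 2 * (n - 2 * k) + 1), fun j _ => A j i,
    fun n _ => if n % 2 = 0 then v (n / 2) else p (n / 2) i,
    fun j => Pars.Good.mem _ (hA j) i, fun _ => trivial, fun _ w => ?_⟩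
  rw [h, BdFormula.holds_rename]
  have : mix (splice k w v) (fun j => p j i) = fun n => mix w (fun n =>
      if n % 2 = 0 then v (n / 2) else p (n / 2) i) (if n % 2 = 1 then 2 * n + 1 else
      if n / 2 < k then n else 2 * (n - 2 * k) + 1) := by
    funext n
    rcases Nat.even_or_odd' n with ⟨j, rfl | rfl⟩
    · have h1 : ¬ (2 * j) % 2 = 1 := by omega
      have h2 : 2 * j / 2 = j := by omega
      rw [mix_even, if_neg h1, h2]
      by_cases hj : j < k
      · rw [if_pos hj, mix_even]; simp [splice, hj]
      · rw [if_neg hj, mix_odd, if_pos (by omega)]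
        simp only [splice, if_neg hj]
        congr 1; omega
    · have h1 : (2 * j + 1) % 2 = 1 := by omega
      rw [if_pos h1, mix_odd, mix_odd, if_neg (by omega)]
      congr 1; omega
  rw [this]

theorem Sg.specialize [C.Good] {R : ∀ i, (ℕ → M i) → Prop} (h : Sg C R) (i : ι) (k : ℕ)
    (v : ℕ → M i) : Sg (full (M i)) (fun _ w => R i (splice k w v)) := by
  obtain ⟨Q, hQ, h⟩ := h
  refine ⟨fun _ m w => Q i m (splice k w v), (hQ.specialize i (k + 1) v).congr fun _ w => ?_,
    fun _ w => h i _⟩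
  have : (fun n => splice (k + 1) w v (n + 1)) = splice k (fun n => w (n + 1)) v := by
    funext n; simp [splice]
  rw [this]
  simp [splice]

theorem Fn.specialize [C.Good] {f : ∀ i, (ℕ → M i) → M i} (h : Fn C f) (i : ι) (k : ℕ)
    (v : ℕ → M i) : Fn (full (M i)) (fun _ w => f i (splice k w v)) := by
  refine ⟨(h.graph.specialize i (k + 1) v).congr fun _ w => ?_⟩
  have : (fun n => splice (k + 1) w v (n + 1)) = splice k (fun n => w (n + 1)) v := by
    funext n; simp [splice]
  rw [this]
  simp [splice]

/-- The graph formula is the same in all structures; its correctness in each of them is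
`eq_mrec_iff` for the specialised step function. -/
instance Fn.mrec [C.Good] {z t : ∀ i, (ℕ → M i) → M i} {s : ∀ i, M i → M i → (ℕ → M i) → M i}
    [hz : Fn C z] [hs : Fn C (fun i v => s i (v 0) (v 1) (fun n => v (n + 2)))] [ht : Fn C t] :
    Fn C (fun i v => mrec (z i v) (fun j y => s i j y v) (t i v)) := by
  have h1 : Fn C (fun i v => z i (fun n => v (n + 3))) := hz.reindex _
  have h2 : Fn C (fun i v => t i (fun n => v (n + 3))) := ht.reindex _
  have h2' : Fn C (fun i v => t i (fun n => v (n + 4))) := ht.reindex _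
  have h3 : Fn C (fun i v => s i (v 0) (v 1) (fun n => v (n + 5))) :=
    hs.reindex (fun n => if n < 2 then n else n + 3)
  have h4 : Fn C (fun i v => s i (v 0) (SOA.beta (v 2) (v 1) (v 0)) (fun n => v (n + 4))) :=
    Fn.subst (t := fun i v => SOA.beta (v 2) (v 1) (v 0))
      (f := fun i y v => s i (v 0) y (fun n => v (n + 4)))
      (h3.reindex (fun n => if n = 0 then 1 else if n = 1 then 0 else n)) inferInstance
  refine Fn.of_graph (G := fun i y v => ∃ a b, SOA.beta a b 0 = z i v ∧ (∀ j, j < t i v →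
    SOA.beta a b (j + 1) = s i j (SOA.beta a b j) v) ∧ y = SOA.beta a b (t i v)) inferInstance
    fun i v y => ?_
  have := hs.specialize i 2 v
  have : Fn2 (full (M i)) (fun _ j y => s i j y v) := ⟨this⟩
  exact eq_mrec_iff (z i v) (fun j y => s i j y v) (t i v) y

end Specialize

open Rational

/-! ## Rational numbers -/

section Val

variable {M : Type u} [NumStr M] [m : Mod M]

/-- The value of a code of a rational number. -/
def val (q : Rational M) : RatOf M :=
  (RatOf.ofNum q.pos - RatOf.ofNum q.neg) / (RatOf.ofNum q.den + 1)

theorem den_pos (q : Rational M) : (0 : RatOf M) < RatOf.ofNum q.den + 1 := RatOf.ofNum_succ_pos _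

theorem den_ne (q : Rational M) : RatOf.ofNum q.den + 1 ≠ (0 : RatOf M) := (den_pos q).ne'

theorem ofNum_mulDen (c d : M) :
    RatOf.ofNum (mulDen c d) + 1 = (RatOf.ofNum c + 1) * (RatOf.ofNum d + 1) := by
  simp only [mulDen, map_add, map_mul]; ring

theorem val_add (p q : Rational M) : val (p.add q) = val p + val q := by
  have hp := den_ne p
  have hq := den_ne q
  simp only [val, Rational.add, ofNum_mulDen, map_add, map_mul, map_one]
  field_simp
  ring

theorem val_opp (p : Rational M) : val p.opp = - val p := by
  simp only [val, Rational.opp]; rw [← neg_div]; ring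

theorem val_sub (p q : Rational M) : val (p.sub q) = val p - val q := by
  rw [Rational.sub, val_add, val_opp, sub_eq_add_neg]

theorem val_mul (p q : Rational M) : val (p.mul q) = val p * val q := by
  have hp := den_ne p
  have hq := den_ne q
  simp only [val, Rational.mul, ofNum_mulDen, map_add, map_mul]
  field_simp
  ring

@[simp] theorem val_ofNum (n : M) : val (ofNum n) = RatOf.ofNum n := by
  simp [val, Rational.ofNum]

theorem val_frac (a n : M) : val (frac a n) = RatOf.ofNum a / (RatOf.ofNum n + 1) := by
  simp [val, frac]

theorem val_half : val (half : Rational M) = 1 / 2 := by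
  simp [val, half]; norm_num

theorem val_abs (p : Rational M) : val p.abs = |val p| := by
  unfold Rational.abs
  have hp := den_pos p
  split_ifs with h
  · rw [abs_of_nonneg]
    exact div_nonneg (sub_nonneg.2 (RatOf.ofNum_le.2 h)) hp.le
  · rw [abs_of_nonpos, val_opp]
    refine div_nonpos_of_nonpos_of_nonneg (sub_nonpos.2 (RatOf.ofNum_le.2 ?_)) hp.le
    exact (lt_of_not_ge h).le

theorem LE_iff (p q : Rational M) : p.LE q ↔ val p ≤ val q := by
  unfold Rational.LE val
  rw [Le_iff, ← RatOf.ofNum_le, div_le_div_iff₀ (den_pos p) (den_pos q)]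
  simp only [map_add, map_mul, map_one]
  constructor <;> intro h <;> linarith

theorem positive_iff (p : Rational M) : p.Positive ↔ 0 < val p := by
  unfold Rational.Positive val
  rw [← RatOf.ofNum_lt, div_pos_iff_of_pos_right (den_pos p), sub_pos]

theorem exists_val (x : RatOf M) : ∃ q : Rational M, val q = x := by
  obtain ⟨a, b, hb, h⟩ := RatOf.exists_rep x
  rcases Arith.zero_or_succ b with rfl | ⟨d, rfl⟩
  · simp at hb
  rcases h with h | h
  · refine ⟨⟨a, 0, d⟩, ?_⟩
    simp only [val, map_add, map_one, map_zero, sub_zero] at *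
    rw [← h]; field_simp
  · refine ⟨⟨0, a, d⟩, ?_⟩
    simp only [val, map_add, map_one, map_zero, zero_sub] at *
    rw [← h]; field_simp

theorem code_inj {p q : Rational M} : p.code = q.code ↔ p = q := by
  refine ⟨fun h => ?_, fun h => h ▸ rfl⟩
  obtain ⟨a, b, c⟩ := p
  obtain ⟨a', b', c'⟩ := q
  simp only [code, pair_inj] at h
  obtain ⟨⟨rfl, rfl⟩, rfl⟩ := h
  rfl

theorem decode_code (q : Rational M) : decode q.code = q :=
  code_inj.1 (Classical.epsilon_spec (p := fun p : Rational M => p.code = q.code) ⟨q, rfl⟩)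

open Classical in
/-- The rational number with code `n`, or `0`. -/
def dec (n : M) : Rational M := if ∃ q : Rational M, q.code = n then decode n else ofNum 0

theorem dec_code (q : Rational M) : dec q.code = q := by
  rw [dec, if_pos ⟨q, rfl⟩, decode_code]

theorem eq_dec_iff {n : M} {q : Rational M} :
    q = dec n ↔ n = q.code ∨ (¬ ∃ q : Rational M, q.code = n) ∧ q = ofNum 0 := by
  by_cases h : ∃ q : Rational M, q.code = n
  · obtain ⟨p, rfl⟩ := h
    rw [dec_code, code_inj]
    exact ⟨fun h => .inl h.symm, fun h => h.elim Eq.symm fun h => (h.1 ⟨p, rfl⟩).elim⟩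
  · rw [dec, if_neg h]
    have : n ≠ q.code := fun e => h ⟨q, e.symm⟩
    simp [h, this]

end Val

/-! ## Definable functions with rational values -/

section FnQ

variable {ι : Type v} {M : ι → Type u} [∀ i, NumStr (M i)] [∀ i, Mod (M i)] {C : Pars M}

variable (C) in
/-- The function `r` with values codes of rational numbers is uniformly definable. -/
class FnQ (r : ∀ i, (ℕ → M i) → Rational (M i)) : Prop where
  pos : Fn C (fun i v => (r i v).pos)
  neg : Fn C (fun i v => (r i v).neg)
  den : Fn C (fun i v => (r i v).den)

instance FnQ.fn_pos {r : ∀ i, (ℕ → M i) → Rational (M i)} [h : FnQ C r] :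
    Fn C (fun i v => (r i v).pos) := h.pos
instance FnQ.fn_neg {r : ∀ i, (ℕ → M i) → Rational (M i)} [h : FnQ C r] :
    Fn C (fun i v => (r i v).neg) := h.neg
instance FnQ.fn_den {r : ∀ i, (ℕ → M i) → Rational (M i)} [h : FnQ C r] :
    Fn C (fun i v => (r i v).den) := h.den
instance FnQ.mk' {a b c : ∀ i, (ℕ → M i) → M i} [ha : Fn C a] [hb : Fn C b] [hc : Fn C c] :
    FnQ C (fun i v => ⟨a i v, b i v, c i v⟩) := ⟨ha, hb, hc⟩

variable {r s : ∀ i, (ℕ → M i) → Rational (M i)} {t t' : ∀ i, (ℕ → M i) → M i}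
  {R : ∀ i, (ℕ → M i) → Prop}

instance FnQ.fn_code [h : FnQ C r] : Fn C (fun i v => (r i v).code) := by
  unfold Rational.code; infer_instance

theorem FnQ.congr (h : FnQ C r) (e : ∀ i v, s i v = r i v) : FnQ C s := by
  have : s = r := by funext i v; exact e i v
  rw [this]; exact h

theorem FnQ.reindex (h : FnQ C r) (ρ : ℕ → ℕ) : FnQ C (fun i v => r i (fun n => v (ρ n))) :=
  ⟨h.pos.reindex ρ, h.neg.reindex ρ, h.den.reindex ρ⟩

theorem FnQ.specialize [C.Good] (h : FnQ C r) (i : ι) (k : ℕ) (v : ℕ → M i) :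
    FnQ (full (M i)) (fun _ w => r i (splice k w v)) :=
  ⟨h.pos.specialize i k v, h.neg.specialize i k v, h.den.specialize i k v⟩

theorem FnQ.subst {r : ∀ i, M i → (ℕ → M i) → Rational (M i)}
    (hr : FnQ C (fun i v => r i (v 0) (fun n => v (n + 1)))) (ht : Fn C t) :
    FnQ C (fun i v => r i (t i v) v) :=
  ⟨Fn.subst (f := fun i x v => (r i x v).pos) hr.pos ht,
   Fn.subst (f := fun i x v => (r i x v).neg) hr.neg ht,
   Fn.subst (f := fun i x v => (r i x v).den) hr.den ht⟩

instance FnQ.add [FnQ C r] [FnQ C s] : FnQ C (fun i v => (r i v).add (s i v)) := by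
  unfold Rational.add mulDen; infer_instance
instance FnQ.mul [FnQ C r] [FnQ C s] : FnQ C (fun i v => (r i v).mul (s i v)) := by
  unfold Rational.mul mulDen; infer_instance
instance FnQ.opp [FnQ C r] : FnQ C (fun i v => (r i v).opp) := by
  unfold Rational.opp; infer_instance
instance FnQ.sub [FnQ C r] [FnQ C s] : FnQ C (fun i v => (r i v).sub (s i v)) := by
  unfold Rational.sub; infer_instance
instance FnQ.ofNum [Fn C t] : FnQ C (fun i v => Rational.ofNum (t i v)) := by
  unfold Rational.ofNum; infer_instance
instance FnQ.frac [Fn C t] [Fn C t'] : FnQ C (fun i v => Rational.frac (t i v) (t' i v)) := by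
  unfold Rational.frac; infer_instance
instance FnQ.half : FnQ C (fun i _ => (Rational.half : Rational (M i))) := by
  unfold Rational.half; infer_instance
instance FnQ.const {N : Type u} [NumStr N] [Mod N] (q : Rational N) :
    FnQ (full N) (fun _ _ => q) :=
  ⟨inferInstance, inferInstance, inferInstance⟩
instance FnQ.ite {d : ∀ i v, Decidable (R i v)} [hR : Dl C R] [hr : FnQ C r] [hs : FnQ C s] :
    FnQ C (fun i v => @_root_.ite _ (R i v) (d i v) (r i v) (s i v)) := by
  refine ⟨Fn.congr (f := fun i v => if R i v then (r i v).pos else (s i v).pos) inferInstance ?_,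
    Fn.congr (f := fun i v => if R i v then (r i v).neg else (s i v).neg) inferInstance ?_,
    Fn.congr (f := fun i v => if R i v then (r i v).den else (s i v).den) inferInstance ?_⟩ <;>
  · intro i v; split_ifs <;> rfl
instance FnQ.abs [FnQ C r] : FnQ C (fun i v => (r i v).abs) := by
  unfold Rational.abs
  have : Dl C (fun i v => Le (r i v).neg (r i v).pos) :=
    (inferInstance : Dl C (fun i v => (r i v).neg ≤ (r i v).pos))
  infer_instance

/-- Being a code is Δ⁰₁ since a code bounds its components. The default value 0 off the codes makes
decoding total. -/
instance FnQ.dec [C.Good] [ht : Fn C t] : FnQ C (fun i v => dec (t i v)) := by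
  refine FnQ.subst (r := fun i x _ => SOA.dec x) ?_ ht
  have hex : ∀ i (n : M i), (∃ q : Rational (M i), q.code = n) ↔
      ∃ a, a ≤ n ∧ ∃ b, b ≤ n ∧ ∃ c, c ≤ n ∧ n = SOA.pair (SOA.pair a b) c := by
    intro i n
    constructor
    · rintro ⟨q, rfl⟩
      exact ⟨q.pos, (left_le_pair _ _).trans (left_le_pair _ _), q.neg,
        (right_le_pair _ _).trans (left_le_pair _ _), q.den, right_le_pair _ _, rfl⟩
    · rintro ⟨a, -, b, -, c, -, rfl⟩
      exact ⟨⟨a, b, c⟩, rfl⟩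
  have hD : Dl C (fun i v => ∃ a, a ≤ v 1 ∧ ∃ b, b ≤ v 1 ∧ ∃ c, c ≤ v 1 ∧
      v 1 = SOA.pair (SOA.pair a b) c) := inferInstance
  have key : ∀ i n, ∀ q : Rational (M i), q = SOA.dec n ↔
      n = SOA.pair (SOA.pair q.pos q.neg) q.den ∨
        (¬ ∃ q : Rational (M i), q.code = n) ∧ q.pos = 0 ∧ q.neg = 0 ∧ q.den = 0 := by
    intro i n q
    rw [eq_dec_iff]
    refine or_congr Iff.rfl (and_congr Iff.rfl ?_)
    obtain ⟨a, b, c⟩ := q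
    simp [Rational.ofNum]
  refine ⟨?_, ?_, ?_⟩
  · refine Fn.of_graph (G := fun i y v => (∃ b c, v 0 = SOA.pair (SOA.pair y b) c) ∨
      (¬ ∃ a, a ≤ v 0 ∧ ∃ b, b ≤ v 0 ∧ ∃ c, c ≤ v 0 ∧
        v 0 = SOA.pair (SOA.pair a b) c) ∧ y = 0) inferInstance fun i v y => ?_
    rw [← hex]
    constructor
    · rintro rfl
      rcases (key i (v 0) _).1 rfl with h | h
      exacts [.inl ⟨_, _, h⟩, .inr ⟨h.1, h.2.1⟩]
    · rintro (⟨b, c, h⟩ | ⟨h, rfl⟩)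
      · exact congrArg Rational.pos ((key i (v 0) ⟨y, b, c⟩).2 (.inl h))
      · exact congrArg Rational.pos ((key i (v 0) ⟨0, 0, 0⟩).2 (.inr ⟨h, rfl, rfl, rfl⟩))
  · refine Fn.of_graph (G := fun i y v => (∃ b c, v 0 = SOA.pair (SOA.pair b y) c) ∨
      (¬ ∃ a, a ≤ v 0 ∧ ∃ b, b ≤ v 0 ∧ ∃ c, c ≤ v 0 ∧
        v 0 = SOA.pair (SOA.pair a b) c) ∧ y = 0) inferInstance fun i v y => ?_
    rw [← hex]
    constructor
    · rintro rfl
      rcases (key i (v 0) _).1 rfl with h | h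
      exacts [.inl ⟨_, _, h⟩, .inr ⟨h.1, h.2.2.1⟩]
    · rintro (⟨b, c, h⟩ | ⟨h, rfl⟩)
      · exact congrArg Rational.neg ((key i (v 0) ⟨b, y, c⟩).2 (.inl h))
      · exact congrArg Rational.neg ((key i (v 0) ⟨0, 0, 0⟩).2 (.inr ⟨h, rfl, rfl, rfl⟩))
  · refine Fn.of_graph (G := fun i y v => (∃ b c, v 0 = SOA.pair (SOA.pair b c) y) ∨
      (¬ ∃ a, a ≤ v 0 ∧ ∃ b, b ≤ v 0 ∧ ∃ c, c ≤ v 0 ∧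
        v 0 = SOA.pair (SOA.pair a b) c) ∧ y = 0) inferInstance fun i v y => ?_
    rw [← hex]
    constructor
    · rintro rfl
      rcases (key i (v 0) _).1 rfl with h | h
      exacts [.inl ⟨_, _, h⟩, .inr ⟨h.1, h.2.2.2⟩]
    · rintro (⟨b, c, h⟩ | ⟨h, rfl⟩)
      · exact congrArg Rational.den ((key i (v 0) ⟨b, c, y⟩).2 (.inl h))
      · exact congrArg Rational.den ((key i (v 0) ⟨0, 0, 0⟩).2 (.inr ⟨h, rfl, rfl, rfl⟩))

theorem FnQ.of_code [C.Good] (h : Fn C (fun i v => (r i v).code)) : FnQ C r :=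
  FnQ.congr (r := fun i v => SOA.dec (r i v).code) inferInstance fun i v => (dec_code _).symm

end FnQ

/-! ## Recursion with rational values -/

section PrimRec

variable {M : Type u} [NumStr M] [m : Mod M]

theorem primRec_congr {z : Rational M} {s s' : M → Rational M → Rational M} {n : M}
    (h : ∀ i, i < n → s i = s' i) : primRec z s n = primRec z s' n := by
  unfold primRec
  congr 1
  funext y
  have : ∀ a b : M, (∀ i : M, i < n → ∃ q : Rational M,
      beta a b i = q.code ∧ beta a b (i + 1) = (s i q).code) ↔
      (∀ i : M, i < n → ∃ q : Rational M,
      beta a b i = q.code ∧ beta a b (i + 1) = (s' i q).code) := fun a b =>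
    forall₂_congr fun i hi => by rw [h i hi]
  simp only [this]

/-- Every entry of the sequence in `primRec` is a code, being the start value or a value of the
step. Hence decoding with `dec` loses nothing, and both recursions have the same beta codes. -/
theorem code_primRec {z : Rational M} {s : M → Rational M → Rational M}
    (hs : Fn2 (full M) (fun _ i y => (s i (dec y)).code)) (n : M) :
    (primRec z s n).code = mrec z.code (fun i y => (s i (dec y)).code) n := by
  have key : ∀ y : Rational M, (∃ a b : M, beta a b 0 = z.code ∧
      (∀ i : M, i < n → ∃ q : Rational M,
        beta a b i = q.code ∧ beta a b (i + 1) = (s i q).code) ∧ beta a b n = y.code) ↔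
      y.code = mrec z.code (fun i y => (s i (dec y)).code) n := by
    intro y
    rw [eq_mrec_iff]
    refine exists₂_congr fun a b => and_congr_right fun h0 => ?_
    constructor
    · rintro ⟨h1, h2⟩
      refine ⟨fun i hi => ?_, h2.symm⟩
      obtain ⟨q, hq, hq'⟩ := h1 i hi
      rw [hq', hq, dec_code]
    · rintro ⟨h1, h2⟩
      refine ⟨fun i hi => ?_, h2.symm⟩
      rcases Arith.zero_or_succ i with rfl | ⟨j, rfl⟩
      · exact ⟨z, h0, by rw [h1 0 hi, h0, dec_code]⟩
      · have hj := h1 j ((lt_succ.2 le_rfl).trans hi)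
        exact ⟨_, hj, by rw [h1 _ hi, hj, dec_code]⟩
  have hex : ∃ y : Rational M, y.code = mrec z.code (fun i y => (s i (dec y)).code) n := by
    rcases Arith.zero_or_succ n with rfl | ⟨j, rfl⟩
    · exact ⟨z, (mrec_zero _ _).symm⟩
    · exact ⟨s j (dec (mrec z.code (fun i y => (s i (dec y)).code) j)), by rw [mrec_succ]⟩
  have := Classical.epsilon_spec (p := fun y : Rational M => ∃ a b : M, beta a b 0 = z.code ∧
      (∀ i : M, i < n → ∃ q : Rational M,
        beta a b i = q.code ∧ beta a b (i + 1) = (s i q).code) ∧ beta a b n = y.code)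
      (by obtain ⟨y, hy⟩ := hex; exact ⟨y, (key y).2 hy⟩)
  exact (key _).1 this

theorem primRec_zero {z : Rational M} {s : M → Rational M → Rational M}
    (hs : Fn2 (full M) (fun _ i y => (s i (dec y)).code)) : primRec z s 0 = z := by
  rw [← code_inj, code_primRec hs, mrec_zero]

theorem primRec_succ {z : Rational M} {s : M → Rational M → Rational M}
    (hs : Fn2 (full M) (fun _ i y => (s i (dec y)).code)) (n : M) :
    primRec z s (n + 1) = s n (primRec z s n) := by
  rw [← code_inj, code_primRec hs, mrec_succ, ← code_primRec hs, dec_code]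

end PrimRec

section PrimRecFn

variable {ι : Type v} {M : ι → Type u} [∀ i, NumStr (M i)] [∀ i, Mod (M i)] {C : Pars M} [C.Good]

theorem FnQ.primRec {z : ∀ i, (ℕ → M i) → Rational (M i)}
    {s : ∀ i, M i → Rational (M i) → (ℕ → M i) → Rational (M i)} {t : ∀ i, (ℕ → M i) → M i}
    [hz : FnQ C z] [hs : FnQ C (fun i v => s i (v 0) (SOA.dec (v 1)) (fun n => v (n + 2)))]
    [ht : Fn C t] : FnQ C (fun i v => primRec (z i v) (fun j q => s i j q v) (t i v)) := by
  refine FnQ.of_code ?_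
  refine Fn.congr (f := fun i v =>
    mrec (z i v).code (fun j y => (s i j (SOA.dec y) v).code) (t i v)) ?_ fun i v => ?_
  · exact Fn.mrec (s := fun i j y v => (s i j (SOA.dec y) v).code)
  · refine code_primRec ⟨?_⟩ _
    have : FnQ (full (M i)) (fun _ w => s i (w 0) (SOA.dec (w 1)) v) := hs.specialize i 2 v
    exact (inferInstance : Fn (full (M i)) (fun _ w => (s i (w 0) (SOA.dec (w 1)) v).code))

instance FnQ.sum {r : ∀ i, M i → (ℕ → M i) → Rational (M i)} {t : ∀ i, (ℕ → M i) → M i}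
    [hr : FnQ C (fun i v => r i (v 0) (fun n => v (n + 1)))]
    [ht : Fn C t] : FnQ C (fun i v => Rational.sum (fun j => r i j v) (t i v)) := by
  have : FnQ C (fun i v => r i (v 0) (fun n => v (n + 2))) :=
    hr.reindex (fun n => if n = 0 then 0 else n + 1)
  exact FnQ.primRec (z := fun i _ => Rational.ofNum 0) (s := fun i j q v => q.add (r i j v))

instance FnQ.pow {r : ∀ i, (ℕ → M i) → Rational (M i)} {t : ∀ i, (ℕ → M i) → M i}
    [hr : FnQ C r] [ht : Fn C t] : FnQ C (fun i v => Rational.pow (r i v) (t i v)) := by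
  have : FnQ C (fun i v => r i (fun n => v (n + 2))) := hr.reindex _
  exact FnQ.primRec (z := fun i _ => Rational.ofNum 1) (s := fun i _ q v => q.mul (r i v))

instance FnQ.twoPowNeg {t : ∀ i, (ℕ → M i) → M i} [ht : Fn C t] :
    FnQ C (fun i v => Rational.twoPowNeg (t i v)) := by
  unfold Rational.twoPowNeg; infer_instance

end PrimRecFn

/-! ## Definable functions with values in the field of rational numbers -/

section RK

variable {ι : Type v} {M : ι → Type u} [∀ i, NumStr (M i)] [∀ i, Mod (M i)] {C : Pars M}

variable (C) in
/-- The function `f` with rational values has a uniformly definable representation. -/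
class RK (f : ∀ i, (ℕ → M i) → RatOf (M i)) : Prop where
  out : ∃ r, FnQ C r ∧ ∀ i v, f i v = val (r i v)

variable {f g : ∀ i, (ℕ → M i) → RatOf (M i)} {t : ∀ i, (ℕ → M i) → M i}
  {R : ∀ i, (ℕ → M i) → Prop}

theorem RK.congr (h : RK C f) (e : ∀ i v, g i v = f i v) : RK C g := by
  have : g = f := by funext i v; exact e i v
  rw [this]; exact h

theorem RK.reindex (h : RK C f) (ρ : ℕ → ℕ) : RK C (fun i v => f i (fun n => v (ρ n))) := by
  obtain ⟨r, hr, h⟩ := h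
  exact ⟨_, hr.reindex ρ, fun i v => h i _⟩

theorem RK.subst {f : ∀ i, M i → (ℕ → M i) → RatOf (M i)}
    (hf : RK C (fun i v => f i (v 0) (fun n => v (n + 1)))) (ht : Fn C t) :
    RK C (fun i v => f i (t i v) v) := by
  obtain ⟨r, hr, h⟩ := hf
  refine ⟨fun i v => r i (push (t i v) v), ?_, fun i v => h i (push (t i v) v)⟩
  refine FnQ.subst (r := fun i x v => r i (push x v)) ?_ ht
  refine FnQ.congr hr fun i v => ?_
  congr 1
  funext n; cases n <;> rfl

instance RK.val {r : ∀ i, (ℕ → M i) → Rational (M i)} [h : FnQ C r] :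
    RK C (fun i v => val (r i v)) := ⟨r, h, fun _ _ => rfl⟩

instance RK.ofNum [h : Fn C t] : RK C (fun i v => RatOf.ofNum (t i v)) :=
  ⟨fun i v => Rational.ofNum (t i v), inferInstance, fun _ _ => (val_ofNum _).symm⟩

instance RK.const {N : Type u} [NumStr N] [Mod N] (x : RatOf N) : RK (full N) (fun _ _ => x) := by
  obtain ⟨q, hq⟩ := exists_val x
  exact ⟨fun _ _ => q, inferInstance, fun _ _ => hq.symm⟩

instance RK.zero : RK C (fun _ _ => 0) :=
  RK.congr (inferInstance : RK C (fun _ _ => RatOf.ofNum 0)) fun _ _ => (map_zero _).symm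

instance RK.one : RK C (fun _ _ => 1) :=
  RK.congr (inferInstance : RK C (fun _ _ => RatOf.ofNum 1)) fun _ _ => (map_one _).symm

instance RK.add [hf : RK C f] [hg : RK C g] : RK C (fun i v => f i v + g i v) := by
  obtain ⟨r, hr, h⟩ := hf
  obtain ⟨s, hs, h'⟩ := hg
  exact ⟨fun i v => (r i v).add (s i v), inferInstance, fun i v => by rw [val_add, h, h']⟩

instance RK.sub [hf : RK C f] [hg : RK C g] : RK C (fun i v => f i v - g i v) := by
  obtain ⟨r, hr, h⟩ := hf
  obtain ⟨s, hs, h'⟩ := hg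
  exact ⟨fun i v => (r i v).sub (s i v), inferInstance, fun i v => by rw [val_sub, h, h']⟩

instance RK.mul [hf : RK C f] [hg : RK C g] : RK C (fun i v => f i v * g i v) := by
  obtain ⟨r, hr, h⟩ := hf
  obtain ⟨s, hs, h'⟩ := hg
  exact ⟨fun i v => (r i v).mul (s i v), inferInstance, fun i v => by rw [val_mul, h, h']⟩

instance RK.abs [hf : RK C f] : RK C (fun i v => |f i v|) := by
  obtain ⟨r, hr, h⟩ := hf
  exact ⟨fun i v => (r i v).abs, inferInstance, fun i v => by rw [val_abs, h]⟩

instance RK.inv_succ [h : Fn C t] : RK C (fun i v => (RatOf.ofNum (t i v) + 1)⁻¹) :=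
  ⟨fun i v => Rational.frac 1 (t i v), inferInstance, fun _ _ => by rw [val_frac]; simp⟩

instance RK.div_succ [hf : RK C f] [h : Fn C t] : RK C (fun i v => f i v / (RatOf.ofNum (t i v) + 1)) :=
  RK.congr (inferInstance : RK C (fun i v => f i v * (RatOf.ofNum (t i v) + 1)⁻¹))
    fun _ _ => div_eq_mul_inv _ _

instance RK.div_const {N : Type u} [NumStr N] [Mod N] {f : ∀ _ : Unit, (ℕ → N) → RatOf N}
    [hf : RK (full N) f] (c : RatOf N) : RK (full N) (fun i v => f i v / c) :=
  RK.congr (inferInstance : RK (full N) (fun i v => f i v * c⁻¹)) fun _ _ => div_eq_mul_inv _ _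

instance RK.ite {d : ∀ i v, Decidable (R i v)} [hR : Dl C R] [hf : RK C f] [hg : RK C g] :
    RK C (fun i v => @_root_.ite _ (R i v) (d i v) (f i v) (g i v)) := by
  obtain ⟨r, hr, h⟩ := hf
  obtain ⟨s, hs, h'⟩ := hg
  refine ⟨fun i v => if R i v then r i v else s i v, inferInstance, fun i v => ?_⟩
  rw [h, h']
  by_cases hR : R i v <;> simp [hR]

instance Dl.leK [hf : RK C f] [hg : RK C g] : Dl C (fun i v => f i v ≤ g i v) := by
  obtain ⟨r, hr, h⟩ := hf
  obtain ⟨s, hs, h'⟩ := hg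
  refine Dl.congr (R := fun i v => (r i v).pos * ((s i v).den + 1) + (s i v).neg * ((r i v).den + 1)
    ≤ (s i v).pos * ((r i v).den + 1) + (r i v).neg * ((s i v).den + 1)) inferInstance
    fun i v => ?_
  rw [h, h', ← LE_iff]; rfl

instance Dl.eqK [hf : RK C f] [hg : RK C g] : Dl C (fun i v => f i v = g i v) :=
  Dl.congr (inferInstance : Dl C (fun i v => f i v ≤ g i v ∧ g i v ≤ f i v))
    fun _ _ => le_antisymm_iff

instance (priority := low) RK.app1 {f : ∀ i, M i → RatOf (M i)}
    [hr : RK C (fun i v => f i (v 0))] [ht : Fn C t] : RK C (fun i v => f i (t i v)) :=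
  RK.subst (f := fun i x _ => f i x) hr ht

end RK

/-! ### Definable sums and powers in the field of rational numbers -/

section Sums

variable {M : Type u} [NumStr M] [m : Mod M]

/-- The function `f` is definable with parameters. -/
abbrev RK1 (f : M → RatOf M) : Prop := RK (full M) (fun _ v => f (v 0))

theorem exists_rep {f : M → RatOf M} (hf : RK1 f) :
    ∃ r : M → Rational M, FnQ (full M) (fun _ v => r (v 0)) ∧ ∀ n, f n = val (r n) := by
  obtain ⟨r, hr, h⟩ := hf
  refine ⟨fun n => r () (fun _ => n), hr.reindex (fun _ => 0), fun n => h () (fun _ => n)⟩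

open Classical in
/-- `∑_{i < n} f i` for definable `f`. -/
def msum (f : M → RatOf M) (n : M) : RatOf M :=
  if h : RK1 f then val (Rational.sum (exists_rep h).choose n) else 0

theorem sum_zero {r : M → Rational M} (hr : FnQ (full M) (fun _ v => r (v 0))) :
    Rational.sum r 0 = ofNum 0 := primRec_zero ⟨inferInstance⟩

theorem sum_succ {r : M → Rational M} (hr : FnQ (full M) (fun _ v => r (v 0))) (n : M) :
    Rational.sum r (n + 1) = (Rational.sum r n).add (r n) :=
  primRec_succ (s := fun i q => q.add (r i)) ⟨inferInstance⟩ n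

/-- Two representations of the same terms may use different codes, but their partial sums have equal
values by induction. Thus the choice made in `msum` is immaterial. -/
theorem val_sum {r : M → Rational M} (hr : FnQ (full M) (fun _ v => r (v 0))) (n : M) :
    val (Rational.sum r n) = msum (fun i => val (r i)) n := by
  have h : RK1 (fun i => val (r i)) := inferInstance
  rw [msum, dif_pos h]
  obtain ⟨hs, e⟩ := (exists_rep h).choose_spec
  set s := (exists_rep h).choose
  refine induct (P := fun n => val (Rational.sum r n) = val (Rational.sum s n)) inferInstance ?_
    (fun n hn => ?_) n
  · rw [sum_zero hr, sum_zero hs]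
  · rw [sum_succ hr, sum_succ hs, val_add, val_add, hn, e]

@[simp] theorem msum_zero (f : M → RatOf M) : msum f 0 = 0 := by
  unfold msum
  split_ifs with h
  · rw [sum_zero (exists_rep h).choose_spec.1, val_ofNum, map_zero]
  · rfl

theorem msum_succ (f : M → RatOf M) [h : RK1 f] (n : M) : msum f (n + 1) = msum f n + f n := by
  unfold msum
  rw [dif_pos h, dif_pos h, sum_succ (exists_rep h).choose_spec.1, val_add,
    ← (exists_rep h).choose_spec.2]

/-- `x ^ n` -/
def kpow (x : RatOf M) (n : M) : RatOf M := val (Rational.pow (exists_val x).choose n)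

theorem pow_zero' (x : Rational M) : Rational.pow x 0 = ofNum 1 := primRec_zero ⟨inferInstance⟩

theorem pow_succ' (x : Rational M) (n : M) :
    Rational.pow x (n + 1) = (Rational.pow x n).mul x :=
  primRec_succ (s := fun _ q => q.mul x) ⟨inferInstance⟩ n

theorem val_pow (x : Rational M) (n : M) : val (Rational.pow x n) = kpow (val x) n := by
  unfold kpow
  set y := (exists_val (val x)).choose with hy
  have e : val y = val x := (exists_val (val x)).choose_spec
  refine induct (P := fun n => val (Rational.pow x n) = val (Rational.pow y n)) inferInstance ?_
    (fun n hn => ?_) n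
  · rw [pow_zero', pow_zero']
  · rw [pow_succ', pow_succ', val_mul, val_mul, hn, e]

@[simp] theorem kpow_zero (x : RatOf M) : kpow x 0 = 1 := by
  rw [kpow, pow_zero', val_ofNum, map_one]

theorem kpow_succ (x : RatOf M) (n : M) : kpow x (n + 1) = kpow x n * x := by
  rw [kpow, pow_succ', val_mul, (exists_val x).choose_spec]; rfl

/-- `2 ^ (-n)` -/
def tp (n : M) : RatOf M := val (twoPowNeg n)

@[simp] theorem tp_zero : tp (0 : M) = 1 := by
  rw [tp, twoPowNeg, pow_zero', val_ofNum, map_one]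

theorem tp_succ (n : M) : tp (n + 1) = tp n / 2 := by
  rw [tp, twoPowNeg, pow_succ', val_mul, val_half, tp, twoPowNeg]; ring

end Sums

section SumsFn

variable {ι : Type v} {M : ι → Type u} [∀ i, NumStr (M i)] [∀ i, Mod (M i)] {C : Pars M} [C.Good]

instance RK.msum {f : ∀ i, M i → (ℕ → M i) → RatOf (M i)} {t : ∀ i, (ℕ → M i) → M i}
    [hf : RK C (fun i v => f i (v 0) (fun n => v (n + 1)))]
    [ht : Fn C t] : RK C (fun i v => msum (fun j => f i j v) (t i v)) := by
  obtain ⟨r, hr, h⟩ := hf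
  have hr' : FnQ C (fun i v => r i (push (v 0) (fun n => v (n + 1)))) :=
    FnQ.congr hr fun i v => by congr 1; funext n; cases n <;> rfl
  refine ⟨fun i v => Rational.sum (fun j => r i (push j v)) (t i v), ?_, fun i v => ?_⟩
  · exact FnQ.sum (r := fun i j v => r i (push j v))
  · have h1 := hr'.specialize i 1 v
    have h2 : FnQ (full (M i)) (fun _ w => r i (push (w 0) v)) := h1
    rw [val_sum h2]
    congr 1
    funext j
    exact h i (push j v)

instance RK.kpow {f : ∀ i, (ℕ → M i) → RatOf (M i)} {t : ∀ i, (ℕ → M i) → M i}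
    [hf : RK C f] [ht : Fn C t] : RK C (fun i v => kpow (f i v) (t i v)) := by
  obtain ⟨r, hr, h⟩ := hf
  exact ⟨fun i v => Rational.pow (r i v) (t i v), inferInstance, fun i v => by rw [val_pow, h]⟩

instance RK.tp {t : ∀ i, (ℕ → M i) → M i} [ht : Fn C t] : RK C (fun i v => tp (t i v)) :=
  (inferInstance : RK C (fun i v => SOA.val (twoPowNeg (t i v))))

end SumsFn

/-! ## Compiling definable functions to codes of Turing functionals -/

section Compile

variable {ι : Type v} {M : ι → Type u} [∀ i, NumStr (M i)] [∀ i, Mod (M i)] (X : ∀ i, M i → M i)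
  {k l : ℕ}

/-- The function `F` is computed by a code with oracle `X`, uniformly in the family. -/
def Cmp (F : ∀ i, (Fin k → M i) → M i) : Prop :=
  ∃ e : OracleCode k, ∀ i w, e.Eval (X i) w (F i w)

open Classical in
/-- The relation `P` is decided by a code with oracle `X`, uniformly in the family. -/
def Dec (P : ∀ i, (Fin k → M i) → Prop) : Prop :=
  Cmp X (fun i w => if P i w then 0 else 1)

variable {X}

theorem Cmp.zero : Cmp X (fun _ (_ : Fin k → _) => 0) := ⟨.zero, fun _ _ => rfl⟩

theorem Cmp.proj (j : Fin k) : Cmp X (fun _ w => w j) := ⟨.proj j, fun _ _ => rfl⟩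

theorem Cmp.comp {F : ∀ i, (Fin l → M i) → M i} {G : Fin l → ∀ i, (Fin k → M i) → M i}
    (hF : Cmp X F) (hG : ∀ j, Cmp X (G j)) : Cmp X (fun i w => F i (fun j => G j i w)) := by
  obtain ⟨e, he⟩ := hF
  choose g hg using hG
  exact ⟨.comp e g, fun i w => ⟨_, fun j => hg j i w, he i _⟩⟩

theorem Cmp.comp1 {F : ∀ i, M i → M i} {G : ∀ i, (Fin k → M i) → M i}
    (hF : Cmp X (fun i (w : Fin 1 → M i) => F i (w 0))) (hG : Cmp X G) :
    Cmp X (fun i w => F i (G i w)) :=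
  Cmp.comp (G := fun _ => G) hF fun _ => hG

theorem Cmp.comp2 {F : ∀ i, M i → M i → M i} {G H : ∀ i, (Fin k → M i) → M i}
    (hF : Cmp X (fun i (w : Fin 2 → M i) => F i (w 0) (w 1))) (hG : Cmp X G) (hH : Cmp X H) :
    Cmp X (fun i w => F i (G i w) (H i w)) :=
  Cmp.comp (G := ![G, H]) hF (fun j => by fin_cases j <;> assumption)

theorem Cmp.succ {G : ∀ i, (Fin k → M i) → M i} (hG : Cmp X G) : Cmp X (fun i w => G i w + 1) :=
  Cmp.comp1 (F := fun _ a => a + 1) ⟨.succ, fun _ _ => rfl⟩ hG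

theorem Cmp.oracle {G : ∀ i, (Fin k → M i) → M i} (hG : Cmp X G) :
    Cmp X (fun i w => X i (G i w)) :=
  Cmp.comp1 (F := X) ⟨.oracle, fun _ _ => rfl⟩ hG

/-- The beta code demanded by `Eval` exists because the step function is definable in each
structure. -/
theorem Cmp.prec {Z : ∀ i, (Fin k → M i) → M i} {S : ∀ i, (Fin (k + 2) → M i) → M i}
    (hZ : Cmp X Z) (hS : Cmp X S)
    (hd : ∀ i w, Fn2 (full (M i)) (fun _ j y => S i (Fin.cons j (Fin.cons y w)))) :
    Cmp X (fun i (w : Fin (k + 1) → M i) => mrec (Z i (Fin.tail w))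
      (fun j y => S i (Fin.cons j (Fin.cons y (Fin.tail w)))) (w 0)) := by
  obtain ⟨z, hz⟩ := hZ
  obtain ⟨s, hs⟩ := hS
  refine ⟨.prec z s, fun i w => ?_⟩
  have := hd i (Fin.tail w)
  obtain ⟨a, b, h0, h1, h⟩ := (eq_mrec_iff (Z i (Fin.tail w))
    (fun j y => S i (Fin.cons j (Fin.cons y (Fin.tail w)))) (w 0) _).1 rfl
  refine ⟨a, b, ?_, fun j hj => ?_, h⟩
  · rw [h0]; exact hz _ _
  · rw [h1 j hj]; exact hs _ _

theorem Cmp.mu {F : ∀ i, (Fin (k + 1) → M i) → M i} {Y : ∀ i, (Fin k → M i) → M i}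
    (hF : Cmp X F) (hY : ∀ i w, F i (Fin.cons (Y i w) w) = 0 ∧
      ∀ z, z < Y i w → F i (Fin.cons z w) ≠ 0) : Cmp X Y := by
  obtain ⟨e, he⟩ := hF
  refine ⟨.mu e, fun i w => ⟨?_, fun z hz => ⟨_, (hY i w).2 z hz, he i _⟩⟩⟩
  rw [← (hY i w).1]
  exact he i _

theorem Cmp.congr {F G : ∀ i, (Fin k → M i) → M i} (hF : Cmp X F) (e : ∀ i w, G i w = F i w) :
    Cmp X G := by
  obtain ⟨c, hc⟩ := hF
  exact ⟨c, fun i w => by rw [e]; exact hc i w⟩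

/-- Binary primitive recursion with one parameter. -/
theorem Cmp.prec1 {z : ∀ i, M i → M i} {s : ∀ i, M i → M i → M i → M i}
    {G H : ∀ i, (Fin k → M i) → M i}
    (hz : Cmp X (fun i (w : Fin 1 → M i) => z i (w 0)))
    (hs : Cmp X (fun i (w : Fin 3 → M i) => s i (w 0) (w 1) (w 2)))
    (hd : ∀ i x, Fn2 (full (M i)) (fun _ j y => s i j y x)) (hG : Cmp X G) (hH : Cmp X H) :
    Cmp X (fun i w => mrec (z i (H i w)) (fun j y => s i j y (H i w)) (G i w)) := by
  have h := Cmp.prec hz hs fun i w => hd i (w 0)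
  exact Cmp.comp2 (F := fun i n x => mrec (z i x) (fun j y => s i j y x) n) h hG hH

/-! ### Programs for arithmetic -/

section Arithmetic

variable {F G : ∀ i, (Fin k → M i) → M i}

theorem mrec_eq {N : Type u} [NumStr N] [Mod N] {z : N} {s : N → N → N} {f : N → N}
    [Fn2 (full N) (fun _ => s)] [Fn1 (full N) (fun _ => f)] (h0 : z = f 0)
    (h : ∀ n, s n (f n) = f (n + 1)) (n : N) : mrec z s n = f n := by
  refine SOA.induct (P := fun n => mrec z s n = f n) inferInstance ?_ (fun n hn => ?_) n
  · rw [mrec_zero, h0]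
  · rw [mrec_succ, hn, h]

theorem Cmp.add (hF : Cmp X F) (hG : Cmp X G) : Cmp X (fun i w => F i w + G i w) := by
  refine (Cmp.prec1 (z := fun _ x => x) (s := fun _ _ y _ => y + 1) (.proj 0) (.succ (.proj 1))
    (fun i x => ⟨inferInstance⟩) hF hG).congr fun i w => ?_
  have h1 : Fn2 (full (M i)) (fun _ _ y => y + 1) := ⟨inferInstance⟩
  have h2 : Fn1 (full (M i)) (fun _ n => n + G i w) := ⟨inferInstance⟩
  exact (mrec_eq (f := fun n => n + G i w) (zero_add _).symm (fun n => by ring) _).symm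

theorem Cmp.mul (hF : Cmp X F) (hG : Cmp X G) : Cmp X (fun i w => F i w * G i w) := by
  refine (Cmp.prec1 (z := fun _ _ => 0) (s := fun _ _ y x => y + x) .zero (.add (.proj 1) (.proj 2))
    (fun i x => ⟨inferInstance⟩) hF hG).congr fun i w => ?_
  have h1 : Fn2 (full (M i)) (fun _ _ y => y + G i w) := ⟨inferInstance⟩
  have h2 : Fn1 (full (M i)) (fun _ n => n * G i w) := ⟨inferInstance⟩
  exact (mrec_eq (f := fun n => n * G i w) (zero_mul _).symm (fun n => by ring) _).symm

open Classical in
theorem Cmp.isZero (hF : Cmp X F) : Cmp X (fun i w => if F i w = 0 then 1 else 0) := by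
  refine (Cmp.prec1 (z := fun _ _ => 1) (s := fun _ _ _ _ => 0)
    ((Cmp.succ .zero).congr fun _ _ => (zero_add _).symm) .zero
    (fun i x => ⟨inferInstance⟩) hF hF).congr fun i w => ?_
  have h1 : Fn2 (full (M i)) (fun _ _ _ => (0 : M i)) := ⟨inferInstance⟩
  have h2 : Fn1 (full (M i)) (fun _ n => if n = 0 then 1 else (0 : M i)) := ⟨inferInstance⟩
  refine (mrec_eq (f := fun n => if n = 0 then 1 else (0 : M i)) (by simp) (fun n => ?_) _).symm
  rw [if_neg (Mod.model.succ_ne_zero n)]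

/-- The predecessor. -/
def mpred {N : Type u} [NumStr N] [Mod N] (n : N) : N := mrec 0 (fun i _ => i) n

theorem mpred_zero {N : Type u} [NumStr N] [Mod N] : mpred (0 : N) = 0 :=
  have : Fn2 (full N) (fun _ i _ => i) := ⟨inferInstance⟩
  mrec_zero _ _

theorem mpred_succ {N : Type u} [NumStr N] [Mod N] (n : N) : mpred (n + 1) = n :=
  have : Fn2 (full N) (fun _ i _ => i) := ⟨inferInstance⟩
  mrec_succ _ _ _

instance Fn.mpred {C : Pars M} [C.Good] {t : ∀ i, (ℕ → M i) → M i} [Fn C t] :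
    Fn C (fun i v => mpred (t i v)) := by
  unfold SOA.mpred; infer_instance

/-- Truncated subtraction. -/
def msub {N : Type u} [NumStr N] [Mod N] (x n : N) : N := mrec x (fun _ y => mpred y) n

theorem msub_spec {N : Type u} [NumStr N] [Mod N] (x n : N) :
    n + msub x n = x ∨ (x ≤ n ∧ msub x n = 0) := by
  have h1 : Fn2 (full N) (fun _ _ y => mpred y) := ⟨inferInstance⟩
  have h2 : Fn1 (full N) (fun _ n => msub x n) := ⟨by unfold msub; infer_instance⟩
  refine SOA.induct (P := fun n => n + msub x n = x ∨ (x ≤ n ∧ msub x n = 0)) inferInstance ?_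
    (fun n hn => ?_) n
  · left; rw [msub, mrec_zero, zero_add]
  · have e : msub x (n + 1) = mpred (msub x n) := mrec_succ _ _ _
    rw [e]
    rcases hn with h | ⟨h, h'⟩
    · rcases Arith.zero_or_succ (msub x n) with h0 | ⟨y, hy⟩
      · right
        rw [h0, mpred_zero]
        exact ⟨by rw [← h, h0, add_zero]; exact le_self_add, rfl⟩
      · left
        rw [hy, mpred_succ, ← h, hy]; ring
    · right
      rw [h', mpred_zero]
      exact ⟨h.trans le_self_add, rfl⟩

theorem msub_eq_zero {N : Type u} [NumStr N] [Mod N] (x n : N) : msub x n = 0 ↔ x ≤ n := by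
  rcases msub_spec x n with h | ⟨h, h'⟩
  · constructor
    · intro h0; rw [← h, h0, add_zero]
    · intro hx
      have : n + msub x n ≤ n + 0 := by rwa [h, add_zero]
      exact le_antisymm (le_of_add_le_add_left this) (zero_le' _)
  · exact ⟨fun _ => h, fun _ => h'⟩

theorem Cmp.msub (hF : Cmp X F) (hG : Cmp X G) : Cmp X (fun i w => msub (F i w) (G i w)) := by
  refine Cmp.prec1 (z := fun _ x => x) (s := fun _ _ y _ => mpred y) (.proj 0) ?_
    (fun i x => ⟨inferInstance⟩) hG hF
  exact Cmp.prec1 (z := fun _ _ => 0) (s := fun _ j _ _ => j) .zero (.proj 0)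
    (fun i x => ⟨inferInstance⟩) (.proj 1) (.proj 1)

end Arithmetic

/-! ### Decidable relations -/

section Relations

variable {F G : ∀ i, (Fin k → M i) → M i} {P Q : ∀ i, (Fin k → M i) → Prop}

theorem Dec.of_zero (hF : Cmp X F) : Dec X (fun i w => F i w = 0) := by
  classical
  refine hF.isZero.isZero.congr fun i w => ?_
  split_ifs <;> simp_all

theorem Dec.congr (h : Dec X P) (e : ∀ i w, Q i w ↔ P i w) : Dec X Q :=
  Cmp.congr h fun i w => by classical exact if_congr (e i w) rfl rfl

theorem Dec.not (h : Dec X P) : Dec X (fun i w => ¬ P i w) := by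
  classical
  refine Cmp.congr h.isZero fun i w => ?_
  split_ifs <;> simp_all

theorem Dec.and (h : Dec X P) (h' : Dec X Q) : Dec X (fun i w => P i w ∧ Q i w) := by
  classical
  refine (Dec.of_zero (Cmp.add h h')).congr fun i w => ?_
  rw [add_eq_zero_iff_of_nonneg (zero_le' _) (zero_le' _)]
  by_cases hP : P i w <;> by_cases hQ : Q i w <;> simp [hP, hQ]

theorem Dec.le (hF : Cmp X F) (hG : Cmp X G) : Dec X (fun i w => F i w ≤ G i w) :=
  (Dec.of_zero (hF.msub hG)).congr fun _ _ => (msub_eq_zero _ _).symm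

theorem Dec.lt (hF : Cmp X F) (hG : Cmp X G) : Dec X (fun i w => F i w < G i w) :=
  (Dec.le hG hF).not.congr fun _ _ => not_le.symm

theorem Dec.eq (hF : Cmp X F) (hG : Cmp X G) : Dec X (fun i w => F i w = G i w) :=
  ((Dec.le hF hG).and (Dec.le hG hF)).congr fun _ _ => le_antisymm_iff

theorem Dec.comp {P : ∀ i, (Fin l → M i) → Prop} {G : Fin l → ∀ i, (Fin k → M i) → M i}
    (hP : Dec X P) (hG : ∀ j, Cmp X (G j)) : Dec X (fun i w => P i (fun j => G j i w)) :=
  Cmp.comp hP hG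

theorem Dec.mu {P : ∀ i, (Fin (k + 1) → M i) → Prop} {Y : ∀ i, (Fin k → M i) → M i}
    (hP : Dec X P) (hY : ∀ i w, P i (Fin.cons (Y i w) w) ∧
      ∀ z, z < Y i w → ¬ P i (Fin.cons z w)) : Cmp X Y := by
  refine Cmp.mu hP fun i w => ⟨if_pos (hY i w).1, fun z hz => ?_⟩
  rw [if_neg ((hY i w).2 z hz)]
  exact one_ne_zero

theorem exists_least {N : Type u} [NumStr N] [Mod N] {P : N → Prop}
    (hP : Dl (full N) (fun _ v => P (v 0))) (h : ∃ n, P n) : ∃ n, P n ∧ ∀ m, m < n → ¬ P m :=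
  Dl.exists_least (P := fun _ n _ => P n) hP () (fun _ => 0) h

/-- The search for the least n with n < F → P n stops at F at the latest, so it is total; the
bounded quantifier holds exactly if the search stops before F. -/
theorem Dec.bex {P : ∀ i, (Fin (k + 1) → M i) → Prop} (hP : Dec X P)
    (hd : ∀ i w, Dl (full (M i)) (fun _ v => P i (Fin.cons (v 0) w))) (hF : Cmp X F) :
    Dec X (fun i w => ∃ a, a < F i w ∧ P i (Fin.cons a w)) := by
  have h1 : ∀ i w, ∃ n, (n < F i w → P i (Fin.cons n w)) ∧
      ∀ m, m < n → ¬ (m < F i w → P i (Fin.cons m w)) := fun i w =>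
    have := hd i w
    exists_least (P := fun n => n < F i w → P i (Fin.cons n w)) inferInstance
      ⟨F i w, fun h => (lt_irrefl _ h).elim⟩
  choose Y hY using h1
  have h2 : Cmp X (fun i (w : Fin (k + 1) → M i) => F i (fun j => w j.succ)) :=
    hF.comp fun j => .proj j.succ
  have h3 : Cmp X Y := by
    refine Dec.mu (P := fun i w => ¬ (w 0 < F i (fun j => w j.succ) ∧ ¬ P i w))
      ((Dec.lt (.proj 0) h2).and hP.not).not fun i w => ?_
    have := hY i w
    simpa using this
  refine (Dec.lt h3 hF).congr fun i w => ?_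
  constructor
  · rintro ⟨a, ha, hPa⟩
    by_contra hlt
    exact (hY i w).2 a (ha.trans_le (not_lt.1 hlt)) fun _ => hPa
  · exact fun h => ⟨_, h, (hY i w).1 h⟩

end Relations

/-- The set coding `X`. -/
def graphSet {N : Type u} [NumStr N] (X : N → N) : Set N := {z | ∃ n, z = pair n (X n)}

/-- The assignment of the arguments `w`, or `0`, to the variables. -/
def envOf {N : Type u} [NumStr N] (σ : ℕ → Option (Fin k)) (w : Fin k → N) (n : ℕ) : N :=
  match σ n with
  | none => 0
  | some j => w j

theorem Cmp.tm (τ : Tm) (σ : ℕ → Option (Fin k)) :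
    Cmp X (fun i w => τ.eval (envOf σ w : ℕ → M i)) := by
  induction τ with
  | var n =>
    rcases h : σ n with _ | j
    · exact Cmp.zero.congr fun i w => by simp [Tm.eval, envOf, h]
    · exact (Cmp.proj j).congr fun i w => by simp [Tm.eval, envOf, h]
  | zero => exact .zero
  | one => exact (Cmp.succ .zero).congr fun i w => (zero_add _).symm
  | add s t hs ht => exact hs.add ht
  | mul s t hs ht => exact hs.mul ht

/-- The free variables after a quantifier. -/
def liftOpt (σ : ℕ → Option (Fin k)) : ℕ → Option (Fin (k + 1))
  | 0 => some 0
  | n + 1 => (σ n).map Fin.succ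

theorem envOf_liftOpt {N : Type u} [NumStr N] (σ : ℕ → Option (Fin k)) (a : N) (w : Fin k → N) :
    envOf (liftOpt σ) (Fin.cons a w : Fin (k + 1) → N) = push a (envOf σ w) := by
  funext n
  cases n with
  | zero => rfl
  | succ n =>
    simp only [envOf, liftOpt, push]
    rcases σ n with _ | j <;> simp

theorem holds_definable {N : Type u} [NumStr N] [Mod N] (θ : BdFormula) {V : ℕ → Set N}
    (hV : ∀ j, V j ∈ Mod.S (M := N)) (ρ : ℕ → Option ℕ) (c : ℕ → N) :
    Dl (full N) (fun _ v => θ.Holds V (fun n => match ρ n with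
      | none => c n
      | some j => v j)) := by
  refine Dl.of_D0 ⟨θ.rename (fun k => k) (fun n => match ρ n with
    | none => 2 * n + 1
    | some j => 2 * j), fun j _ => V j, fun j _ => c j, fun j => hV j, fun _ => trivial,
    fun _ v => ?_⟩
  rw [BdFormula.holds_rename]
  have : (fun n => match ρ n with
      | none => c n
      | some j => v j) = fun n => mix v c (match ρ n with
      | none => 2 * n + 1
      | some j => 2 * j) := by
    funext n
    rcases ρ n with _ | j
    · exact (mix_odd v c n).symm
    · exact (mix_even v c j).symm
  rw [this]

/-- Structural induction on bounded formulas, with bounded quantifiers treated as terminating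
searches. Internality of the oracle supplies the least number principle for these searches. -/
theorem Dec.holds (hX : ∀ i, Internal Mod.S (X i)) (θ : BdFormula) :
    ∀ {k : ℕ} (σ : ℕ → Option (Fin k)),
      Dec X (fun i w => θ.Holds (fun _ => graphSet (X i)) (envOf σ w)) := by
  induction θ with
  | eq s t => exact fun σ => Dec.eq (Cmp.tm s σ) (Cmp.tm t σ)
  | lt s t => exact fun σ => Dec.lt (Cmp.tm s σ) (Cmp.tm t σ)
  | mem t A =>
    intro k σ
    have ht := Cmp.tm (X := X) t σ
    have h1 : Cmp X (fun i (w : Fin (k + 1) → M i) => t.eval (envOf σ (fun j => w j.succ))) :=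
      ht.comp fun j => .proj j.succ
    have h0 : Cmp X (fun i (w : Fin (k + 1) → M i) => w 0) := .proj 0
    have h2 : Cmp X (fun i (w : Fin (k + 1) → M i) => pair (w 0) (X i (w 0))) :=
      ((h0.add h0.oracle).mul (h0.add h0.oracle)).add h0
    -- Membership in the graph is a bounded search, since n ≤ pair n (X n).
    refine (Dec.bex (Dec.eq h1 h2) (fun i w => ?_) ht.succ).congr fun i w => ?_
    · have := Fn1.of_internal (hX i)
      simp only [Fin.cons_succ, Fin.cons_zero]
      infer_instance
    · simp only [Fin.cons_succ, Fin.cons_zero, lt_succ]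
      change (∃ n, _) ↔ _
      refine exists_congr fun n => ⟨fun h => ⟨?_, h⟩, And.right⟩
      rw [h]; exact left_le_pair _ _
  | neg φ ih => exact fun σ => (ih σ).not
  | and φ ψ ih ih' => exact fun σ => (ih σ).and (ih' σ)
  | ball t φ ih =>
    intro k σ
    refine (Dec.bex (ih (liftOpt σ)).not (fun i w => ?_) (Cmp.tm t σ)).not.congr fun i w => ?_
    · simp only [envOf_liftOpt]
      have := holds_definable φ (V := fun _ => graphSet (X i)) (fun _ => hX i)
        (fun n => if n = 0 then some 0 else none) (fun n => envOf σ w (n - 1))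
      have h' : Dl (full (M i)) (fun _ v => φ.Holds (fun _ => graphSet (X i))
          (push (v 0) (envOf σ w))) := by
        refine this.congr fun _ v => ?_
        have e : push (v 0) (envOf σ w) = (fun n => match (if n = 0 then some 0 else none) with
            | none => envOf σ w (n - 1)
            | some j => v j) := by
          funext n; cases n <;> simp [push]
        rw [e]
      infer_instance
    · simp only [envOf_liftOpt, not_exists, not_and, not_not]
      rfl

/-- The only parameter is the oracle. -/
def oraclePars (X : ∀ i, M i → M i) : Pars M where
  sets := {fun i => graphSet (X i)}
  nums := {fun _ => 0}
  sets_nonempty := Set.singleton_nonempty _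
  nums_nonempty := Set.singleton_nonempty _

theorem oraclePars_good (hX : ∀ i, Internal Mod.S (X i)) : (oraclePars X).Good :=
  ⟨by rintro A rfl i; exact hX i⟩

theorem Fn1.oracle : Fn1 (oraclePars X) X := by
  refine ⟨⟨Sg.of_D0 (h := ?_)⟩⟩
  have h1 : IsTm (oraclePars X) (fun _ v => pair (v 1) (v 0)) := by
    unfold pair; infer_instance
  refine (D0.mem (C := oraclePars X) (A := fun i => graphSet (X i))
    (t := fun _ v => pair (v 1) (v 0)) rfl).congr fun i v => ?_
  change _ ↔ ∃ n, _
  simp only [pair_inj]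
  simp

/-- A function which is uniformly definable from the oracle is computed by a Turing functional. -/
theorem exists_oracleCode (hX : ∀ i, Internal Mod.S (X i)) {Y : ∀ i, M i → M i}
    (hY : Fn1 (oraclePars X) Y) : ∃ e : OracleCode 1, ∀ i, Computes e (X i) (Y i) := by
  obtain ⟨θ, A, p, hA, hp, h⟩ := hY.out.graph.sigmaHolds
  obtain rfl : A = fun _ i => graphSet (X i) := funext fun j => hA j
  obtain rfl : p = fun _ _ => 0 := funext fun j => hp j
  -- Variable 0 is the witness, variable 1 the value, every later even variable the argument; the
  -- remaining odd variables are parameters, all equal to 0.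
  set σ : ℕ → Option (Fin 3) := fun n => if n = 0 then some 0 else if n = 1 then some 1 else
    if n % 2 = 0 then some 2 else none with hσ
  set P : ∀ i, M i → M i → M i → Prop := fun i m y x =>
    θ.Holds (fun _ => graphSet (X i)) (envOf σ ![m, y, x]) with hP
  have hgraph : ∀ i x y, y = Y i x ↔ ∃ m, P i m y x := by
    intro i x y
    have := h i y (fun _ => x)
    refine this.trans (exists_congr fun m => ?_)
    have e : push m (push y (mix (fun _ => x) (fun _ => 0))) = envOf σ ![m, y, x] := by
      funext n
      rcases n with _ | _ | n
      · rfl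
      · rfl
      · have h2 : (n + 1 + 1) % 2 = n % 2 := by omega
        by_cases hn : n % 2 = 0 <;> simp [push, mix, envOf, hσ, hn, h2]
    rw [e]
  have hDec : Dec X (fun i (w : Fin 3 → M i) => P i (w 0) (w 1) (w 2)) := by
    refine (Dec.holds hX θ σ).congr fun i w => ?_
    have : ![w 0, w 1, w 2] = w := by funext j; fin_cases j <;> rfl
    simp only [hP, this]
  have hDl : ∀ i, Dl (full (M i)) (fun _ v => P i (v 0) (v 1) (v 2)) := by
    intro i
    refine (holds_definable θ (V := fun _ => graphSet (X i)) (fun _ => hX i)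
      (fun n => (σ n).map (fun j => (j : ℕ))) (fun _ => 0)).congr fun _ v => ?_
    have e : envOf σ ![v 0, v 1, v 2] = (fun n => match (σ n).map (fun j => (j : ℕ)) with
        | none => (0 : M i)
        | some j => v j) := by
      funext n
      simp only [envOf]
      rcases σ n with _ | j
      · rfl
      · fin_cases j <;> rfl
    simp only [hP, e]
  have hDl3 : ∀ i (b x : M i), Dl (full (M i)) (fun _ v => P i (v 0) (v 1) x) := by
    intro i b x
    exact Dl.subst (t := fun _ _ => x) (R := fun _ x v => P i (v 0) (v 1) x)
      ((hDl i).reindex (fun n => if n = 0 then 1 else if n = 1 then 2 else 0)) inferInstance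
  have hDl2 : ∀ i (y x : M i), Dl (full (M i)) (fun _ v => P i (v 0) y x) := by
    intro i y x
    exact Dl.subst (t := fun _ _ => y) (R := fun _ y v => P i (v 0) y x)
      ((hDl3 i y x).reindex (fun n => if n = 0 then 1 else 0)) inferInstance
  have hP2 : Dec X (fun i (w : Fin 3 → M i) => ∃ m, m < w 1 ∧ P i m (w 0) (w 2)) := by
    refine Dec.bex (P := fun i (w : Fin 4 → M i) => P i (w 0) (w 1) (w 3)) ?_ (fun i w => ?_)
      (.proj 1)
    · exact hDec.comp (G := ![fun i w => w 0, fun i w => w 1, fun i w => w 3])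
        (fun j => by fin_cases j <;> exact .proj _)
    · exact hDl2 i (w 0) (w 2)
  have hDlP2 : ∀ i (b x : M i),
      Dl (full (M i)) (fun _ v => ∃ m, m < b ∧ P i m (v 0) x) := by
    intro i b x
    have := (hDl3 i b x)
    infer_instance
  have hP1 : Dec X (fun i (w : Fin 2 → M i) => ∃ y, y < w 0 ∧ ∃ m, m < w 0 ∧ P i m y (w 1)) := by
    refine Dec.bex (P := fun i (w : Fin 3 → M i) => ∃ m, m < w 1 ∧ P i m (w 0) (w 2)) hP2
      (fun i w => hDlP2 i (w 0) (w 1)) (.proj 0)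
  -- Two successive searches avoid decoding pairs: first the least b below which there are a value
  -- and a witness, then the least y with a witness below b. Since the graph is single valued, this
  -- y is the value.
  have hB : ∀ i x, ∃ b, (∃ y, y < b ∧ ∃ m, m < b ∧ P i m y x) ∧
      ∀ b', b' < b → ¬ ∃ y, y < b' ∧ ∃ m, m < b' ∧ P i m y x := by
    intro i x
    have h3 := hDl3 i x x
    have h3' : Dl (full (M i)) (fun _ v => P i (v 0) (v 1) x) := h3
    refine exists_least (P := fun b => ∃ y, y < b ∧ ∃ m, m < b ∧ P i m y x) inferInstance ?_
    obtain ⟨m, hm⟩ := (hgraph i x (Y i x)).1 rfl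
    exact ⟨max (Y i x) m + 1, Y i x, lt_succ.2 (le_max_left _ _), m,
      lt_succ.2 (le_max_right _ _), hm⟩
  choose B hB using hB
  have hBc : Cmp X (fun i (w : Fin 1 → M i) => B i (w 0)) :=
    Dec.mu hP1 fun i w => hB i (w 0)
  have hYc : Cmp X (fun i (w : Fin 1 → M i) => Y i (w 0)) := by
    refine Dec.mu (P := fun i (w : Fin 2 → M i) => ∃ m, m < B i (w 1) ∧ P i m (w 0) (w 1)) ?_
      fun i w => ⟨?_, fun z hz hm => ?_⟩
    · refine hP2.comp (G := ![fun i w => w 0, fun i w => B i (w 1), fun i w => w 1])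
        (fun j => ?_)
      fin_cases j
      · exact .proj _
      · exact Cmp.comp1 (F := B) hBc (.proj 1)
      · exact .proj _
    · obtain ⟨y, -, m, hm, hP⟩ := (hB i (w 0)).1
      have : y = Y i (w 0) := (hgraph i (w 0) y).2 ⟨m, hP⟩
      exact ⟨m, hm, this ▸ hP⟩
    · obtain ⟨m, -, hP⟩ := hm
      exact hz.ne ((hgraph i (w 0) z).2 ⟨m, hP⟩)
  obtain ⟨e, he⟩ := hYc
  exact ⟨e, fun i n => he i (fun _ => n)⟩

end Compile

/-! ## Finite sums and variation of sequences -/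

section Sequences

variable {M : Type u} [NumStr M] [m : Mod M]

theorem msum_le {f g : M → RatOf M} [hf : RK1 f] [hg : RK1 g] {n : M}
    (h : ∀ i, i < n → f i ≤ g i) : msum f n ≤ msum g n := by
  refine induct (P := fun k => k ≤ n → msum f k ≤ msum g k) inferInstance (by simp)
    (fun k hk hkn => ?_) n le_rfl
  rw [msum_succ, msum_succ]
  exact add_le_add (hk (le_self_add.trans hkn)) (h k (succ_le.1 hkn))

theorem msum_add (f g : M → RatOf M) [hf : RK1 f] [hg : RK1 g] (n : M) :
    msum (fun i => f i + g i) n = msum f n + msum g n := by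
  refine induct (P := fun n => msum (fun i => f i + g i) n = msum f n + msum g n) inferInstance
    (by simp) (fun k hk => ?_) n
  rw [msum_succ, msum_succ, msum_succ, hk]; ring

theorem msum_const_mul (c : RatOf M) (f : M → RatOf M) [hf : RK1 f] (n : M) :
    msum (fun i => c * f i) n = c * msum f n := by
  refine induct (P := fun n => msum (fun i => c * f i) n = c * msum f n) inferInstance
    (by simp) (fun k hk => ?_) n
  rw [msum_succ, msum_succ, hk]; ring

theorem msum_const (c : RatOf M) (n : M) : msum (fun _ => c) n = RatOf.ofNum n * c := by
  refine induct (P := fun n => msum (fun _ => c) n = RatOf.ofNum n * c) inferInstance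
    (by simp) (fun k hk => ?_) n
  rw [msum_succ, hk, map_add, map_one]; ring

/-- The variation of the sequence `a` up to the index `k`. -/
abbrev vari (a : M → RatOf M) (k : M) : RatOf M := msum (fun j => |a (j + 1) - a j|) k

variable (a : M → RatOf M) [ha : RK1 a]

theorem abs_sub_le_vari (s j : M) : |a (s + j) - a s| ≤ vari a (s + j) - vari a s := by
  refine induct (P := fun j => |a (s + j) - a s| ≤ vari a (s + j) - vari a s) inferInstance
    (by simp) (fun k hk => ?_) j
  rw [← add_assoc]
  have e : vari a (s + k + 1) = vari a (s + k) + |a (s + k + 1) - a (s + k)| := msum_succ _ _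
  rw [e]
  have := abs_sub_le (a (s + k + 1)) (a (s + k)) (a s)
  linarith

theorem vari_mono {s t : M} (h : s ≤ t) : vari a s ≤ vari a t := by
  obtain ⟨j, rfl⟩ := exists_add_of_le h
  linarith [abs_sub_le_vari a s j, abs_nonneg (a (s + j) - a s)]

theorem vari_nonneg (t : M) : 0 ≤ vari a t := by
  have := vari_mono a (zero_le' t)
  simpa using this

theorem abs_sub_le_vari' {s t n : M} (hs : s ≤ n) (ht : t ≤ n) : |a s - a t| ≤ vari a n := by
  wlog h : s ≤ t generalizing s t
  · rw [abs_sub_comm]; exact this ht hs (le_of_not_ge h)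
  obtain ⟨j, rfl⟩ := exists_add_of_le h
  rw [abs_sub_comm]
  linarith [abs_sub_le_vari a s j, vari_mono a ht, vari_nonneg a s]

theorem vari_coarse_le (n d : M) : vari (fun i => a (i * d)) n ≤ vari a (n * d) := by
  refine induct (P := fun n => vari (fun i => a (i * d)) n ≤ vari a (n * d)) inferInstance
    (by simp) (fun k hk => ?_) n
  have e : vari (fun i => a (i * d)) (k + 1) =
    vari (fun i => a (i * d)) k + |a ((k + 1) * d) - a (k * d)| := msum_succ _ _
  have := abs_sub_le_vari a (k * d) d
  rw [e, show (k + 1) * d = k * d + d by ring]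
  linarith

/-- Inside a block, each term differs from the first one by at most the variation over the block. -/
theorem abs_block_le (s j : M) :
    |msum (fun i => |a i|) (s + j) - msum (fun i => |a i|) s - RatOf.ofNum j * (|a s|)|
      ≤ RatOf.ofNum j * (vari a (s + j) - vari a s) := by
  refine induct (P := fun j =>
    |msum (fun i => |a i|) (s + j) - msum (fun i => |a i|) s - RatOf.ofNum j * (|a s|)|
      ≤ RatOf.ofNum j * (vari a (s + j) - vari a s)) inferInstance
    (by simp) (fun k hk => ?_) j
  rw [← add_assoc, msum_succ, map_add, map_one]
  have h1 := abs_abs_sub_abs_le_abs_sub (a (s + k)) (a s)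
  have h2 := abs_sub_le_vari a s k
  have h3 : vari a (s + k) ≤ vari a (s + k + 1) := vari_mono a le_self_add
  have h4 := abs_add_le (msum (fun i => |a i|) (s + k) - msum (fun i => |a i|) s -
    RatOf.ofNum k * |a s|) (|a (s + k)| - |a s|)
  have h5 : RatOf.ofNum k * (vari a (s + k) - vari a s) ≤
      RatOf.ofNum k * (vari a (s + k + 1) - vari a s) :=
    mul_le_mul_of_nonneg_left (by linarith) (RatOf.ofNum_nonneg k)
  have e : msum (fun i => |a i|) (s + k) + |a (s + k)| - msum (fun i => |a i|) s -
      (RatOf.ofNum k + 1) * |a s| = (msum (fun i => |a i|) (s + k) - msum (fun i => |a i|) s -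
    RatOf.ofNum k * |a s|) + (|a (s + k)| - |a s|) := by ring
  rw [e]
  linarith

/-- The variations of the blocks telescope, so n blocks cost d times one total variation, and not n
times as much. -/
theorem abs_refine_le (n d : M) :
    |msum (fun i => |a i|) (n * d) - RatOf.ofNum d * msum (fun i => |a (i * d)|) n|
      ≤ RatOf.ofNum d * vari a (n * d) := by
  refine induct (P := fun n =>
    |msum (fun i => |a i|) (n * d) - RatOf.ofNum d * msum (fun i => |a (i * d)|) n|
      ≤ RatOf.ofNum d * vari a (n * d)) inferInstance
    (by simp) (fun k hk => ?_) n
  have e : msum (fun i => |a (i * d)|) (k + 1) = msum (fun i => |a (i * d)|) k + |a (k * d)| :=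
    msum_succ _ _
  rw [show (k + 1) * d = k * d + d by ring, e]
  have h1 := abs_block_le a (k * d) d
  have h2 := abs_add_le (msum (fun i => |a i|) (k * d) -
    RatOf.ofNum d * msum (fun i => |a (i * d)|) k)
    (msum (fun i => |a i|) (k * d + d) - msum (fun i => |a i|) (k * d) -
      RatOf.ofNum d * |a (k * d)|)
  have e2 : msum (fun i => |a i|) (k * d + d) - RatOf.ofNum d *
      (msum (fun i => |a (i * d)|) k + |a (k * d)|) = (msum (fun i => |a i|) (k * d) -
    RatOf.ofNum d * msum (fun i => |a (i * d)|) k) +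
    (msum (fun i => |a i|) (k * d + d) - msum (fun i => |a i|) (k * d) -
      RatOf.ofNum d * |a (k * d)|) := by ring
  rw [e2]
  linarith

/-- Summing |a i| ≤ |a j| + V over j: the passage from an average bound to a pointwise bound. -/
theorem mul_abs_le_sum {n i : M} {V : RatOf M} (hV : vari a n ≤ V) (hi : i ≤ n) :
    RatOf.ofNum n * |a i| ≤ msum (fun j => |a j|) n + RatOf.ofNum n * V := by
  have h1 := msum_le (f := fun _ => |a i|) (g := fun j => |a j| + V) (n := n) fun j hj => by
    have := abs_sub_le_vari' a hi hj.le
    have h2 := abs_sub_abs_le_abs_sub (a i) (a j)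
    linarith
  rw [msum_const, msum_add, msum_const] at h1
  exact h1

end Sequences

/-! ## Riemann sums -/

section Riemann

variable {M : Type u} [NumStr M] [m : Mod M]

/-- `limsup s ≤ c` -/
def KLim (s : M → RatOf M) (c : RatOf M) : Prop :=
  ∀ ε, 0 < ε → ∃ N, ∀ n, N ≤ n → s n ≤ c + ε

theorem limLE_iff {s : M → Rational M} {q : Rational M} :
    LimLE s q ↔ KLim (fun n => val (s n)) (val q) := by
  constructor
  · intro h ε hε
    obtain ⟨e, rfl⟩ := exists_val ε
    obtain ⟨N, hN⟩ := h e ((positive_iff e).2 hε)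
    refine ⟨N, fun n hn => ?_⟩
    have := (LE_iff _ _).1 (hN n hn)
    rwa [val_add] at this
  · intro h e he
    obtain ⟨N, hN⟩ := h (val e) ((positive_iff e).1 he)
    refine ⟨N, fun n hn => ?_⟩
    rw [LE_iff, val_add]
    exact hN n hn

theorem exists_div_le (V : RatOf M) {ε : RatOf M} (hε : 0 < ε) :
    ∃ N : M, ∀ n, N ≤ n → V / (RatOf.ofNum n + 1) ≤ ε := by
  obtain ⟨N, hN⟩ := RatOf.exists_lt_ofNum (V / ε)
  refine ⟨N, fun n hn => ?_⟩
  rw [div_le_iff₀ (RatOf.ofNum_succ_pos n)]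
  rw [div_lt_iff₀ hε] at hN
  have : RatOf.ofNum N ≤ RatOf.ofNum n := RatOf.ofNum_le.2 hn
  nlinarith

theorem KLim.mono {s : M → RatOf M} {c c' : RatOf M} (h : KLim s c) (hc : c ≤ c') : KLim s c' :=
  fun ε hε => (h ε hε).imp fun N hN n hn => (hN n hn).trans (by linarith)

/-- `f` maps definable functions to definable functions. -/
class DF (f : RatOf M → RatOf M) : Prop where
  out : ∀ g : Unit → (ℕ → M) → RatOf M, RK (full M) g → RK (full M) (fun i v => f (g i v))

instance (priority := low) RK.df {f : RatOf M → RatOf M} [hf : DF f]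
    {g : Unit → (ℕ → M) → RatOf M} [hg : RK (full M) g] : RK (full M) (fun i v => f (g i v)) :=
  hf.out g hg

instance DF.sub {f g : RatOf M → RatOf M} [hf : DF f] [hg : DF g] : DF (fun x => f x - g x) :=
  ⟨fun h _ => have := hf.out h ‹_›; have := hg.out h ‹_›; inferInstance⟩

/-- The Riemann sum of `|f|`. -/
def rs (f : RatOf M → RatOf M) (N : M) : RatOf M :=
  msum (fun i => |f (RatOf.ofNum i / (RatOf.ofNum N + 1))|) (N + 1) / (RatOf.ofNum N + 1)

/-- The variation of `f` on the grid of the multiples of `1 / (N + 1)`. -/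
def gvar (f : RatOf M → RatOf M) (N : M) : RatOf M :=
  vari (fun i => f (RatOf.ofNum i / (RatOf.ofNum N + 1))) (N + 1)

theorem mulDen_eq (N d : M) : mulDen N d + 1 = (N + 1) * (d + 1) := by
  simp only [mulDen]; ring

theorem right_le_mulDen (N d : M) : d ≤ mulDen N d := le_add_self

theorem grid_mul (N d i : M) :
    RatOf.ofNum (i * (d + 1)) / (RatOf.ofNum (mulDen N d) + 1) =
      RatOf.ofNum i / (RatOf.ofNum N + 1) := by
  rw [ofNum_mulDen, map_mul, map_add, map_one]
  exact mul_div_mul_right _ _ (RatOf.ofNum_succ_pos d).ne'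

variable {f g h : RatOf M → RatOf M} [hf : DF f] [hg : DF g] [hh : DF h]

theorem gvar_nonneg (N : M) : 0 ≤ gvar f N :=
  vari_nonneg (fun i => f (RatOf.ofNum i / (RatOf.ofNum N + 1))) (N + 1)

theorem gvar_refine (N d : M) : gvar f N ≤ gvar f (mulDen N d) := by
  have := vari_coarse_le (fun i => f (RatOf.ofNum i / (RatOf.ofNum (mulDen N d) + 1))) (N + 1) (d + 1)
  simp only [grid_mul] at this
  rwa [← mulDen_eq] at this

/-- The error depends only on the coarser mesh. As `mulDen N d` is a common refinement of the grids
N and d, any two grids can be compared through it. -/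
theorem rs_refine {V : RatOf M} (hV : ∀ N, gvar f N ≤ V) (N d : M) :
    |rs f (mulDen N d) - rs f N| ≤ V / (RatOf.ofNum N + 1) := by
  have h1 := abs_refine_le (fun i => f (RatOf.ofNum i / (RatOf.ofNum (mulDen N d) + 1)))
    (N + 1) (d + 1)
  simp only [grid_mul] at h1
  rw [← mulDen_eq, map_add, map_one] at h1
  have h2 := hV (mulDen N d)
  unfold gvar at h2
  have hN := RatOf.ofNum_succ_pos N
  have hd := RatOf.ofNum_succ_pos d
  unfold rs
  set S := msum (fun i => |f (RatOf.ofNum i / (RatOf.ofNum (mulDen N d) + 1))|) (mulDen N d + 1)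
  set S' := msum (fun i => |f (RatOf.ofNum i / (RatOf.ofNum N + 1))|) (N + 1)
  rw [ofNum_mulDen]
  have e : S / ((RatOf.ofNum N + 1) * (RatOf.ofNum d + 1)) - S' / (RatOf.ofNum N + 1) =
      (S - (RatOf.ofNum d + 1) * S') / ((RatOf.ofNum N + 1) * (RatOf.ofNum d + 1)) := by
    field_simp
  rw [e, abs_div, abs_of_pos (mul_pos hN hd), div_le_div_iff₀ (mul_pos hN hd) hN]
  have h3 : |S - (RatOf.ofNum d + 1) * S'| ≤ (RatOf.ofNum d + 1) * V :=
    h1.trans (mul_le_mul_of_nonneg_left h2 hd.le)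
  nlinarith [mul_le_mul_of_nonneg_right h3 hN.le]

theorem mulDen_comm (N d : M) : mulDen N d = mulDen d N := by
  simp only [mulDen]; ring

theorem rs_compare {V : RatOf M} (hV : ∀ N, gvar f N ≤ V) (N d : M) :
    rs f N ≤ rs f d + V / (RatOf.ofNum N + 1) + V / (RatOf.ofNum d + 1) := by
  have h1 := abs_le.1 (rs_refine hV N d)
  have h2 := abs_le.1 (rs_refine hV d N)
  rw [mulDen_comm d N] at h2
  linarith

/-- Comparison with arbitrarily fine refinements of the grid N. The conclusion is an inequality on
one grid, which unlike the limit statement is Δ⁰₁ for definable functions and can be used in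
inductions. -/
theorem rs_le_of_lim {V c : RatOf M} (hV : ∀ N, gvar f N ≤ V) (h : KLim (rs f) c) (N : M) :
    rs f N ≤ c + V / (RatOf.ofNum N + 1) := by
  refine le_of_forall_pos_le_add fun ε hε => ?_
  obtain ⟨d, hd⟩ := h ε hε
  have h1 := hd _ (right_le_mulDen N d)
  have h2 := abs_le.1 (rs_refine hV N d)
  linarith

/-- The way back to integrals: with bounded variation, one Riemann sum controls all fine ones. -/
theorem lim_of_rs_le {V c : RatOf M} (hV : ∀ N, gvar f N ≤ V) {N : M} (h : rs f N ≤ c) :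
    KLim (rs f) (c + V / (RatOf.ofNum N + 1)) := by
  intro ε hε
  obtain ⟨n, hn⟩ := exists_div_le V hε
  refine ⟨n, fun d hd => ?_⟩
  have := rs_compare hV d N
  have := hn d hd
  linarith

theorem lim_of_forall_rs_le {f : RatOf M → RatOf M} {V c : RatOf M}
    (h : ∀ N, rs f N ≤ c + V / (RatOf.ofNum N + 1)) : KLim (rs f) c := by
  intro ε hε
  obtain ⟨n, hn⟩ := exists_div_le V hε
  exact ⟨n, fun d hd => (h d).trans (by linarith [hn d hd])⟩

theorem rs_le_add {N : M} (H : ∀ x, |h x| ≤ |f x| + |g x|) : rs h N ≤ rs f N + rs g N := by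
  unfold rs
  rw [← add_div, ← msum_add]
  exact div_le_div_of_nonneg_right (msum_le fun i _ => H _) (RatOf.ofNum_succ_pos N).le

theorem rs_sub_comm {f g : RatOf M → RatOf M} (N : M) :
    rs (fun x => f x - g x) N = rs (fun x => g x - f x) N := by
  unfold rs; simp only [abs_sub_comm]

theorem gvar_sub_le (N : M) : gvar (fun x => f x - g x) N ≤ gvar f N + gvar g N := by
  unfold gvar vari
  rw [← msum_add]
  refine msum_le fun i _ => ?_
  have := abs_sub (f (RatOf.ofNum (i + 1) / (RatOf.ofNum N + 1)) - f (RatOf.ofNum i / (RatOf.ofNum N + 1)))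
    (g (RatOf.ofNum (i + 1) / (RatOf.ofNum N + 1)) - g (RatOf.ofNum i / (RatOf.ofNum N + 1)))
  refine le_trans (le_of_eq ?_) this
  congr 1; ring

theorem rs_le_of_forall {c : RatOf M} {N : M}
    (H : ∀ i, i ≤ N → |f (RatOf.ofNum i / (RatOf.ofNum N + 1))| ≤ c) : rs f N ≤ c := by
  unfold rs
  rw [div_le_iff₀ (RatOf.ofNum_succ_pos N)]
  refine (msum_le (g := fun _ => c) fun i hi => H i (lt_succ.1 hi)).trans ?_
  rw [msum_const, map_add, map_one, mul_comm]

theorem abs_le_rs_add {V : RatOf M} {N i : M} (hV : gvar f N ≤ V) (hi : i ≤ N) :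
    |f (RatOf.ofNum i / (RatOf.ofNum N + 1))| ≤ rs f N + V := by
  have h1 := mul_abs_le_sum (fun i => f (RatOf.ofNum i / (RatOf.ofNum N + 1))) (n := N + 1)
    (i := i) hV (hi.trans le_self_add)
  rw [map_add, map_one] at h1
  have hN := RatOf.ofNum_succ_pos N
  unfold rs
  rw [← sub_nonneg] at h1 ⊢
  have := div_nonneg h1 hN.le
  refine le_of_le_of_eq this ?_
  field_simp

/-- `F` acts on codes as `f` does on rational numbers. -/
structure Rep (F : Rational M → Rational M) (f : RatOf M → RatOf M) : Prop where
  val : ∀ x, SOA.val (F x) = f (SOA.val x)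
  fn : ∀ N, FnQ (full M) (fun _ v => F (frac (v 0) N))

theorem intAbsLE_iff {F : Rational M → Rational M} {f : RatOf M → RatOf M} (hF : Rep F f)
    (q : Rational M) : IntAbsLE F q ↔ KLim (rs f) (val q) := by
  unfold IntAbsLE
  rw [limLE_iff]
  have : (fun n => val (riemannSum F n)) = rs f := by
    funext N
    have h1 := hF.fn N
    rw [riemannSum, val_mul, val_sum (r := fun i => (F (frac i N)).abs) inferInstance, val_frac, rs]
    simp only [val_abs, hF.val, val_frac, map_one]
    rw [one_div_mul_eq_div]
  rw [this]

end Riemann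

/-! ## Polynomials -/

section Poly

variable {M : Type u} [NumStr M] [m : Mod M]

/-- The coefficient of index `i`. -/
def pc (p : RatPoly M) (i : M) : RatOf M := val (dec (beta p.seqA p.seqB i))

/-- The value of the polynomial `p` at `x`. -/
def pe (p : RatPoly M) (x : RatOf M) : RatOf M := msum (fun i => pc p i * kpow x i) (p.deg + 1)

/-- The value of the derivative of `p` at `x`. -/
def pd (p : RatPoly M) (x : RatOf M) : RatOf M :=
  msum (fun i => (RatOf.ofNum i + 1) * pc p (i + 1) * kpow x i) p.deg

/-- `decode` is unspecified off the codes; on the coefficients of a valid polynomial it agrees with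
the definable `dec`. -/
theorem coeff_eq {p : RatPoly M} (hp : p.Valid) {i : M} (hi : i ≤ p.deg) :
    p.coeff i = dec (beta p.seqA p.seqB i) := by
  obtain ⟨q, hq⟩ := hp i hi
  rw [RatPoly.coeff, hq, decode_code, dec_code]

theorem eval_eq {p : RatPoly M} (hp : p.Valid) (x : Rational M) :
    p.eval x = Rational.sum (fun i => (dec (beta p.seqA p.seqB i)).mul (pow x i)) (p.deg + 1) :=
  primRec_congr fun i hi => by dsimp only; rw [coeff_eq hp (lt_succ.1 hi)]

theorem evalDeriv_eq {p : RatPoly M} (hp : p.Valid) (x : Rational M) :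
    p.evalDeriv x = Rational.sum (fun i =>
      ((ofNum (i + 1)).mul (dec (beta p.seqA p.seqB (i + 1)))).mul (pow x i)) p.deg :=
  primRec_congr fun i hi => by dsimp only; rw [coeff_eq hp (succ_le.2 hi)]

theorem Rep.eval {p : RatPoly M} (hp : p.Valid) : Rep p.eval (pe p) where
  val x := by
    rw [eval_eq hp, val_sum inferInstance]
    simp only [val_mul, val_pow]; rfl
  fn N := by
    simp only [eval_eq hp]; infer_instance

theorem Rep.evalDeriv {p : RatPoly M} (hp : p.Valid) : Rep p.evalDeriv (pd p) where
  val x := by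
    rw [evalDeriv_eq hp, val_sum inferInstance]
    simp only [val_mul, val_pow, val_ofNum, map_add, map_one]; rfl
  fn N := by
    simp only [evalDeriv_eq hp]; infer_instance

theorem Rep.sub {F G : Rational M → Rational M} {f g : RatOf M → RatOf M} (hF : Rep F f)
    (hG : Rep G g) : Rep (fun x => (F x).sub (G x)) (fun x => f x - g x) where
  val x := by rw [val_sub, hF.val, hG.val]
  fn N := by
    have := hF.fn N
    have := hG.fn N
    infer_instance

theorem polyDistLE_iff {p q : RatPoly M} (hp : p.Valid) (hq : q.Valid) (c : Rational M) :
    PolyDistLE p q c ↔ KLim (rs fun x => pe p x - pe q x) (val c) :=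
  intAbsLE_iff ((Rep.eval hp).sub (Rep.eval hq)) c

instance RK1.pc (p : RatPoly M) : RK (full M) (fun _ v => pc p (v 0)) := by
  unfold SOA.pc; infer_instance

instance DF.pe (p : RatPoly M) : DF (pe p) := ⟨fun g hg => by
  have : RK (full M) (fun _ v => g () (fun n => v (n + 1))) := hg.reindex _
  unfold SOA.pe; infer_instance⟩

instance DF.pd (p : RatPoly M) : DF (pd p) := ⟨fun g hg => by
  have : RK (full M) (fun _ v => g () (fun n => v (n + 1))) := hg.reindex _
  unfold SOA.pd; infer_instance⟩

theorem kpow_mem {x : RatOf M} (h0 : 0 ≤ x) (h1 : x ≤ 1) (k : M) : 0 ≤ kpow x k ∧ kpow x k ≤ 1 := by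
  refine induct (P := fun k => 0 ≤ kpow x k ∧ kpow x k ≤ 1) inferInstance (by simp)
    (fun k hk => ?_) k
  rw [kpow_succ]
  exact ⟨mul_nonneg hk.1 h0, mul_le_one₀ hk.2 h0 h1⟩

theorem abs_kpow_sub_le {x y : RatOf M} (hx0 : 0 ≤ x) (hx1 : x ≤ 1) (hy0 : 0 ≤ y) (hy1 : y ≤ 1)
    (k : M) : |kpow y k - kpow x k| ≤ RatOf.ofNum k * |y - x| := by
  refine induct (P := fun k => |kpow y k - kpow x k| ≤ RatOf.ofNum k * |y - x|) inferInstance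
    (by simp) (fun k hk => ?_) k
  rw [kpow_succ, kpow_succ, map_add, map_one]
  have e : kpow y k * y - kpow x k * x = (kpow y k - kpow x k) * x + kpow y k * (y - x) := by ring
  rw [e]
  refine (abs_add_le _ _).trans ?_
  rw [abs_mul, abs_mul, abs_of_nonneg hx0, abs_of_nonneg (kpow_mem hy0 hy1 k).1]
  have h1 := mul_le_of_le_one_right (abs_nonneg (kpow y k - kpow x k)) hx1
  have h2 := mul_le_of_le_one_left (abs_nonneg (y - x)) (kpow_mem hy0 hy1 k).2
  linarith

/-- The remainders satisfy R_{k+1} = R_k·x + (y - x)(y^{k+1} - x^{k+1}), and the last factor is at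
most (k + 1)|y - x| in absolute value. -/
theorem kpow_taylor {x y : RatOf M} (hx0 : 0 ≤ x) (hx1 : x ≤ 1) (hy0 : 0 ≤ y) (hy1 : y ≤ 1)
    (k : M) : |kpow y (k + 1) - kpow x (k + 1) - (RatOf.ofNum k + 1) * (y - x) * kpow x k| ≤
      (RatOf.ofNum k + 1) * (RatOf.ofNum k + 1) * ((y - x) * (y - x)) := by
  refine induct (P := fun k =>
    |kpow y (k + 1) - kpow x (k + 1) - (RatOf.ofNum k + 1) * (y - x) * kpow x k| ≤
      (RatOf.ofNum k + 1) * (RatOf.ofNum k + 1) * ((y - x) * (y - x))) inferInstance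
    ?_ (fun k hk => ?_) k
  · simp only [kpow_succ, kpow_zero, map_zero]
    ring_nf
    simp only [abs_zero]
    nlinarith [mul_self_nonneg (y - x)]
  · have e : kpow y (k + 1 + 1) - kpow x (k + 1 + 1) -
        (RatOf.ofNum (k + 1) + 1) * (y - x) * kpow x (k + 1) =
        (kpow y (k + 1) - kpow x (k + 1) - (RatOf.ofNum k + 1) * (y - x) * kpow x k) * x +
        (y - x) * (kpow y (k + 1) - kpow x (k + 1)) := by
      simp only [kpow_succ, map_add, map_one]; ring
    rw [e]
    refine (abs_add_le _ _).trans ?_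
    rw [abs_mul, abs_mul, abs_of_nonneg hx0]
    have h1 := mul_le_of_le_one_right (abs_nonneg
      (kpow y (k + 1) - kpow x (k + 1) - (RatOf.ofNum k + 1) * (y - x) * kpow x k)) hx1
    have h2 := mul_le_mul_of_nonneg_left (abs_kpow_sub_le hx0 hx1 hy0 hy1 (k + 1))
      (abs_nonneg (y - x))
    have h3 : |y - x| * |y - x| = (y - x) * (y - x) := abs_mul_abs_self _
    have h4 := RatOf.ofNum_nonneg k
    have h5 := mul_self_nonneg (y - x)
    rw [map_add, map_one] at *
    have h6 : |y - x| * ((RatOf.ofNum k + 1) * |y - x|) =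
      (RatOf.ofNum k + 1) * ((y - x) * (y - x)) := by rw [← h3]; ring
    rw [h6] at h2
    nlinarith [mul_nonneg h4 h5]

/-- A replacement for the fundamental theorem of calculus: one second-order constant per polynomial
is all that the variation estimate needs. -/
theorem poly_taylor (p : RatPoly M) : ∃ C : RatOf M, ∀ x y, 0 ≤ x → x ≤ 1 → 0 ≤ y → y ≤ 1 →
    |pe p y - pe p x - (y - x) * pd p x| ≤ C * ((y - x) * (y - x)) := by
  refine ⟨msum (fun i => |pc p (i + 1)| * ((RatOf.ofNum i + 1) * (RatOf.ofNum i + 1))) p.deg,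
    fun x y hx0 hx1 hy0 hy1 => ?_⟩
  refine induct (P := fun k => |msum (fun i => pc p i * kpow y i) (k + 1) -
    msum (fun i => pc p i * kpow x i) (k + 1) -
    (y - x) * msum (fun i => (RatOf.ofNum i + 1) * pc p (i + 1) * kpow x i) k| ≤
    msum (fun i => |pc p (i + 1)| * ((RatOf.ofNum i + 1) * (RatOf.ofNum i + 1))) k *
      ((y - x) * (y - x))) inferInstance ?_ (fun k hk => ?_) p.deg
  · rw [msum_succ, msum_succ]; simp
  · have e1 := msum_succ (fun i => pc p i * kpow y i) (k + 1)
    have e2 := msum_succ (fun i => pc p i * kpow x i) (k + 1)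
    have e3 := msum_succ (fun i => (RatOf.ofNum i + 1) * pc p (i + 1) * kpow x i) k
    have e4 := msum_succ (fun i => |pc p (i + 1)| * ((RatOf.ofNum i + 1) * (RatOf.ofNum i + 1))) k
    rw [e1, e2, e3, e4]
    set A := msum (fun i => pc p i * kpow y i) (k + 1)
    set B := msum (fun i => pc p i * kpow x i) (k + 1)
    set D := msum (fun i => (RatOf.ofNum i + 1) * pc p (i + 1) * kpow x i) k
    set E := msum (fun i => |pc p (i + 1)| * ((RatOf.ofNum i + 1) * (RatOf.ofNum i + 1))) k
    have e : A + pc p (k + 1) * kpow y (k + 1) - (B + pc p (k + 1) * kpow x (k + 1)) -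
        (y - x) * (D + (RatOf.ofNum k + 1) * pc p (k + 1) * kpow x k) =
        (A - B - (y - x) * D) + pc p (k + 1) * (kpow y (k + 1) - kpow x (k + 1) -
          (RatOf.ofNum k + 1) * (y - x) * kpow x k) := by ring
    rw [e]
    refine (abs_add_le _ _).trans ?_
    rw [abs_mul]
    have := mul_le_mul_of_nonneg_left (kpow_taylor hx0 hx1 hy0 hy1 k) (abs_nonneg (pc p (k + 1)))
    linarith

/-- Each of the N + 1 increments is f'(x)/(N + 1) up to C/(N + 1)². -/
theorem gvar_le_rs {f f' : RatOf M → RatOf M} [DF f] [DF f'] {C : RatOf M}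
    (h : ∀ x y, 0 ≤ x → x ≤ 1 → 0 ≤ y → y ≤ 1 →
      |f y - f x - (y - x) * f' x| ≤ C * ((y - x) * (y - x))) (N : M) :
    gvar f N ≤ rs f' N + C / (RatOf.ofNum N + 1) := by
  have hN := RatOf.ofNum_succ_pos N
  have key : gvar f N ≤ msum (fun i => (RatOf.ofNum N + 1)⁻¹ *
      |f' (RatOf.ofNum i / (RatOf.ofNum N + 1))| +
      C * ((RatOf.ofNum N + 1)⁻¹ * (RatOf.ofNum N + 1)⁻¹)) (N + 1) := by
    refine msum_le fun i hi => ?_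
    have hi' : RatOf.ofNum (i + 1) ≤ RatOf.ofNum N + 1 := by
      rw [← map_one RatOf.ofNum, ← map_add, RatOf.ofNum_le]; exact succ_le.2 hi
    have hi0 := RatOf.ofNum_nonneg i
    have hi1 : RatOf.ofNum i ≤ RatOf.ofNum N + 1 := by
      rw [map_add, map_one] at hi'; linarith
    have := h (RatOf.ofNum i / (RatOf.ofNum N + 1)) (RatOf.ofNum (i + 1) / (RatOf.ofNum N + 1))
      (div_nonneg hi0 hN.le) ((div_le_one hN).2 hi1)
      (div_nonneg (RatOf.ofNum_nonneg _) hN.le) ((div_le_one hN).2 hi')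
    have e : RatOf.ofNum (i + 1) / (RatOf.ofNum N + 1) - RatOf.ofNum i / (RatOf.ofNum N + 1) =
        (RatOf.ofNum N + 1)⁻¹ := by
      rw [map_add, map_one]; field_simp; ring
    rw [e] at this
    set a := f (RatOf.ofNum (i + 1) / (RatOf.ofNum N + 1))
    set b := f (RatOf.ofNum i / (RatOf.ofNum N + 1))
    set c := f' (RatOf.ofNum i / (RatOf.ofNum N + 1))
    have h2 := abs_sub_abs_le_abs_sub (a - b) ((RatOf.ofNum N + 1)⁻¹ * c)
    rw [abs_mul, abs_of_pos (inv_pos.2 hN)] at h2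
    linarith
  refine key.trans (le_of_eq ?_)
  rw [msum_add, msum_const_mul, msum_const, map_add, map_one, rs]
  field_simp

/-- Under refinement of the grid the error C/(N + 1) vanishes while the variation can only grow. -/
theorem gvar_le_of_deriv {f f' : RatOf M → RatOf M} [DF f] [DF f'] {C w : RatOf M}
    (h : ∀ x y, 0 ≤ x → x ≤ 1 → 0 ≤ y → y ≤ 1 →
      |f y - f x - (y - x) * f' x| ≤ C * ((y - x) * (y - x)))
    (hw : KLim (rs f') w) (N : M) : gvar f N ≤ w := by
  refine le_of_forall_pos_le_add fun ε hε => ?_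
  obtain ⟨d, hd⟩ := hw (ε / 2) (half_pos hε)
  obtain ⟨e, he⟩ := exists_div_le C (half_pos hε)
  have h1 := gvar_refine (f := f) N (max d e)
  have h2 := gvar_le_rs h (mulDen N (max d e))
  have h3 := hd (mulDen N (max d e)) ((le_max_left _ _).trans (right_le_mulDen _ _))
  have h4 := he (mulDen N (max d e)) ((le_max_right _ _).trans (right_le_mulDen _ _))
  linarith

theorem gvar_le_of_variation {p : RatPoly M} (hp : p.Valid) {w : Rational M}
    (h : IntAbsLE p.evalDeriv w) (N : M) : gvar (pe p) N ≤ val w := by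
  obtain ⟨C, hC⟩ := poly_taylor p
  exact gvar_le_of_deriv hC ((intAbsLE_iff (Rep.evalDeriv hp) w).1 h) N

end Poly

section PolyFn

variable {ι : Type v} {M : ι → Type u} [∀ i, NumStr (M i)] [∀ i, Mod (M i)] {C : Pars M}

variable (C) in
/-- The polynomial-valued function `p` is uniformly definable. -/
class FnP (p : ∀ i, (ℕ → M i) → RatPoly (M i)) : Prop where
  seqA : Fn C (fun i v => (p i v).seqA)
  seqB : Fn C (fun i v => (p i v).seqB)
  deg : Fn C (fun i v => (p i v).deg)

/-- The components are Σ⁰₁ definable from the code, so polynomials read off an internal function or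
the oracle are definable. -/
theorem FnP.of_code {p : ∀ i, (ℕ → M i) → RatPoly (M i)} (h : Fn C (fun i v => (p i v).code)) :
    FnP C p := by
  have key : ∀ i v a b d, (p i v).code = SOA.pair (SOA.pair a b) d ↔
      (p i v).seqA = a ∧ (p i v).seqB = b ∧ (p i v).deg = d := by
    intro i v a b d
    rw [RatPoly.code, pair_inj, pair_inj, and_assoc]
  have h3 : Fn C (fun i v => (p i (fun n => v (n + 3))).code) := h.reindex _
  refine ⟨?_, ?_, ?_⟩
  · refine Fn.of_graph (G := fun i y v => ∃ b d, (p i v).code = SOA.pair (SOA.pair y b) d)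
      inferInstance fun i v y => ?_
    simp only [key]; simp [eq_comm]
  · refine Fn.of_graph (G := fun i y v => ∃ b d, (p i v).code = SOA.pair (SOA.pair b y) d)
      inferInstance fun i v y => ?_
    simp only [key]; simp [eq_comm]
  · refine Fn.of_graph (G := fun i y v => ∃ b d, (p i v).code = SOA.pair (SOA.pair b d) y)
      inferInstance fun i v y => ?_
    simp only [key]; simp [eq_comm]

instance (priority := low) FnP.app1 {p : ∀ i, M i → RatPoly (M i)} {t : ∀ i, (ℕ → M i) → M i}
    [hp : FnP C (fun i v => p i (v 0))] [ht : Fn C t] : FnP C (fun i v => p i (t i v)) :=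
  ⟨Fn.comp1 (f := fun i x => (p i x).seqA) hp.seqA ht,
   Fn.comp1 (f := fun i x => (p i x).seqB) hp.seqB ht,
   Fn.comp1 (f := fun i x => (p i x).deg) hp.deg ht⟩

instance FnP.const {N : Type u} [NumStr N] [Mod N] (p : RatPoly N) : FnP (full N) (fun _ _ => p) :=
  ⟨inferInstance, inferInstance, inferInstance⟩

instance RK.pe [C.Good] {p : ∀ i, (ℕ → M i) → RatPoly (M i)} {f : ∀ i, (ℕ → M i) → RatOf (M i)}
    [hp : FnP C p] [hf : RK C f] : RK C (fun i v => pe (p i v) (f i v)) := by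
  unfold SOA.pe SOA.pc
  have h1 := hp.seqA
  have h2 := hp.seqB
  have h3 := hp.deg
  have h1' : Fn C (fun i v => (p i (fun n => v (n + 1))).seqA) := h1.reindex _
  have h2' : Fn C (fun i v => (p i (fun n => v (n + 1))).seqB) := h2.reindex _
  have hf' : RK C (fun i v => f i (fun n => v (n + 1))) := hf.reindex _
  infer_instance

end PolyFn

/-! ## Points of `BV` -/

section BV

variable {M : Type u} [NumStr M] [m : Mod M]

theorem tp_pos (n : M) : 0 < tp n := by
  refine induct (P := fun n => 0 < tp n) inferInstance (by simp) (fun k hk => ?_) n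
  rw [tp_succ]; exact half_pos hk

theorem tp_add_le (n k : M) : tp (n + k) ≤ tp n := by
  refine induct (P := fun k => tp (n + k) ≤ tp n) inferInstance (by simp) (fun k hk => ?_) k
  rw [← add_assoc, tp_succ]
  linarith [tp_pos (n + k)]

theorem tp_anti {a b : M} (h : a ≤ b) : tp b ≤ tp a := by
  obtain ⟨k, rfl⟩ := exists_add_of_le h
  exact tp_add_le a k

theorem tp_le_inv (n : M) : tp n * (RatOf.ofNum n + 1) ≤ 1 := by
  refine induct (P := fun n => tp n * (RatOf.ofNum n + 1) ≤ 1) inferInstance (by simp)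
    (fun k hk => ?_) n
  rw [tp_succ, map_add, map_one]
  have := tp_pos k
  have h2 : tp k * 1 ≤ tp k * (RatOf.ofNum k + 1) :=
    mul_le_mul_of_nonneg_left (by linarith [RatOf.ofNum_nonneg k]) this.le
  linarith

theorem exists_tp_le {ε : RatOf M} (hε : 0 < ε) : ∃ k : M, tp k ≤ ε := by
  obtain ⟨k, hk⟩ := exists_div_le 1 hε
  refine ⟨k, le_trans ?_ (hk k le_rfl)⟩
  rw [le_div_iff₀ (RatOf.ofNum_succ_pos k)]
  exact tp_le_inv k

/-- The facts about a sequence of polynomials coding a point of `BV` with bound `w` on the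
variation. -/
structure BVFacts (p : M → RatPoly M) (w : RatOf M) : Prop where
  valid : ∀ k, (p k).Valid
  gvar : ∀ k N, gvar (pe (p k)) N ≤ w
  rate : ∀ k, KLim (rs fun x => pe (p k) x - pe (p (k + 1)) x) (tp k)

theorem IsBVPoint.facts {F : M → M} {v : Rational M} {p : M → RatPoly M} (h : IsBVPoint F v p)
    {w : RatOf M} (hw : val v ≤ w) : BVFacts p w where
  valid := h.valid
  gvar k N := (gvar_le_of_variation (h.valid k) (h.variation k) N).trans hw
  rate k := (polyDistLE_iff (h.valid k) (h.valid (k + 1)) _).1 (h.rate k)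

theorem BVFacts.gvar_sub {p q : M → RatPoly M} {w : RatOf M} (hp : BVFacts p w)
    (hq : BVFacts q w) (k l N : M) : SOA.gvar (fun x => pe (p k) x - pe (q l) x) N ≤ 2 * w := by
  have := gvar_sub_le (f := pe (p k)) (g := pe (q l)) N
  linarith [hp.gvar k N, hq.gvar l N]

theorem BVFacts.bound_nonneg {p : M → RatPoly M} {w : RatOf M} (hp : BVFacts p w) : 0 ≤ w :=
  (gvar_nonneg (f := pe (p 0)) 0).trans (hp.gvar 0 0)

theorem rs_triangle {f g h : RatOf M → RatOf M} [DF f] [DF g] [DF h] (N : M) :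
    rs (fun x => f x - h x) N ≤ rs (fun x => f x - g x) N + rs (fun x => g x - h x) N :=
  rs_le_add (f := fun x => f x - g x) (g := fun x => g x - h x) (h := fun x => f x - h x)
    fun _ => abs_sub_le _ _ _

/-- The rates form a geometric series with sum at most 2·2^{-k}. The index i may be nonstandard, so
the triangle inequality is iterated by induction on the inequality over one fixed grid. -/
theorem BVFacts.rs_chain {p : M → RatPoly M} {w : RatOf M} (hp : BVFacts p w)
    [hd : FnP (full M) (fun _ v => p (v 0))] (k i N : M) :
    rs (fun x => pe (p k) x - pe (p (k + i)) x) N ≤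
      2 * tp k + (2 * w) / (RatOf.ofNum N + 1) := by
  have h1 : ∀ N i, rs (fun x => pe (p k) x - pe (p (k + i)) x) N ≤
      2 * tp k - 2 * tp (k + i) + RatOf.ofNum i * ((2 * w) / (RatOf.ofNum N + 1)) := by
    intro N i
    have : RK (full M) (fun _ v => rs (fun x => pe (p k) x - pe (p (k + v 0)) x) N) := by
      unfold rs; infer_instance
    refine induct (P := fun i => rs (fun x => pe (p k) x - pe (p (k + i)) x) N ≤
      2 * tp k - 2 * tp (k + i) + RatOf.ofNum i * ((2 * w) / (RatOf.ofNum N + 1))) inferInstance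
      ?_ (fun i hi => ?_) i
    · refine rs_le_of_forall (f := fun x => pe (p k) x - pe (p (k + 0)) x) fun i _ => ?_
      simp
    · have h2 := rs_triangle (f := pe (p k)) (g := pe (p (k + i))) (h := pe (p (k + i + 1))) N
      have h3 := rs_le_of_lim (f := fun x => pe (p (k + i)) x - pe (p (k + i + 1)) x)
        (fun N => hp.gvar_sub hp (k + i) (k + i + 1) N) (hp.rate (k + i)) N
      rw [← add_assoc, tp_succ, map_add, map_one]
      linarith
  -- The induction pays one grid error per step, i in total. On a fine enough refinement of the grid
  -- their sum is below ε, and returning to the grid N costs a single error.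
  refine le_of_forall_pos_le_add fun ε hε => ?_
  obtain ⟨d, hd⟩ := exists_div_le (RatOf.ofNum i * (2 * w)) hε
  have h2 := h1 (mulDen N d) i
  have h3 := hd _ (right_le_mulDen N d)
  have h4 := (abs_le.1 (rs_refine (f := fun x => pe (p k) x - pe (p (k + i)) x)
    (fun N => hp.gvar_sub hp k (k + i) N) N d)).1
  have h5 := tp_pos (k + i)
  rw [mul_div_assoc] at h3
  linarith

end BV

/-! ## Functions of coded pairs -/

section Uncurry

open Classical in
/-- The function of coded pairs given by a binary function. -/
def uncurry {N : Type u} [NumStr N] (f : N → N → N) (z : N) : N :=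
  if h : ∃ n k, z = pair n k then f h.choose h.choose_spec.choose else 0

theorem uncurry_pair {N : Type u} [NumStr N] [Mod N] (f : N → N → N) (n k : N) :
    uncurry f (pair n k) = f n k := by
  have h : ∃ n' k', pair n k = pair n' k' := ⟨n, k, rfl⟩
  rw [uncurry, dif_pos h]
  obtain ⟨h1, h2⟩ := pair_inj.1 h.choose_spec.choose_spec
  exact congrArg₂ f h1.symm h2.symm

variable {ι : Type v} {M : ι → Type u} [∀ i, NumStr (M i)] [∀ i, Mod (M i)] {C : Pars M} [C.Good]

theorem Fn1.uncurry {f : ∀ i, M i → M i → M i} [hf : Fn2 C f] :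
    Fn1 C (fun i => SOA.uncurry (f i)) := by
  refine ⟨Fn.of_graph (G := fun i y v => (∃ n k, v 0 = SOA.pair n k ∧ y = f i n k) ∨
    ((¬ ∃ n, n ≤ v 0 ∧ ∃ k, k ≤ v 0 ∧ v 0 = SOA.pair n k) ∧ y = 0)) inferInstance fun i v y => ?_⟩
  have hb : (∃ n, n ≤ v 0 ∧ ∃ k, k ≤ v 0 ∧ v 0 = SOA.pair n k) ↔ ∃ n k, v 0 = SOA.pair n k := by
    constructor
    · rintro ⟨n, -, k, -, h⟩; exact ⟨n, k, h⟩
    · rintro ⟨n, k, h⟩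
      exact ⟨n, h ▸ left_le_pair n k, k, h ▸ right_le_pair n k, h⟩
  rw [hb]
  by_cases h : ∃ n k, v 0 = SOA.pair n k
  · obtain ⟨n, k, h⟩ := h
    rw [h, uncurry_pair]
    constructor
    · rintro rfl; exact .inl ⟨n, k, rfl, rfl⟩
    · rintro (⟨n', k', h1, h2⟩ | ⟨h1, -⟩)
      · obtain ⟨rfl, rfl⟩ := pair_inj.1 h1
        exact h2
      · exact (h1 ⟨n, k, rfl⟩).elim
  · rw [SOA.uncurry, dif_neg h]
    constructor
    · exact fun e => .inr ⟨h, e⟩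
    · rintro (⟨n, k, e, -⟩ | ⟨-, e⟩)
      · exact (h ⟨n, k, e⟩).elim
      · exact e

end Uncurry

/-! ## From sequences of real numbers to sequences of constant functions -/

section ConstantFunctions

variable {M : Type u} [NumStr M] [m : Mod M]

/-- The constant polynomial with value `x`. -/
def constPoly (x : Rational M) : RatPoly M := ⟨0, x.code, x.code⟩

/-- The modulus is c + 1, so c is its own remainder and (c, c) codes the sequence with first entry
c. -/
theorem beta_self (c : M) : beta c c 0 = c :=
  (eq_beta_iff.2 ⟨by rw [zero_add, mul_one]; exact lt_succ.2 le_rfl, 0, by simp⟩).symm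

theorem constPoly_valid (x : Rational M) : (constPoly x).Valid := by
  intro i hi
  have : i = 0 := le_antisymm hi (zero_le' i)
  subst this
  exact ⟨x, beta_self _⟩

theorem pe_constPoly (x : Rational M) (y : RatOf M) : pe (constPoly x) y = val x := by
  have := msum_succ (fun i => pc (constPoly x) i * kpow y i) 0
  rw [msum_zero, kpow_zero, mul_one] at this
  exact this.trans (by rw [zero_add, pc, constPoly, beta_self, dec_code])

theorem pd_constPoly (x : Rational M) (y : RatOf M) : pd (constPoly x) y = 0 := msum_zero _

theorem KLim.of_le {s : M → RatOf M} {c : RatOf M} (h : ∀ n, s n ≤ c) : KLim s c :=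
  fun ε hε => ⟨0, fun n _ => (h n).trans (by linarith)⟩

/-- The code of the sequence of constant functions with the values coded by `X`. -/
def constSeq (X : M → M) : M → M := uncurry fun n k =>
  if k = 0 then (ofNum (0 : M)).code else
    pair (pair (X (pair n (mpred k))) (X (pair n (mpred k)))) 0

theorem constSeq_isBVPoint {X : M → M} {x : M → M → Rational M} (h : CodesUnitSeq X x) (n : M) :
    IsBVPoint (component (constSeq X) n) (ofNum 0) (fun k => constPoly (x n k)) where
  bound_code := by rw [component, constSeq, uncurry_pair, if_pos rfl]
  poly_code k := by
    rw [component, constSeq, uncurry_pair, if_neg (Mod.model.succ_ne_zero k), mpred_succ]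
    have := (h n).1.code k
    rw [component] at this
    rw [this]; rfl
  valid k := constPoly_valid _
  rate k := by
    rw [polyDistLE_iff (constPoly_valid _) (constPoly_valid _)]
    refine KLim.of_le fun N => ?_
    have := (LE_iff _ _).1 ((h n).1.rate k 1)
    rw [val_abs, val_sub] at this
    refine rs_le_of_forall (f := fun y => pe (constPoly (x n k)) y - pe (constPoly (x n (k + 1))) y)
      fun i _ => ?_
    rw [pe_constPoly, pe_constPoly]
    exact this
  variation k := by
    rw [intAbsLE_iff (Rep.evalDeriv (constPoly_valid _))]
    refine KLim.of_le fun N => rs_le_of_forall (f := pd (constPoly (x n k))) fun i _ => ?_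
    rw [pd_constPoly]; simp

/-- Late terms lie in [-1, 2], and every term is within 2^{-k} ≤ 1 of them; hence the bound 3. -/
theorem real_abs_le {F : M → M} {x : M → Rational M} (h : IsReal F x) (h1 : LimLE x (ofNum 1))
    (h0 : LimLE (fun k => (x k).opp) (ofNum 0)) (k : M) : |val (x k)| ≤ RatOf.ofNum (1 + 1 + 1) := by
  obtain ⟨N, hN⟩ := limLE_iff.1 h1 1 one_pos
  obtain ⟨N', hN'⟩ := limLE_iff.1 h0 1 one_pos
  have e1 := hN (k + max N N') ((le_max_left _ _).trans le_add_self)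
  have e2 := hN' (k + max N N') ((le_max_right _ _).trans le_add_self)
  have e3 := (LE_iff _ _).1 (h.rate k (max N N'))
  rw [val_abs, val_sub] at e3
  have e4 : val (twoPowNeg k) ≤ 1 := tp_zero (M := M) ▸ tp_anti (zero_le' k)
  have e5 := abs_le.1 (e3.trans e4)
  dsimp only at e2
  rw [val_ofNum, map_one] at e1
  rw [val_opp, val_ofNum, map_zero] at e2
  rw [map_add, map_add, map_one, abs_le]
  constructor <;> linarith [e5.1, e5.2]

theorem constSeq_bounded {X : M → M} {x : M → M → Rational M} (h : CodesUnitSeq X x) :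
    UniformlyBounded (fun _ => ofNum 0) (fun n k => constPoly (x n k)) (ofNum (1 + 1 + 1))
      (ofNum 0) := by
  refine ⟨fun n δ hδ => ⟨0, fun k _ => ?_⟩, fun n => (LE_iff _ _).2 le_rfl⟩
  rw [intAbsLE_iff (Rep.eval (constPoly_valid _)), val_add]
  refine KLim.of_le fun N => rs_le_of_forall (f := pe (constPoly (x n k))) fun i _ => ?_
  rw [pe_constPoly, val_ofNum]
  have := real_abs_le (h n).1 (h n).2.1 (h n).2.2 k
  linarith [(positive_iff δ).1 hδ]

theorem constSeq_isHSTInstance {X : M → M} (h : IsBWInstance X) : IsHSTInstance (constSeq X) := by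
  obtain ⟨x, hx⟩ := h
  exact ⟨_, _, constSeq_isBVPoint hx, _, _, constSeq_bounded hx⟩

theorem kpow_zero_succ (k : M) : kpow (0 : RatOf M) (k + 1) = 0 := by
  rw [kpow_succ, mul_zero]

theorem pe_zero (p : RatPoly M) : pe p 0 = pc p 0 := by
  refine induct (P := fun k => msum (fun i => pc p i * kpow 0 i) (k + 1) = pc p 0) inferInstance
    ?_ (fun k hk => ?_) p.deg
  · rw [msum_succ, msum_zero, kpow_zero]; ring
  · rw [msum_succ, hk, kpow_zero_succ]; ring

theorem rs_at_zero (f : RatOf M → RatOf M) [DF f] : rs f 0 = |f 0| := by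
  unfold rs
  rw [msum_succ (fun i => |f (RatOf.ofNum i / (RatOf.ofNum 0 + 1))|) 0]
  simp

/-- With variation bound 0 all errors V/(N + 1) disappear, and the grid consisting of the point 0
alone already yields the L₁ estimates. The values at 0 are the constant coefficients. -/
theorem bw_of_hst_constSeq {X : M → M} (h : HST m.S (constSeq X)) : BW m.S X := by
  intro x hx
  obtain ⟨F, q, g, hF, hq, hg, hgi, hconv⟩ :=
    h _ _ (constSeq_isBVPoint hx) _ _ (constSeq_bounded hx)
  have hq' : BVFacts q 0 := hq.facts (by simp)
  have hF1 := Fn1.of_internal hF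
  have hqd : FnP (full M) (fun _ v => q (v 0)) :=
    FnP.of_code (Fn.congr (f := fun _ v => F (v 0 + 1)) inferInstance
      fun _ v => (hq.poly_code (v 0)).symm)
  have hy : ∀ k, val (dec (beta (q k).seqA (q k).seqB 0)) = pe (q k) 0 := fun k => (pe_zero _).symm
  -- The shift of the index turns the rate 2·2^{-(k+1)} of `rs_chain` into the required 2^{-k}.
  refine ⟨fun k => (dec (beta (q (k + 1)).seqA (q (k + 1)).seqB 0)).code,
    fun k => dec (beta (q (k + 1)).seqA (q (k + 1)).seqB 0), g, ?_, ⟨fun k => rfl, fun k i => ?_⟩,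
    hg, hgi, ?_⟩
  · apply internal_of_fn
    have h1 := hqd.seqA
    have h2 := hqd.seqB
    have h1' : Fn (full M) (fun _ v => (q (v 0 + 1)).seqA) :=
      Fn.comp1 (f := fun _ x => (q x).seqA) h1 inferInstance
    have h2' : Fn (full M) (fun _ v => (q (v 0 + 1)).seqB) :=
      Fn.comp1 (f := fun _ x => (q x).seqB) h2 inferInstance
    infer_instance
  · have h1 := hq'.rs_chain (k + 1) i 0
    rw [rs_at_zero (fun x => pe (q (k + 1)) x - pe (q (k + 1 + i)) x), tp_succ] at h1
    rw [LE_iff, val_abs, val_sub, hy, hy, show k + i + 1 = k + 1 + i by ring]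
    change _ ≤ tp k
    simp only [mul_zero, zero_div, add_zero] at h1
    linarith
  · intro ε hε
    obtain ⟨N, hN⟩ := hconv ε hε
    refine ⟨N, fun n hn => ?_⟩
    rw [RealDistLE, limLE_iff]
    intro δ hδ
    obtain ⟨δ', hδ'⟩ := exists_val (δ / 2)
    obtain ⟨K, hK⟩ := hN n hn δ' ((positive_iff δ').2 (by rw [hδ']; exact half_pos hδ))
    obtain ⟨L, hL⟩ := exists_tp_le (half_pos hδ)
    refine ⟨max K L, fun k hk => ?_⟩
    have hp' : BVFacts (fun k => constPoly (x (g n) k)) 0 :=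
      (constSeq_isBVPoint hx (g n)).facts (by simp)
    have h1 := (polyDistLE_iff (constPoly_valid _) (hq.valid k) _).1
      (hK k ((le_max_left _ _).trans hk))
    have h2 := rs_le_of_lim (f := fun y => pe (constPoly (x (g n) k)) y - pe (q k) y)
      (fun N => hp'.gvar_sub hq' k k N) h1 0
    have h3 := rs_le_of_lim (f := fun y => pe (q k) y - pe (q (k + 1)) y)
      (fun N => hq'.gvar_sub hq' k (k + 1) N) (hq'.rate k) 0
    rw [rs_at_zero (fun y => pe (constPoly (x (g n) k)) y - pe (q k) y), pe_constPoly, val_add,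
      hδ'] at h2
    rw [rs_at_zero (fun y => pe (q k) y - pe (q (k + 1)) y)] at h3
    have h4 : tp k ≤ δ / 2 := (tp_anti ((le_max_right _ _).trans hk)).trans hL
    dsimp only
    rw [val_abs, val_sub, hy]
    have h5 := abs_sub_le (val (x (g n) k)) (pe (q k) 0) (pe (q (k + 1)) 0)
    simp only [mul_zero, zero_div, add_zero] at h2 h3
    linarith

end ConstantFunctions

section ConstantFunctionsFn

variable {ι : Type v} {M : ι → Type u} [∀ i, NumStr (M i)] [∀ i, Mod (M i)] {C : Pars M} [C.Good]

theorem Fn1.constSeq {X : ∀ i, M i → M i} [hX : Fn1 C X] : Fn1 C (fun i => constSeq (X i)) := by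
  have : Fn2 C (fun i n k => if k = 0 then (ofNum (0 : M i)).code else
    SOA.pair (SOA.pair (X i (SOA.pair n (mpred k))) (X i (SOA.pair n (mpred k)))) 0) :=
    ⟨inferInstance⟩
  exact Fn1.uncurry (C := C)

end ConstantFunctionsFn

/-- A model of `RCA₀` with a function `X` of the model satisfying `P`. -/
structure World (P : ∀ (M : Type u) [NumStr M], (M → M) → Prop) where
  M : Type u
  inst : NumStr M
  mod : Mod M
  X : M → M
  internal : Internal mod.S X
  prop : P M X

instance {P : ∀ (M : Type u) [NumStr M], (M → M) → Prop} (W : World P) : NumStr W.M := W.inst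
instance {P : ∀ (M : Type u) [NumStr M], (M → M) → Prop} (W : World P) : Mod W.M := W.mod

/-- The family is indexed by all models with an instance, so a uniform definition yields one code
that is fixed before the model. -/
theorem exists_code_of_world (P : ∀ (M : Type u) [NumStr M], (M → M) → Prop)
    (Y : ∀ W : World P, W.M → W.M)
    (hY : Fn1 (oraclePars (M := fun W : World P => W.M) (fun W => W.X)) Y) :
    ∃ e : OracleCode 1, ∀ W : World P, Computes e W.X (Y W) ∧ Internal W.mod.S (Y W) := by
  obtain ⟨e, he⟩ := exists_oracleCode (M := fun W : World P => W.M) (X := fun W => W.X)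
    (fun W => W.internal) hY
  have := oraclePars_good (M := fun W : World P => W.M) (X := fun W => W.X) (fun W => W.internal)
  exact ⟨e, fun W => ⟨he W, internal_of_fn (hY.out.specialize W 1 (fun _ => 0))⟩⟩

theorem exists_code_constSeq : ∃ e : OracleCode 1, ∀ (M : Type u) [NumStr M] (S : Set (Set M)),
    IsModelRCA0 M S → ∀ X : M → M, Internal S X → IsBWInstance X →
      ∃ Y : M → M, Internal S Y ∧ Computes e X Y ∧ IsHSTInstance Y ∧ (HST S Y → BW S X) := by
  have := oraclePars_good (M := fun W : World @IsBWInstance => W.M) (X := fun W => W.X)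
    (fun W => W.internal)
  have := Fn1.oracle (M := fun W : World @IsBWInstance => W.M) (X := fun W => W.X)
  obtain ⟨e, he⟩ := exists_code_of_world @IsBWInstance (fun W => constSeq W.X) Fn1.constSeq
  refine ⟨e, fun M _ S hS X hX hBW => ?_⟩
  let _ : Mod M := ⟨S, hS⟩
  obtain ⟨h1, h2⟩ := he ⟨M, inferInstance, inferInstance, X, hX, hBW⟩
  exact ⟨_, h2, h1, constSeq_isHSTInstance hBW, bw_of_hst_constSeq⟩

/-! ## Sums of powers of `1 / 4` -/

section Digits

variable {M : Type u} [NumStr M] [m : Mod M]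

/-- `4 ^ (-n)`. -/
def fp (n : M) : RatOf M := tp (n + n)

theorem fp_pos (n : M) : 0 < fp n := tp_pos _

theorem fp_succ (n : M) : fp (n + 1) = fp n / 4 := by
  rw [fp, show n + 1 + (n + 1) = n + n + 1 + 1 by ring, tp_succ, tp_succ, fp]; ring

theorem fp_anti {a b : M} (h : a ≤ b) : fp b ≤ fp a := tp_anti (add_le_add h h)

instance RK.fp {ι : Type v} {M : ι → Type u} [∀ i, NumStr (M i)] [∀ i, Mod (M i)] {C : Pars M}
    [C.Good] {t : ∀ i, (ℕ → M i) → M i} [Fn C t] : RK C (fun i v => fp (t i v)) := by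
  unfold SOA.fp; infer_instance

open Classical in
/-- `∑ 4 ^ (-(i + 1))`, where `i < n` has the property `b`. -/
def dsum (b : M → Prop) (n : M) : RatOf M := msum (fun i => if b i then fp (i + 1) else 0) n

variable {b c : M → Prop} [hb : Dl (full M) (fun _ v => b (v 0))]
  [hc : Dl (full M) (fun _ v => c (v 0))]

theorem dsum_succ_of {n : M} (h : b n) : dsum b (n + 1) = dsum b n + fp (n + 1) := by
  classical
  refine (msum_succ (fun i => if b i then fp (i + 1) else 0) n).trans ?_
  rw [if_pos h]; rfl

theorem dsum_succ_of_not {n : M} (h : ¬ b n) : dsum b (n + 1) = dsum b n := by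
  classical
  refine (msum_succ (fun i => if b i then fp (i + 1) else 0) n).trans ?_
  rw [if_neg h, add_zero]; rfl

instance RK1.dsum : RK (full M) (fun _ v => dsum b (v 0)) := by
  unfold SOA.dsum
  have : Dl (full M) (fun _ v => b (v 0)) := hb
  infer_instance

/-- The tail after n is at most 4^{-n}/3, the sum of the geometric series. Keeping the unused part
of the tail on the left makes the bound inductive. -/
theorem dsum_bounds (n k : M) : dsum b n ≤ dsum b (n + k) ∧
    dsum b (n + k) + fp (n + k) / 3 ≤ dsum b n + fp n / 3 := by
  have : RK (full M) (fun _ v => dsum b (n + v 0)) := RK.app1 (f := fun _ x => dsum b x)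
  refine induct (P := fun k => dsum b n ≤ dsum b (n + k) ∧
    dsum b (n + k) + fp (n + k) / 3 ≤ dsum b n + fp n / 3) inferInstance (by simp)
    (fun k hk => ?_) k
  have := fp_pos (n + k)
  rw [← add_assoc]
  by_cases h : b (n + k)
  · rw [dsum_succ_of h, fp_succ]
    constructor <;> linarith [hk.1, hk.2]
  · rw [dsum_succ_of_not h, fp_succ]
    constructor <;> linarith [hk.1, hk.2]

theorem dsum_mono {n l : M} (h : n ≤ l) : dsum b n ≤ dsum b l := by
  obtain ⟨k, rfl⟩ := exists_add_of_le h
  exact (dsum_bounds n k).1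

theorem dsum_le_add {n l : M} (h : n ≤ l) : dsum b l ≤ dsum b n + fp n / 3 := by
  obtain ⟨k, rfl⟩ := exists_add_of_le h
  linarith [(dsum_bounds (b := b) n k).2, fp_pos (n + k)]

theorem dsum_congr {n : M} (h : ∀ i, i < n → (b i ↔ c i)) : dsum b n = dsum c n := by
  classical
  refine le_antisymm (msum_le fun i hi => ?_) (msum_le fun i hi => ?_) <;> simp [h i hi]

/-- At the first difference one sum gains 4^{-(i+1)}, while all later digits of the other give at
most a third of that. -/
theorem dsum_gap {I n l i : M} (hn : I ≤ n) (hl : I ≤ l) (hi : i < I)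
    (heq : ∀ j, j < i → (b j ↔ c j)) (hbi : b i) (hci : ¬ c i) :
    2 / 3 * fp I ≤ dsum b n - dsum c l := by
  have h1 := dsum_mono (b := b) ((succ_le.2 hi).trans hn)
  have h2 := dsum_le_add (b := c) ((succ_le.2 hi).trans hl)
  have h3 := dsum_congr heq
  have h4 := fp_anti (succ_le.2 hi)
  rw [dsum_succ_of hbi] at h1
  rw [dsum_succ_of_not hci] at h2
  linarith

/-- As in the Cantor set, the omitted digits leave gaps between sums with different initial digits.
A disagreement below I has a least place, where `dsum_gap` applies in one direction or the other. -/
theorem digits_agree {I n l : M} (hn : I ≤ n) (hl : I ≤ l)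
    (h : |dsum b n - dsum c l| < 2 / 3 * fp I) (i : M) (hi : i < I) : b i ↔ c i := by
  by_contra hne
  obtain ⟨j, ⟨hj, hjne⟩, hmin⟩ := exists_least (P := fun i => i < I ∧ ¬ (b i ↔ c i)) inferInstance
    ⟨i, hi, hne⟩
  have heq : ∀ k, k < j → (b k ↔ c k) := fun k hk =>
    by_contra fun hk' => hmin k hk ⟨hk.trans hj, hk'⟩
  by_cases hbj : b j
  · have hcj : ¬ c j := fun h => hjne ⟨fun _ => h, fun _ => hbj⟩
    exact absurd h (not_lt.2 ((dsum_gap hn hl hj heq hbj hcj).trans (le_abs_self _)))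
  · have hcj : c j := by by_contra h; exact hjne ⟨fun h' => (hbj h').elim, fun h' => (h h').elim⟩
    have := dsum_gap hl hn hj (fun k hk => (heq k hk).symm) hcj hbj
    rw [abs_sub_comm] at h
    exact absurd h (not_lt.2 (this.trans (le_abs_self _)))

end Digits

/-! ## Coding a sequence of polynomials by real numbers -/

section Code

variable {M : Type u} [NumStr M] [m : Mod M]

/-- The digits of the real number associated with the polynomial `P n`: they code the pairs of a
rational grid point and a rational bound for the value of the polynomial there. -/
def bit (P : M → RatPoly M) (n i : M) : Prop :=
  ∃ a, a ≤ i ∧ ∃ b, b ≤ i ∧ ∃ c, c ≤ i ∧ ∃ N, N ≤ i ∧ i = pair (pair a b) (pair c N) ∧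
    pe (P n) (RatOf.ofNum a / (RatOf.ofNum N + 1)) ≤
      (RatOf.ofNum b - RatOf.ofNum c) / (RatOf.ofNum N + 1)

theorem bit_pair (P : M → RatPoly M) (n a b c N : M) :
    bit P n (pair (pair a b) (pair c N)) ↔
      pe (P n) (RatOf.ofNum a / (RatOf.ofNum N + 1)) ≤
        (RatOf.ofNum b - RatOf.ofNum c) / (RatOf.ofNum N + 1) := by
  constructor
  · rintro ⟨a', -, b', -, c', -, N', -, h, h'⟩
    simp only [pair_inj] at h
    obtain ⟨⟨rfl, rfl⟩, rfl, rfl⟩ := h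
    exact h'
  · intro h
    exact ⟨a, (left_le_pair _ _).trans (left_le_pair _ _),
      b, (right_le_pair _ _).trans (left_le_pair _ _),
      c, (left_le_pair _ _).trans (right_le_pair _ _),
      N, (right_le_pair _ _).trans (right_le_pair _ _), rfl, h⟩

/-- The sum of the first `n` digits of the polynomial `P n`. -/
def digitSum (P : M → RatPoly M) (n : M) : RatOf M := dsum (bit P n) n

/-- The least threshold (s - T)/(N + 1) above x exceeds x by at most 1/(N + 1), and x' lies below it
as well. The thresholds with s ≤ 2T run from -B to B, which covers x. -/
theorem threshold_le {x x' : RatOf M} {N B T : M}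
    (hT : RatOf.ofNum T = RatOf.ofNum B * (RatOf.ofNum N + 1)) (hx : |x| ≤ RatOf.ofNum B)
    (h : ∀ s, s ≤ T + T → x ≤ (RatOf.ofNum s - RatOf.ofNum T) / (RatOf.ofNum N + 1) →
      x' ≤ (RatOf.ofNum s - RatOf.ofNum T) / (RatOf.ofNum N + 1)) :
    x' ≤ x + 1 / (RatOf.ofNum N + 1) := by
  have hN := RatOf.ofNum_succ_pos N
  have hB : RatOf.ofNum T / (RatOf.ofNum N + 1) = RatOf.ofNum B := by
    rw [hT, mul_div_cancel_right₀ _ hN.ne']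
  have hx' := abs_le.1 hx
  obtain ⟨s, hs, hmin⟩ := exists_least
    (P := fun s => x ≤ (RatOf.ofNum s - RatOf.ofNum T) / (RatOf.ofNum N + 1)) inferInstance
    ⟨T + T, by rw [map_add, add_sub_cancel_right, hB]; exact hx'.2⟩
  have hsT : s ≤ T + T := by
    by_contra hc
    refine hmin _ (not_le.1 hc) ?_
    rw [map_add, add_sub_cancel_right, hB]; exact hx'.2
  have h1 := h s hsT hs
  have h2 := one_div_pos.2 hN
  rcases Arith.zero_or_succ s with rfl | ⟨s', rfl⟩
  · rw [map_zero, zero_sub, neg_div, hB] at h1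
    linarith
  · have h3 := not_le.1 (hmin s' (lt_succ.2 le_rfl))
    rw [map_add, map_one, add_sub_right_comm, add_div] at h1
    linarith

/-- All comparisons of grid values with thresholds have codes below I, by monotonicity of pairing.
Applying `threshold_le` in both directions bounds the difference at each grid point. -/
theorem rs_le_of_digits {P : M → RatPoly M} {n l N B T I : M}
    (hT : RatOf.ofNum T = RatOf.ofNum B * (RatOf.ofNum N + 1))
    (hI : I = pair (pair N (T + T)) (pair T N) + 1)
    (hn : ∀ i, i ≤ N → |pe (P n) (RatOf.ofNum i / (RatOf.ofNum N + 1))| ≤ RatOf.ofNum B)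
    (hl : ∀ i, i ≤ N → |pe (P l) (RatOf.ofNum i / (RatOf.ofNum N + 1))| ≤ RatOf.ofNum B)
    (h : ∀ i, i < I → (bit P n i ↔ bit P l i)) :
    rs (fun x => pe (P n) x - pe (P l) x) N ≤ 1 / (RatOf.ofNum N + 1) := by
  refine rs_le_of_forall (f := fun x => pe (P n) x - pe (P l) x) fun i hi => ?_
  have key : ∀ s, s ≤ T + T →
      (pe (P n) (RatOf.ofNum i / (RatOf.ofNum N + 1)) ≤
        (RatOf.ofNum s - RatOf.ofNum T) / (RatOf.ofNum N + 1) ↔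
      pe (P l) (RatOf.ofNum i / (RatOf.ofNum N + 1)) ≤
        (RatOf.ofNum s - RatOf.ofNum T) / (RatOf.ofNum N + 1)) := by
    intro s hs
    rw [← bit_pair, ← bit_pair]
    refine h _ ?_
    rw [hI, lt_succ]
    exact pair_mono (pair_mono hi hs) le_rfl
  have h1 := threshold_le hT (hn i hi) fun s hs => (key s hs).1
  have h2 := threshold_le hT (hl i hi) fun s hs => (key s hs).2
  rw [abs_le]
  constructor <;> linarith

end Code

section CodeFn

variable {ι : Type v} {M : ι → Type u} [∀ i, NumStr (M i)] [∀ i, Mod (M i)] {C : Pars M} [C.Good]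

instance Dl.bit {P : ∀ i, M i → RatPoly (M i)} {s t : ∀ i, (ℕ → M i) → M i}
    [hP : FnP C (fun i v => P i (v 0))] [hs : Fn C s] [ht : Fn C t] :
    Dl C (fun i v => bit (P i) (s i v) (t i v)) := by
  refine Dl.comp2 (P := fun i a b => SOA.bit (P i) a b) ?_ hs ht
  unfold SOA.bit
  infer_instance

instance RK.digitSum {P : ∀ i, M i → RatPoly (M i)} {t : ∀ i, (ℕ → M i) → M i}
    [hP : FnP C (fun i v => P i (v 0))] [ht : Fn C t] :
    RK C (fun i v => digitSum (P i) (t i v)) := by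
  refine RK.subst (f := fun i n _ => SOA.digitSum (P i) n) ?_ ht
  unfold SOA.digitSum dsum
  infer_instance

end CodeFn

/-! ## From Bolzano–Weierstraß to Helly's selection theorem -/

section Selection

variable {M : Type u} [NumStr M] [m : Mod M]

theorem digitSum_mem (P : M → RatPoly M) [FnP (full M) (fun _ v => P (v 0))] (n : M) :
    0 ≤ digitSum P n ∧ digitSum P n ≤ 1 := by
  have h0 : dsum (bit P n) 0 = 0 := msum_zero _
  have h1 := dsum_mono (b := bit P n) (zero_le' n)
  have h2 := dsum_le_add (b := bit P n) (zero_le' n)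
  have h3 : fp (0 : M) = 1 := by rw [fp, add_zero, tp_zero]
  rw [h0] at h1 h2
  rw [h3] at h2
  exact ⟨h1, h2.trans (by norm_num)⟩

/-- The code of the sequence of real numbers given by the rational numbers `r n`. -/
def ratSeq (r : M → Rational M) : M → M := uncurry fun n _ => (r n).code

theorem ratSeq_codes {P : M → RatPoly M} [FnP (full M) (fun _ v => P (v 0))] {r : M → Rational M}
    (hr : ∀ n, val (r n) = digitSum P n) : CodesUnitSeq (ratSeq r) (fun n _ => r n) := by
  refine fun n => ⟨⟨fun k => uncurry_pair (fun n _ => (r n).code) n k, fun k i => ?_⟩, limLE_iff.2 ?_, limLE_iff.2 ?_⟩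
  · rw [LE_iff, val_abs, val_sub, sub_self, abs_zero]; exact (tp_pos k).le
  · refine KLim.of_le fun _ => ?_
    rw [hr, val_ofNum, map_one]; exact (digitSum_mem P n).2
  · refine KLim.of_le fun _ => ?_
    rw [val_opp, hr, val_ofNum, map_zero, neg_nonpos]; exact (digitSum_mem P n).1

/-- One tp j pays for convergence, shared equally by ε and the slack of the real distance; the other
pays for replacing the limit by its j-th approximation. -/
theorem exists_limit {Y : M → RatOf M} {r : M → Rational M} (hr : ∀ n, val (r n) = Y n)
    (hc : CodesUnitSeq (ratSeq r) (fun n _ => r n)) (h : BW m.S (ratSeq r)) :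
    ∃ (g : M → M) (z : M → RatOf M), Internal m.S g ∧ StrictIncr g ∧ RK1 z ∧
      (∀ k i, |z k - z (k + i)| ≤ tp k) ∧
      ∀ j, ∃ N, ∀ n, N ≤ n → |Y (g n) - z j| ≤ 2 * tp j := by
  obtain ⟨F, y, g, hF, hy, hg, hgi, hconv⟩ := h _ hc
  have hF1 := Fn1.of_internal hF
  have hyd : FnQ (full M) (fun _ v => y (v 0)) :=
    FnQ.of_code (Fn.congr (f := fun _ v => F (v 0)) inferInstance fun _ v => (hy.code (v 0)).symm)
  have hrate : ∀ k i, |val (y k) - val (y (k + i))| ≤ tp k := by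
    intro k i
    have := (LE_iff _ _).1 (hy.rate k i)
    rwa [val_abs, val_sub] at this
  refine ⟨g, fun k => val (y k), hg, hgi, inferInstance, hrate, fun j => ?_⟩
  obtain ⟨ε, hε⟩ := exists_val (tp j / 2)
  obtain ⟨N, hN⟩ := hconv ε ((positive_iff ε).2 (by rw [hε]; exact half_pos (tp_pos j)))
  refine ⟨N, fun n hn => ?_⟩
  obtain ⟨K, hK⟩ := limLE_iff.1 (hN n hn) (tp j / 2) (half_pos (tp_pos j))
  have h1 := hK (j + K) le_add_self
  dsimp only at h1
  rw [val_abs, val_sub, hr, hε] at h1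
  have h2 := hrate j K
  have h3 := abs_sub_le (Y (g n)) (val (y (j + K))) (val (y j))
  rw [abs_sub_comm (val (y (j + K)))] at h3
  linarith

theorem StrictIncr.le_apply {g : M → M} (hg : StrictIncr g) (hi : Internal m.S g) (n : M) :
    n ≤ g n := by
  have := Fn1.of_internal hi
  refine induct (P := fun n => n ≤ g n) inferInstance (zero_le' _) (fun n hn => ?_) n
  exact succ_le.2 (hn.trans_lt (hg n (n + 1) (lt_succ.2 le_rfl)))

/-- `D * 2 ^ k`. -/
def doubling (D k : M) : M := mrec D (fun _ y => y + y) k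

theorem doubling_zero (D : M) : doubling D 0 = D :=
  have : Fn2 (full M) (fun _ _ y => y + y) := ⟨inferInstance⟩
  mrec_zero _ _

theorem doubling_succ (D k : M) : doubling D (k + 1) = doubling D k + doubling D k :=
  have : Fn2 (full M) (fun _ _ y => y + y) := ⟨inferInstance⟩
  mrec_succ _ _ _

instance Fn.doubling (D : M) {t : Unit → (ℕ → M) → M} [Fn (full M) t] :
    Fn (full M) (fun i v => doubling D (t i v)) := by
  unfold SOA.doubling; infer_instance

theorem doubling_mul_tp (D k : M) : RatOf.ofNum (doubling D k) * tp k = RatOf.ofNum D := by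
  refine induct (P := fun k => RatOf.ofNum (doubling D k) * tp k = RatOf.ofNum D) inferInstance
    (by rw [doubling_zero, tp_zero, mul_one]) (fun k hk => ?_) k
  rw [doubling_succ, tp_succ, map_add, ← hk]; ring

/-- A bound for the indices of the digits which determine the polynomial up to `tp k`. -/
def digitBound (B N : M) : M :=
  pair (pair N (B * (N + 1) + B * (N + 1))) (pair (B * (N + 1)) N) + 1

theorem digitBound_mono {B N N' : M} (h : N ≤ N') : digitBound B N ≤ digitBound B N' := by
  have h1 : B * (N + 1) ≤ B * (N' + 1) := mul_le_mul' le_rfl (add_le_add h le_rfl)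
  exact add_le_add (pair_mono (pair_mono h (add_le_add h1 h1)) (pair_mono h1 h)) le_rfl

/-- A pointwise bound that does not depend on n. A late polynomial has Riemann sum at most u + 1 up
to a grid error w; passing back to p n costs at most 2 + 2w; the pointwise value costs another w. -/
theorem BVFacts.abs_le {p : M → RatPoly M} {w : RatOf M} (hp : BVFacts p w)
    [FnP (full M) (fun _ v => p (v 0))] {u : Rational M} (hu : NormLE p u) (n : M) {N i : M}
    (hi : i ≤ N) : |pe (p n) (RatOf.ofNum i / (RatOf.ofNum N + 1))| ≤ val u + 4 * w + 3 := by
  have hw := hp.bound_nonneg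
  have hdiv : ∀ c : RatOf M, 0 ≤ c → c / (RatOf.ofNum N + 1) ≤ c := fun c hc =>
    div_le_self hc (by linarith [RatOf.ofNum_nonneg N])
  obtain ⟨K, hK⟩ := hu (ofNum 1) ((positive_iff _).2 (by simp))
  have h1 := (intAbsLE_iff (Rep.eval (hp.valid (n + K))) _).1 (hK (n + K) (le_add_self (a := K)))
  have h2 := rs_le_of_lim (f := pe (p (n + K))) (hp.gvar (n + K)) h1 N
  have h3 := hp.rs_chain n K N
  have h4 := rs_le_add (f := pe (p (n + K))) (g := fun x => pe (p n) x - pe (p (n + K)) x)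
    (h := pe (p n)) (N := N) fun x => by
      have := abs_add_le (pe (p (n + K)) x) (pe (p n) x - pe (p (n + K)) x)
      rwa [add_sub_cancel] at this
  have h5 := abs_le_rs_add (f := pe (p n)) (hp.gvar n N) hi
  have h6 : tp n ≤ 1 := tp_zero (M := M) ▸ tp_anti (zero_le' n)
  rw [val_add, val_ofNum, map_one] at h2
  linarith [hdiv w hw, hdiv (2 * w) (by linarith)]

end Selection

/-! ### Construction of the limit point in L₁ -/

section HST

variable {M : Type u} [NumStr M] [m : Mod M]

/-- Equal digits give 1/(N + 1) on the grid, and leaving the grid costs 2w/(N + 1). With N = D·2^k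
and D ≥ 2w + 1 the total is at most 2^{-k}. -/
theorem rs_close {P : M → RatPoly M} [FnP (full M) (fun _ v => P (v 0))] {w : RatOf M} {B D : M}
    (hw : ∀ n N, gvar (pe (P n)) N ≤ w) (hD : 2 * w + 1 ≤ RatOf.ofNum D)
    (hB : ∀ n N i, i ≤ N → |pe (P n) (RatOf.ofNum i / (RatOf.ofNum N + 1))| ≤ RatOf.ofNum B)
    {k n l : M} (hn : digitBound B (doubling D k) ≤ n) (hl : digitBound B (doubling D k) ≤ l)
    (h : |digitSum P n - digitSum P l| < 2 / 3 * fp (digitBound B (doubling D k))) :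
    KLim (rs fun x => pe (P n) x - pe (P l) x) (tp k) := by
  have h1 := rs_le_of_digits (N := doubling D k) (B := B) (T := B * (doubling D k + 1))
    (by simp) rfl (hB n (doubling D k)) (hB l (doubling D k)) (digits_agree hn hl h)
  have hV : ∀ N, gvar (fun x => pe (P n) x - pe (P l) x) N ≤ 2 * w := fun N => by
    have := gvar_sub_le (f := pe (P n)) (g := pe (P l)) N
    linarith [hw n N, hw l N]
  refine (lim_of_rs_le hV h1).mono ?_
  rw [← add_div, div_le_iff₀ (RatOf.ofNum_succ_pos _), mul_add, mul_one, mul_comm (tp k),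
    doubling_mul_tp]
  linarith [tp_pos k]

/-- The search runs over all indices, not only over the range of g: the condition is Δ⁰₁, so its
least solution is definable, and g merely shows that a solution exists. -/
theorem exists_selection {Y z : M → RatOf M} [RK1 Y] [RK1 z] {I e g : M → M}
    [Fn1 (full M) (fun _ => I)] [Fn1 (full M) (fun _ => e)] (hg : ∀ n, n ≤ g n)
    (h : ∀ j, ∃ N, ∀ n, N ≤ n → |Y (g n) - z j| ≤ 2 * tp j) :
    ∃ s : M → M, Fn1 (full M) (fun _ => s) ∧
      ∀ k, I k ≤ s k ∧ |Y (s k) - z (e k)| ≤ 2 * tp (e k) := by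
  obtain ⟨s, hs, hspec⟩ := Fn.exists_least (C := full M)
    (P := fun _ n v => I (v 0) ≤ n ∧ |Y n - z (e (v 0))| ≤ 2 * tp (e (v 0)))
    inferInstance fun _ v => by
      obtain ⟨N, hN⟩ := h (e (v 0))
      exact ⟨g (max N (I (v 0))), (le_max_right _ _).trans (hg _), hN _ (le_max_left _ _)⟩
  exact ⟨fun k => s () fun _ => k, ⟨hs.reindex fun _ => 0⟩, fun k => (hspec () fun _ => k).1⟩

/-- The tail of p beyond l costs 2·2^{-l}, the hypothesis 2^{-k} and the tail of q beyond k costs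
2·2^{-k}; since k ≤ l this is at most 5·2^{-k}. -/
theorem distLE_of_diagonal {p : M → RatPoly M} {q : M → RatPoly M} {w : RatOf M}
    [FnP (full M) (fun _ v => p (v 0))] [FnP (full M) (fun _ v => q (v 0))] (hp : BVFacts p w)
    (hq : BVFacts q w) {l k : M} (hkl : k ≤ l)
    (h : KLim (rs fun x => pe (p l) x - pe (q k) x) (tp k)) {ε : Rational M}
    (hε : 5 * tp k ≤ val ε) : DistLE p q ε := by
  intro δ hδ
  have hδ' := (positive_iff δ).1 hδ
  refine ⟨l, fun n hn => ?_⟩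
  obtain ⟨i, hi⟩ := exists_add_of_le (show l ≤ n from hn)
  obtain ⟨j, hj⟩ := exists_add_of_le (hkl.trans (show l ≤ n from hn))
  rw [polyDistLE_iff (hp.valid n) (hq.valid n), val_add]
  -- Three comparisons, each with grid error 2w/(N + 1).
  refine lim_of_forall_rs_le (V := 6 * w) fun N => ?_
  have h1 := hp.rs_chain l i N
  have h2 := rs_le_of_lim (f := fun x => pe (p l) x - pe (q k) x)
    (fun N => hp.gvar_sub hq l k N) h N
  have h3 := hq.rs_chain k j N
  rw [← hi, rs_sub_comm (f := pe (p l)) (g := pe (p n))] at h1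
  rw [← hj] at h3
  have h4 := rs_triangle (f := pe (p n)) (g := pe (p l)) (h := pe (q n)) N
  have h5 := rs_triangle (f := pe (p l)) (g := pe (q k)) (h := pe (q n)) N
  have h6 := tp_anti hkl
  rw [mul_div_assoc] at *
  linarith

/-- The limit point is the diagonal k ↦ p_{s(k),s(k)}, whose codes are entries of X. It inherits the
common bound w on the variation. -/
theorem hst_of_selection {X : M → M} (hX : Internal m.S X) {v : M → Rational M}
    {p : M → M → RatPoly M} (hp : CodesBVSeq X v p) {w : Rational M} (hv : ∀ n, (v n).LE w)
    {g s : M → M} (hg : ∀ n, n ≤ g n) [hs : Fn1 (full M) (fun _ => s)]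
    (hss : ∀ k, KLim (rs fun x => pe (p (s k) (s k)) x - pe (p (s (k + 1)) (s (k + 1))) x) (tp k))
    (hgs : ∀ k, ∃ N, ∀ n, N ≤ n →
      KLim (rs fun x => pe (p (g n) (g n)) x - pe (p (s k) (s k)) x) (tp k)) :
    ∃ (F : M → M) (q : M → RatPoly M), Internal m.S F ∧ IsBVPoint F w q ∧
      ∀ ε : Rational M, ε.Positive → ∃ m : M, ∀ n : M, Le m n → DistLE (p (g n)) q ε := by
  have hX1 := Fn1.of_internal hX
  have hfacts : ∀ n, BVFacts (p n) (val w) := fun n => (hp n).facts ((LE_iff _ _).1 (hv n))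
  have hpn : ∀ n, FnP (full M) (fun _ v => p n (v 0)) := fun n =>
    FnP.of_code (Fn.congr (f := fun _ v => X (pair n (v 0 + 1))) inferInstance
      fun _ v => ((hp n).poly_code (v 0)).symm)
  have hq : FnP (full M) (fun _ v => p (s (v 0)) (s (v 0))) :=
    FnP.of_code (Fn.congr (f := fun _ v => X (pair (s (v 0)) (s (v 0) + 1))) inferInstance
      fun _ v => ((hp (s (v 0))).poly_code (s (v 0))).symm)
  have hpt : IsBVPoint (fun n => if n = 0 then w.code else
      X (pair (s (mpred n)) (s (mpred n) + 1))) w (fun k => p (s k) (s k)) :=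
    { bound_code := if_pos rfl
      poly_code := fun k => by
        rw [if_neg (Mod.model.succ_ne_zero k), mpred_succ]
        exact (hp (s k)).poly_code (s k)
      valid := fun k => (hp _).valid _
      rate := fun k => (polyDistLE_iff ((hp _).valid _) ((hp _).valid _) _).2 (hss k)
      variation := fun k => by
        have h := (hp (s k)).variation (s k)
        rw [intAbsLE_iff (Rep.evalDeriv ((hp _).valid _))] at h ⊢
        exact h.mono ((LE_iff _ _).1 (hv _)) }
  refine ⟨_, _, internal_of_fn inferInstance, hpt, fun ε hε => ?_⟩
  obtain ⟨k, hk⟩ := exists_tp_le (div_pos ((positive_iff ε).1 hε) (by norm_num : (0 : RatOf M) < 5))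
  obtain ⟨N, hN⟩ := hgs k
  refine ⟨max k N, fun n hn => distLE_of_diagonal (hfacts (g n)) (hpt.facts le_rfl)
    (((le_max_left k N).trans hn).trans (hg n)) (hN n ((le_max_right k N).trans hn)) ?_⟩
  linarith

/-- The subsequence g given by BW is kept for HST. Both the rate of the limit point and the
convergence along g follow from `rs_close`, since all the digit sums involved are close to one
approximation of the limit real. -/
theorem hst_of_bw {X : M → M} (hX : Internal m.S X) {v : M → Rational M} {p : M → M → RatPoly M}
    (hp : CodesBVSeq X v p) {u w : Rational M} (hb : UniformlyBounded v p u w)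
    {r : M → Rational M} (hr : ∀ n, val (r n) = digitSum (fun n => p n n) n)
    (hBW : BW m.S (ratSeq r)) :
    ∃ (F : M → M) (q : M → RatPoly M) (g : M → M),
      Internal m.S F ∧ IsBVPoint F w q ∧ Internal m.S g ∧ StrictIncr g ∧
      ∀ ε : Rational M, ε.Positive → ∃ m : M, ∀ n : M, Le m n → DistLE (p (g n)) q ε := by
  have hX1 := Fn1.of_internal hX
  have hfacts : ∀ n, BVFacts (p n) (val w) := fun n => (hp n).facts ((LE_iff _ _).1 (hb.2 n))
  have hpn : ∀ n, FnP (full M) (fun _ v => p n (v 0)) := fun n =>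
    FnP.of_code (Fn.congr (f := fun _ v => X (pair n (v 0 + 1))) inferInstance
      fun _ v => ((hp n).poly_code (v 0)).symm)
  set P : M → RatPoly M := fun n => p n n with hPdef
  have hP : FnP (full M) (fun _ v => P (v 0)) :=
    FnP.of_code (Fn.congr (f := fun _ v => X (pair (v 0) (v 0 + 1))) inferInstance
      fun _ v => ((hp (v 0)).poly_code (v 0)).symm)
  obtain ⟨g, z, hg, hgi, hz, hzr, hconv⟩ := exists_limit hr (ratSeq_codes hr) hBW
  have hg1 := Fn1.of_internal hg
  have hgle := hgi.le_apply hg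
  obtain ⟨D, hD⟩ := RatOf.exists_lt_ofNum (2 * val w + 1)
  obtain ⟨B, hB⟩ := RatOf.exists_lt_ofNum (val u + 4 * val w + 3)
  set I : M → M := fun k => digitBound B (doubling D k) with hI
  have hI1 : Fn1 (full M) (fun _ => I) := ⟨by rw [hI]; unfold digitBound; infer_instance⟩
  have hImono : ∀ k, I k ≤ I (k + 1) := fun k =>
    digitBound_mono (by rw [doubling_succ]; exact le_self_add)
  -- This precision is 4^{-I(k)}/8. Consecutive choices of s then differ by at most 5/8 of
  -- 4^{-I(k)}, and terms along g by at most 4/8, both below the 2/3 needed for equal digits.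
  set e : M → M := fun k => I k + I k + (1 + 1 + 1) with he
  have he1 : Fn1 (full M) (fun _ => e) := ⟨by rw [he]; infer_instance⟩
  have hetp : ∀ k, tp (e k) = fp (I k) / 8 := fun k => by
    rw [he]
    simp only [← add_assoc, tp_succ, fp]; ring
  have hclose : ∀ {k n l}, I k ≤ n → I k ≤ l → |digitSum P n - digitSum P l| < 2 / 3 * fp (I k) →
      KLim (rs fun x => pe (P n) x - pe (P l) x) (tp k) := fun hn hl h =>
    rs_close (fun n N => (hfacts n).gvar n N) hD.le
      (fun n N i hi => ((hfacts n).abs_le (hb.1 n) n hi).trans hB.le) hn hl h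
  have hY : RK1 (digitSum P) := RK.digitSum (C := full M) (P := fun _ => P)
  obtain ⟨s, hs, hspec⟩ := exists_selection (I := I) (e := e) hgle hconv
  have hfp := fun k => fp_pos (I k)
  suffices h : _ ∧ _ by
    obtain ⟨F, q, hF, hq, hlim⟩ := hst_of_selection hX hp hb.2 hgle (s := s) h.1 h.2
    exact ⟨F, q, g, hF, hq, hg, hgi, hlim⟩
  refine ⟨fun k => hclose (hspec k).1 ((hImono k).trans (hspec (k + 1)).1) ?_, fun k => ?_⟩
  · have h1 := (hspec k).2
    have h2 := (hspec (k + 1)).2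
    obtain ⟨j, hj⟩ := exists_add_of_le
      (show e k ≤ e (k + 1) from add_le_add (add_le_add (hImono k) (hImono k)) le_rfl)
    have h3 := hzr (e k) j
    have h4 : tp (e (k + 1)) ≤ tp (e k) := hj ▸ tp_add_le _ _
    rw [← hj] at h3
    have h5 := abs_sub_le (digitSum P (s k)) (z (e k)) (digitSum P (s (k + 1)))
    have h6 := abs_sub_le (z (e k)) (z (e (k + 1))) (digitSum P (s (k + 1)))
    rw [abs_sub_comm (z (e (k + 1)))] at h6
    linarith [hetp k, hfp k]
  · obtain ⟨N, hN⟩ := hconv (e k)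
    refine ⟨max N (I k), fun n hn => hclose (((le_max_right _ _).trans hn).trans (hgle n))
      (hspec k).1 ?_⟩
    have h1 := hN n ((le_max_left _ _).trans hn)
    have h2 := (hspec k).2
    have h5 := abs_sub_le (digitSum P (g n)) (z (e k)) (digitSum P (s k))
    rw [abs_sub_comm (z (e k))] at h5
    linarith [hetp k, hfp k]

end HST

/-- The polynomials are determined by X because codes are injective. So digits built from one
decoding of X serve for every decoding quantified over in `HST`. -/
theorem CodesBVSeq.diagonal_eq {M : Type u} [NumStr M] [Mod M] {X : M → M} {v v' : M → Rational M}
    {p p' : M → M → RatPoly M} (h : CodesBVSeq X v p) (h' : CodesBVSeq X v' p') (n k : M) :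
    p n k = p' n k := by
  have h1 := ((h n).poly_code k).symm.trans ((h' n).poly_code k)
  rw [RatPoly.code, RatPoly.code, pair_inj, pair_inj] at h1
  obtain ⟨⟨h1, h2⟩, h3⟩ := h1
  cases hp : p n k
  cases hp' : p' n k
  simp_all

theorem exists_code_digits : ∃ e : OracleCode 1, ∀ (M : Type u) [NumStr M] (S : Set (Set M)),
    IsModelRCA0 M S → ∀ X : M → M, Internal S X → IsHSTInstance X →
      ∃ Y : M → M, Internal S Y ∧ Computes e X Y ∧ IsBWInstance Y ∧ (BW S Y → HST S X) := by
  have := oraclePars_good (M := fun W : World @IsHSTInstance => W.M) (X := fun W => W.X)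
    (fun W => W.internal)
  have := Fn1.oracle (M := fun W : World @IsHSTInstance => W.M) (X := fun W => W.X)
  -- The choice does no harm to definability: the codes of the diagonal polynomials are read off the
  -- oracle, and the bounds do not enter the digits.
  choose v p hp hb using fun W : World @IsHSTInstance => W.prop
  have hP : FnP (oraclePars (M := fun W : World @IsHSTInstance => W.M) (fun W => W.X))
      (fun W v => p W (v 0) (v 0)) :=
    FnP.of_code (Fn.congr (f := fun W v => W.X (pair (v 0) (v 0 + 1))) inferInstance
      fun W v => ((hp W (v 0)).poly_code (v 0)).symm)
  obtain ⟨r, hr, hrv⟩ := RK.digitSum (C := oraclePars (M := fun W : World @IsHSTInstance => W.M)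
    (fun W => W.X)) (P := fun W n => p W n n) (t := fun _ v => v 0)
  have hr' := hr.reindex fun _ => 0
  have hY : Fn1 (oraclePars (M := fun W : World @IsHSTInstance => W.M) (fun W => W.X))
      (fun W => ratSeq fun n => r W fun _ => n) := by
    have : Fn2 (oraclePars (M := fun W : World @IsHSTInstance => W.M) (fun W => W.X))
      (fun W n _ => (r W fun _ => n).code) := ⟨inferInstance⟩
    exact Fn1.uncurry
  obtain ⟨e, he⟩ := exists_code_of_world @IsHSTInstance _ hY
  refine ⟨e, fun M _ S hS X hX hHST => ?_⟩
  let _ : Mod M := ⟨S, hS⟩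
  let W : World @IsHSTInstance := ⟨M, inferInstance, inferInstance, X, hX, hHST⟩
  obtain ⟨h1, h2⟩ := he W
  have hX1 := Fn1.of_internal hX
  have hPW : FnP (full M) (fun _ v => p W (v 0) (v 0)) :=
    FnP.of_code (Fn.congr (f := fun _ v => X (pair (v 0) (v 0 + 1))) inferInstance
      fun _ v => ((hp W (v 0)).poly_code (v 0)).symm)
  have hrW : ∀ n, val (r W fun _ => n) = digitSum (fun n => p W n n) n :=
    fun n => (hrv W fun _ => n).symm
  refine ⟨_, h2, h1, ⟨_, ratSeq_codes hrW⟩, fun hBW v' p' hp' u w hb' => ?_⟩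
  have hpp : (fun n => p W n n) = fun n => p' n n :=
    funext fun n => (hp W).diagonal_eq hp' n n
  exact hst_of_bw hX hp' hb' (hpp ▸ hrW) hBW

end SOA

end

theorem mainTheorem2 :
    ∃ e₁ e₂ : OracleCode 1, ∀ (M : Type*) [NumStr M] (S : Set (Set M)), IsModelRCA0 M S →
      (∀ X : M → M, Internal S X → IsHSTInstance X →
        ∃ Y : M → M, Internal S Y ∧ Computes e₁ X Y ∧ IsBWInstance Y ∧ (BW S Y → HST S X)) ∧
      (∀ X : M → M, Internal S X → IsBWInstance X →
        ∃ Y : M → M, Internal S Y ∧ Computes e₂ X Y ∧ IsHSTInstance Y ∧ (HST S Y → BW S X)) := by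
  obtain ⟨e₁, h₁⟩ := SOA.exists_code_digits
  obtain ⟨e₂, h₂⟩ := SOA.exists_code_constSeq
  exact ⟨e₁, e₂, fun M _ S hS => ⟨h₁ M S hS, h₂ M S hS⟩⟩
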